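/- Let $X$ be a smooth manifold (Hausdorff, second countable, without boundary) of dimension $n+1$, oriented by a volume form $\eta$, and let $\pi_{XY}:Y\to X$ be a smooth fibre bundle of rank $N$. Let $J^1Y\to Y$ be the first jet bundle (its fibre over $y\in Y_x$ consists of the linear maps $\gamma:T_xX\to T_yY$ with $T\pi_{XY}\circ\gamma=\mathrm{id}$), let $Z\subset\Lambda^{n+1}T^*Y$ be the bundle of $(n+1)$-forms on $Y$ that vanish whenever two of their arguments are vertical, and let $M=J^1Y\times_Y Z$ be the Pontryagin bundle, with projections $\pi_{XM}:M\to X$ and $\pi_{ZM}:M\to Z$. Let $\Theta$ be the canonical form on $Z$, $\Theta(z)=\pi_{YZ}^*z$, put $\Omega=-\mathbf d\Theta$, $\Theta_M=\pi_{ZM}^*\Theta$, $\Omega_M=\pi_{ZM}^*\Omega$. Let $\mathcal L=L\eta$ with $L:J^1Y\to\mathbb R$ smooth be a (possibly degenerate) Lagrangian density, let $\mathcal E(\gamma,z)=\gamma^*z-\mathcal L(\gamma)$ be the generalized energy density, also regarded as an $(n+1)$-form on $M$, and put $\Omega_{\mathcal E}=\Omega_M+\mathbf d\mathcal E$. In bundle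 coordinates $(x^\mu,y^A)$ on $Y$ write $\mathcal L=L(x,y,v)\,d^{n+1}x$, and let $(x^\mu,y^A,v^A_\mu,p,p^\mu_A)$ be the induced coordinates on $M$, where $\gamma=dx^\mu\otimes(\partial_\mu+v^A_\mu\,\partial/\partial y^A)$ and $z=p\,d^{n+1}x+p^\mu_A\,dy^A\wedge d^nx_\mu$, with $d^nx_\mu=\partial_\mu\lrcorner\, d^{n+1}x$. For open $U\subset X$ with compact closure put $S_U(\psi)=\int_U\psi^*(\Theta_M-\mathcal E)$. A smooth section $\psi$ of $\pi_{XM}$ is a critical point of the Hamilton-Pontryagin action if $\frac{d}{d\lambda}\big|_{\lambda=0}S_U(\eta_\lambda\circ\psi)=0$ for all such $U$ and all smooth one-parameter families of diffeomorphisms $\eta_\lambda:M\to M$ with $\pi_{XM}\circ\eta_\lambda=\pi_{XM}$, $\eta_0=\mathrm{id}$, and $\eta_\lambda=\mathrm{id}$ outside a compact subset of $\pi_{XM}^{-1}(U)$. **Theorem.** Let $\psi=(\gamma,z):X\to M$ be a smooth section of $\pi_{XM}$. (a) The following are equivalent: (1) $\psi$ is a critical point of the Hamilton-Pontryagin action;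 (2) $\psi^*(\mathcal V\lrcorner\,\Omega_{\mathcal E})=0$ for every smooth $\pi_{XM}$-vertical vector field $\mathcal V$ on $M$; (3') in all bundle coordinates $\psi$ satisfies the implicit Euler-Lagrange equations $$\frac{\partial y^A}{\partial x^\mu}=v^A_\mu,\qquad \frac{\partial p^\mu_A}{\partial x^\mu}=\frac{\partial L}{\partial y^A},\qquad p^\mu_A=\frac{\partial L}{\partial v^A_\mu}.$$ (b) If moreover $\psi$ satisfies the generalized energy constraint $\mathcal E\circ\psi=0$ (in coordinates $p+p^\mu_Av^A_\mu-L=0$), then (1) and (2) are equivalent to (3) in all bundle coordinates $\psi$ satisfies the implicit Euler-Lagrange equations together with the covariant Legendre transformation $$p^\mu_A=\frac{\partial L}{\partial v^A_\mu},\qquad p=L-\frac{\partial L}{\partial v^A_\mu}v^A_\mu .$$ (c) Conversely, every $\psi$ that satisfies (3) satisfies $\mathcal E\circ\psi=0$. -/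

import Mathlib

open Set Function Bundle
open scoped Manifold ContDiff Topology

noncomputable section

namespace HamiltonPontryagin

/-! ### Differential forms on a boundaryless manifold -/

section Forms

variable {E : Type*} [NormedAddCommGroup E] [NormedSpace ℝ E]
  {P : Type*} [TopologicalSpace P] [ChartedSpace E P]
  {E' : Type*} [NormedAddCommGroup E'] [NormedSpace ℝ E']
  {Q : Type*} [TopologicalSpace Q] [ChartedSpace E' Q]

/-- A (not necessarily smooth) differential `k`-form on the manifold `P` modelled on `E`. -/
abbrev DiffForm (E : Type*) [NormedAddCommGroup E] [NormedSpace ℝ E]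
    (P : Type*) [TopologicalSpace P] [ChartedSpace E P] (k : ℕ) : Type _ :=
  ∀ p : P, TangentSpace 𝓘(ℝ, E) p [⋀^Fin k]→L[ℝ] ℝ

/-- The expression of a form in the preferred chart around `p₀`, i.e. its pullback along the
inverse of that chart; meaningful on the target of the chart. -/
def formInChart {k : ℕ} (α : DiffForm E P k) (p₀ : P) (a : E) : E [⋀^Fin k]→L[ℝ] ℝ :=
  (α ((chartAt E p₀).symm a)).compContinuousLinearMap
    (mfderiv 𝓘(ℝ, E) 𝓘(ℝ, E) (chartAt E p₀).symm a)

/-- A form is smooth if all its chart expressions are. -/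
def IsSmoothForm {k : ℕ} (α : DiffForm E P k) : Prop :=
  ∀ p₀ : P, ContDiffOn ℝ ∞ (formInChart α p₀) (chartAt E p₀).target

/-- The exterior derivative: at `p`, differentiate the expression of the form in the preferred
chart at `p` and transport the result back by the derivative of the chart. -/
def dform {k : ℕ} (α : DiffForm E P k) : DiffForm E P (k + 1) := fun p =>
  (extDeriv (formInChart α p) (chartAt E p p)).compContinuousLinearMap
    (mfderiv 𝓘(ℝ, E) 𝓘(ℝ, E) (chartAt E p) p)

/-- The pullback `f^* α`. -/
def pullback {k : ℕ} (f : P → Q) (α : DiffForm E' Q k) : DiffForm E P k := fun p =>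
  (α (f p)).compContinuousLinearMap (mfderiv 𝓘(ℝ, E) 𝓘(ℝ, E') f p)

/-- The contraction `V ⌟ α`: insert `V` in the first slot. -/
def contract {k : ℕ} (V : ∀ p : P, TangentSpace 𝓘(ℝ, E) p) (α : DiffForm E P (k + 1)) :
    DiffForm E P k := fun p =>
  ContinuousAlternatingMap.curryLeft (E := E) (α p) (V p)

end Forms

/-! ### Volume forms and integration of top-degree forms -/

/-- The model space of the base. -/
abbrev BaseSp (n : ℕ) : Type := EuclideanSpace ℝ (Fin (n + 1))

/-- The model space of the fibres. -/
abbrev FibSp (N : ℕ) : Type := EuclideanSpace ℝ (Fin N)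

/-- The model space of the total space of a bundle. -/
abbrev TotSp (n N : ℕ) : Type := BaseSp n × FibSp N

/-- The coordinate vectors `∂_μ` of `ℝ^(n+1)`. -/
def baseVec {n : ℕ} (μ : Fin (n + 1)) : BaseSp n := EuclideanSpace.single μ 1

/-- The coordinate vectors `∂_A` of `ℝ^N`. -/
def fibVec {N : ℕ} (A : Fin N) : FibSp N := EuclideanSpace.single A 1

section Integration

variable {n : ℕ} {X : Type*} [TopologicalSpace X] [ChartedSpace (BaseSp n) X]

/-- A volume form: a smooth, nowhere vanishing form of top degree. -/
def IsVolumeForm (η : DiffForm (BaseSp n) X (n + 1)) : Prop :=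
  IsSmoothForm η ∧ ∀ x, η x ≠ 0

variable [IsManifold 𝓘(ℝ, BaseSp n) ∞ X] [T2Space X] [SigmaCompactSpace X]

/-- A smooth partition of unity subordinate to the domains of the preferred charts. -/
def chartPartition (n : ℕ) (X : Type*) [TopologicalSpace X] [ChartedSpace (BaseSp n) X]
    [IsManifold 𝓘(ℝ, BaseSp n) ∞ X] [T2Space X] [SigmaCompactSpace X] :
    SmoothPartitionOfUnity X 𝓘(ℝ, BaseSp n) X univ :=
  (SmoothPartitionOfUnity.exists_isSubordinate_chartAt_source 𝓘(ℝ, BaseSp n) X).choose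

lemma chartPartition_isSubordinate :
    (chartPartition n X).IsSubordinate (fun x => (chartAt (BaseSp n) x).source) :=
  (SmoothPartitionOfUnity.exists_isSubordinate_chartAt_source 𝓘(ℝ, BaseSp n) X).choose_spec

/-- The integral `∫_U α` of a form of top degree over a subset `U` of `X`, where `X` carries the
orientation for which the volume form `η` is positive: cut `α` into pieces by a partition of
unity subordinate to charts, and integrate each piece in its chart, with a minus sign where the
chart reverses the orientation. -/
def integralOn (η : DiffForm (BaseSp n) X (n + 1)) (U : Set X)
    (α : DiffForm (BaseSp n) X (n + 1)) : ℝ :=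
  ∑ᶠ i : X, ∫ a in (chartAt (BaseSp n) i).target ∩ (chartAt (BaseSp n) i).symm ⁻¹' U,
    chartPartition n X i ((chartAt (BaseSp n) i).symm a) *
      (Real.sign (formInChart η i a baseVec) * formInChart α i a baseVec)

end Integration

/-! ### Smooth fibre bundles and adapted charts -/

/-- A smooth fibre bundle `Y → X` with typical fibre `F`, where `dim X = n + 1` and
`dim F = N`: every point of `X` lies in the base set of a smooth local trivialization. -/
structure SmoothFiberBundle (n N : ℕ) (X Y F : Type*)
    [TopologicalSpace X] [ChartedSpace (BaseSp n) X]
    [TopologicalSpace Y] [ChartedSpace (TotSp n N) Y]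
    [TopologicalSpace F] [ChartedSpace (FibSp N) F] where
  proj : Y → X
  exists_trivialization : ∀ x : X, ∃ e : Trivialization F proj, x ∈ e.baseSet ∧
    ContMDiffOn 𝓘(ℝ, TotSp n N) (𝓘(ℝ, BaseSp n).prod 𝓘(ℝ, FibSp N)) ∞ e e.source ∧
    ContMDiffOn (𝓘(ℝ, BaseSp n).prod 𝓘(ℝ, FibSp N)) 𝓘(ℝ, TotSp n N) ∞
      e.toOpenPartialHomeomorph.symm e.target

variable {n N : ℕ} {X Y F : Type*}
  [TopologicalSpace X] [ChartedSpace (BaseSp n) X]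
  [TopologicalSpace Y] [ChartedSpace (TotSp n N) Y]
  [TopologicalSpace F] [ChartedSpace (FibSp N) F]

/-- Bundle coordinates `(x^μ, y^A)`: a smooth chart of `Y` together with a smooth chart of `X`
such that the first component of the former is the latter composed with the projection. -/
structure AdaptedChart (B : SmoothFiberBundle n N X Y F) where
  chart : OpenPartialHomeomorph Y (TotSp n N)
  base : OpenPartialHomeomorph X (BaseSp n)
  smooth_chart : ContMDiffOn 𝓘(ℝ, TotSp n N) 𝓘(ℝ, TotSp n N) ∞ chart chart.source
  smooth_chart_symm :
    ContMDiffOn 𝓘(ℝ, TotSp n N) 𝓘(ℝ, TotSp n N) ∞ chart.symm chart.target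
  smooth_base : ContMDiffOn 𝓘(ℝ, BaseSp n) 𝓘(ℝ, BaseSp n) ∞ base base.source
  smooth_base_symm : ContMDiffOn 𝓘(ℝ, BaseSp n) 𝓘(ℝ, BaseSp n) ∞ base.symm base.target
  proj_mem : ∀ y ∈ chart.source, B.proj y ∈ base.source
  fst_chart : ∀ y ∈ chart.source, (chart y).1 = base (B.proj y)

namespace SmoothFiberBundle

variable (B : SmoothFiberBundle n N X Y F)

/-- The tangent map of the bundle projection. -/
def dproj (y : Y) :
    TangentSpace 𝓘(ℝ, TotSp n N) y →L[ℝ] TangentSpace 𝓘(ℝ, BaseSp n) (B.proj y) :=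
  mfderiv 𝓘(ℝ, TotSp n N) 𝓘(ℝ, BaseSp n) B.proj y

lemma contMDiff_proj : ContMDiff 𝓘(ℝ, TotSp n N) 𝓘(ℝ, BaseSp n) ∞ B.proj := by
  intro y
  obtain ⟨e, he, h1, -⟩ := B.exists_trivialization (B.proj y)
  have hy : y ∈ e.source := by rw [e.source_eq]; exact he
  have h2 := (h1.contMDiffAt (e.open_source.mem_nhds hy))
  have h3 : ContMDiffAt 𝓘(ℝ, TotSp n N) 𝓘(ℝ, BaseSp n) ∞ (fun y => (e y).1) y :=
    contMDiffAt_fst.comp y h2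
  refine h3.congr_of_eventuallyEq ?_
  filter_upwards [e.open_source.mem_nhds hy] with z hz
  exact (e.proj_toFun z hz).symm

lemma exists_adaptedChart [IsManifold 𝓘(ℝ, BaseSp n) ∞ X] [IsManifold 𝓘(ℝ, FibSp N) ∞ F]
    (y : Y) : ∃ e : AdaptedChart B, y ∈ e.chart.source := by
  obtain ⟨e, he, h1, h2⟩ := B.exists_trivialization (B.proj y)
  have hy : y ∈ e.source := by rw [e.source_eq]; exact he
  set c := chartAt (BaseSp n) (B.proj y) with hc
  set d := chartAt (FibSp N) (e y).2 with hd
  have hp : ∀ z ∈ e.source, (e z).1 = B.proj z := e.proj_toFun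
  have hc1 : ContMDiffOn 𝓘(ℝ, BaseSp n) 𝓘(ℝ, BaseSp n) ∞ c c.source := contMDiffOn_chart
  have hc2 : ContMDiffOn 𝓘(ℝ, BaseSp n) 𝓘(ℝ, BaseSp n) ∞ c.symm c.target :=
    contMDiffOn_chart_symm
  have hd1 : ContMDiffOn 𝓘(ℝ, FibSp N) 𝓘(ℝ, FibSp N) ∞ d d.source := contMDiffOn_chart
  have hd2 : ContMDiffOn 𝓘(ℝ, FibSp N) 𝓘(ℝ, FibSp N) ∞ d.symm d.target :=
    contMDiffOn_chart_symm
  have hcd1 := hc1.prodMap hd1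
  have hcd2 := hc2.prodMap hd2
  refine ⟨⟨e.toOpenPartialHomeomorph ≫ₕ c.prod d, c, ?_, ?_, hc1, hc2, ?_, ?_⟩, ?_⟩
  · have := hcd1.comp (t := c.source ×ˢ d.source)
      (s := (e.toOpenPartialHomeomorph ≫ₕ c.prod d).source) (h1.mono ?_) ?_
    · rw [modelWithCornersSelf_prod, ← chartedSpaceSelf_prod]
      rw [modelWithCornersSelf_prod] at this
      exact this
    · intro z hz; exact hz.1
    · intro z hz; exact hz.2
  · have := h2.comp (t := e.target)
      (s := (e.toOpenPartialHomeomorph ≫ₕ c.prod d).target)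
      (f := (c.prod d).symm) (hcd2.mono ?_) ?_
    · rw [modelWithCornersSelf_prod, ← chartedSpaceSelf_prod]
      rw [modelWithCornersSelf_prod] at this
      exact this
    · intro z hz; exact hz.1
    · intro z hz; exact hz.2
  · intro z hz
    rw [← hp z hz.1]
    exact hz.2.1
  · intro z hz
    change c (e z).1 = _
    rw [hp z hz.1]
  · refine ⟨hy, ?_, ?_⟩
    · change (e y).1 ∈ c.source
      rw [hp y hy]; exact mem_chart_source _ _
    · exact mem_chart_source _ _

end SmoothFiberBundle


/-! ### Derivatives of adapted charts -/

namespace AdaptedChart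

variable {B : SmoothFiberBundle n N X Y F} (e e' : AdaptedChart B)

/-- The derivative at `y` of the chart of the total space. -/
def dchart (y : Y) : TangentSpace 𝓘(ℝ, TotSp n N) y →L[ℝ] TotSp n N :=
  mfderiv 𝓘(ℝ, TotSp n N) 𝓘(ℝ, TotSp n N) e.chart y

/-- The derivative of the inverse of the chart of the total space, at the image of `y`; it sends
coordinate vectors to the coordinate vector fields at `y`. -/
def dchartSymm (y : Y) : TotSp n N →L[ℝ] TangentSpace 𝓘(ℝ, TotSp n N) y :=
  mfderiv 𝓘(ℝ, TotSp n N) 𝓘(ℝ, TotSp n N) e.chart.symm (e.chart y)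

/-- The derivative at `x` of the chart of the base. -/
def dbase (x : X) : TangentSpace 𝓘(ℝ, BaseSp n) x →L[ℝ] BaseSp n :=
  mfderiv 𝓘(ℝ, BaseSp n) 𝓘(ℝ, BaseSp n) e.base x

/-- The derivative of the inverse of the chart of the base, at the image of `x`; it sends
coordinate vectors to the coordinate vector fields at `x`. -/
def dbaseSymm (x : X) : BaseSp n →L[ℝ] TangentSpace 𝓘(ℝ, BaseSp n) x :=
  mfderiv 𝓘(ℝ, BaseSp n) 𝓘(ℝ, BaseSp n) e.base.symm (e.base x)

lemma mdiff_chart : e.chart.MDifferentiable 𝓘(ℝ, TotSp n N) 𝓘(ℝ, TotSp n N) :=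
  ⟨e.smooth_chart.mdifferentiableOn (by simp), e.smooth_chart_symm.mdifferentiableOn (by simp)⟩

lemma mdiff_base : e.base.MDifferentiable 𝓘(ℝ, BaseSp n) 𝓘(ℝ, BaseSp n) :=
  ⟨e.smooth_base.mdifferentiableOn (by simp), e.smooth_base_symm.mdifferentiableOn (by simp)⟩

variable {e e'} in
lemma dchartSymm_dchart {y : Y} (hy : y ∈ e.chart.source)
    (u : TangentSpace 𝓘(ℝ, TotSp n N) y) : e.dchartSymm y (e.dchart y u) = u :=
  congrArg (fun T : TotSp n N →L[ℝ] TotSp n N => T u) (e.mdiff_chart.symm_comp_deriv hy)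

variable {e e'} in
lemma dchart_dchartSymm {y : Y} (hy : y ∈ e.chart.source) (u : TotSp n N) :
    e.dchart y (e.dchartSymm y u) = u := by
  have h := e.mdiff_chart.symm.symm_comp_deriv (x := e.chart y) (e.chart.map_source hy)
  have h2 := congrArg (fun T : TotSp n N →L[ℝ] TotSp n N => T u) h
  simp only [OpenPartialHomeomorph.symm_symm] at h2
  have h3 : e.chart.symm (e.chart y) = y := e.chart.left_inv hy
  rw [h3] at h2
  exact h2

variable {e e'} in
lemma dbaseSymm_dbase {x : X} (hx : x ∈ e.base.source)
    (u : TangentSpace 𝓘(ℝ, BaseSp n) x) : e.dbaseSymm x (e.dbase x u) = u :=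
  congrArg (fun T : BaseSp n →L[ℝ] BaseSp n => T u) (e.mdiff_base.symm_comp_deriv hx)

variable {e e'} in
lemma dbase_dbaseSymm {x : X} (hx : x ∈ e.base.source) (u : BaseSp n) :
    e.dbase x (e.dbaseSymm x u) = u := by
  have h := e.mdiff_base.symm.symm_comp_deriv (x := e.base x) (e.base.map_source hx)
  have h2 := congrArg (fun T : BaseSp n →L[ℝ] BaseSp n => T u) h
  simp only [OpenPartialHomeomorph.symm_symm] at h2
  have h3 : e.base.symm (e.base x) = x := e.base.left_inv hx
  rw [h3] at h2
  exact h2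

variable {e e'} in
lemma fst_dchart {y : Y} (hy : y ∈ e.chart.source) (u : TangentSpace 𝓘(ℝ, TotSp n N) y) :
    (e.dchart y u).1 = e.dbase (B.proj y) (B.dproj y u) := by
  have h1 : HasMFDerivAt 𝓘(ℝ, TotSp n N) 𝓘(ℝ, TotSp n N) e.chart y (e.dchart y) :=
    (e.mdiff_chart.mdifferentiableAt hy).hasMFDerivAt
  have h2 : HasMFDerivAt 𝓘(ℝ, TotSp n N) 𝓘(ℝ, BaseSp n) B.proj y (B.dproj y) :=
    (B.contMDiff_proj.mdifferentiableAt (by simp)).hasMFDerivAt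
  have h3 : HasMFDerivAt 𝓘(ℝ, BaseSp n) 𝓘(ℝ, BaseSp n) e.base (B.proj y)
      (e.dbase (B.proj y)) :=
    (e.mdiff_base.mdifferentiableAt (e.proj_mem y hy)).hasMFDerivAt
  have h4 := h3.comp y h2
  have h5 : HasMFDerivAt 𝓘(ℝ, TotSp n N) 𝓘(ℝ, BaseSp n)
      (fun q : TotSp n N => q.1) (e.chart y) (ContinuousLinearMap.fst ℝ (BaseSp n) (FibSp N)) :=
    (ContinuousLinearMap.fst ℝ (BaseSp n) (FibSp N)).hasMFDerivAt
  have h6 := h5.comp y h1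
  have h7 := h4.congr_of_eventuallyEq (f₁ := (fun q : TotSp n N => q.1) ∘ e.chart) (by
    filter_upwards [e.chart.open_source.mem_nhds hy] with z hz
    exact e.fst_chart z hz)
  exact congrArg (fun T : TotSp n N →L[ℝ] BaseSp n => T u) (hasMFDerivAt_unique h6 h7)

/-- The change of coordinates of the total space. -/
def change (q : TotSp n N) : TotSp n N := e'.chart (e.chart.symm q)

/-- The change of coordinates of the base. -/
def baseChange (a : BaseSp n) : BaseSp n := e'.base (e.base.symm a)

lemma contDiffOn_change :
    ContDiffOn ℝ ∞ (change e e') (e.chart.symm ≫ₕ e'.chart).source := by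
  rw [← contMDiffOn_iff_contDiffOn]
  exact e'.smooth_chart.comp (e.smooth_chart_symm.mono fun q hq => hq.1) fun q hq => hq.2

lemma contDiffOn_baseChange :
    ContDiffOn ℝ ∞ (baseChange e e') (e.base.symm ≫ₕ e'.base).source := by
  rw [← contMDiffOn_iff_contDiffOn]
  exact e'.smooth_base.comp (e.smooth_base_symm.mono fun q hq => hq.1) fun q hq => hq.2

variable {e e'} in
lemma fderiv_change {y : Y} (hy : y ∈ e.chart.source) (hy' : y ∈ e'.chart.source)
    (u : TotSp n N) :
    fderiv ℝ (change e e') (e.chart y) u = e'.dchart y (e.dchartSymm y u) := by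
  have h0 : e.chart.symm (e.chart y) = y := e.chart.left_inv hy
  have h1 : HasMFDerivAt 𝓘(ℝ, TotSp n N) 𝓘(ℝ, TotSp n N) e'.chart
      (e.chart.symm (e.chart y)) (e'.dchart y) := by
    rw [h0]
    exact (e'.mdiff_chart.mdifferentiableAt hy').hasMFDerivAt
  have h2 : HasMFDerivAt 𝓘(ℝ, TotSp n N) 𝓘(ℝ, TotSp n N) e.chart.symm (e.chart y)
      (e.dchartSymm y) :=
    (e.mdiff_chart.mdifferentiableAt_symm (e.chart.map_source hy)).hasMFDerivAt
  have h3 : HasFDerivAt (change e e') (show TotSp n N →L[ℝ] TotSp n N from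
      (show TotSp n N →L[ℝ] TotSp n N from e'.dchart y).comp (e.dchartSymm y)) (e.chart y) :=
    hasMFDerivAt_iff_hasFDerivAt.1 (h1.comp (e.chart y) h2)
  exact congrArg (fun T : TotSp n N →L[ℝ] TotSp n N => T u) h3.fderiv

variable {e e'} in
lemma fderiv_baseChange {x : X} (hx : x ∈ e.base.source) (hx' : x ∈ e'.base.source)
    (u : BaseSp n) :
    fderiv ℝ (baseChange e e') (e.base x) u = e'.dbase x (e.dbaseSymm x u) := by
  have h0 : e.base.symm (e.base x) = x := e.base.left_inv hx
  have h1 : HasMFDerivAt 𝓘(ℝ, BaseSp n) 𝓘(ℝ, BaseSp n) e'.base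
      (e.base.symm (e.base x)) (e'.dbase x) := by
    rw [h0]
    exact (e'.mdiff_base.mdifferentiableAt hx').hasMFDerivAt
  have h2 : HasMFDerivAt 𝓘(ℝ, BaseSp n) 𝓘(ℝ, BaseSp n) e.base.symm (e.base x)
      (e.dbaseSymm x) :=
    (e.mdiff_base.mdifferentiableAt_symm (e.base.map_source hx)).hasMFDerivAt
  have h3 : HasFDerivAt (baseChange e e') (show BaseSp n →L[ℝ] BaseSp n from
      (show BaseSp n →L[ℝ] BaseSp n from e'.dbase x).comp (e.dbaseSymm x)) (e.base x) :=
    hasMFDerivAt_iff_hasFDerivAt.1 (h1.comp (e.base x) h2)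
  exact congrArg (fun T : BaseSp n →L[ℝ] BaseSp n => T u) h3.fderiv

end AdaptedChart

/-! ### Manifold structure on a bundle over `Y` from fibre coordinates -/

/-- Fibre coordinates with values in `K` for a family `Fib` of types over `Y`, one system for each
adapted chart, with smooth transition maps. -/
structure FiberCoords (B : SmoothFiberBundle n N X Y F) (K : Type*) [NormedAddCommGroup K]
    [NormedSpace ℝ K] (Fib : Y → Type*) where
  coord : ∀ (e : AdaptedChart B) (y : Y), y ∈ e.chart.source → (Fib y ≃ K)
  smooth : ∀ e e' : AdaptedChart B, ∃ T : TotSp n N × K → K,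
    ContDiffOn ℝ ∞ T ((e.chart.symm ≫ₕ e'.chart).source ×ˢ univ) ∧
    ∀ (y : Y) (hy : y ∈ e.chart.source) (hy' : y ∈ e'.chart.source) (b : Fib y),
      coord e' y hy' b = T (e.chart y, coord e y hy b)

namespace FiberCoords

variable {B : SmoothFiberBundle n N X Y F} {K : Type*} [NormedAddCommGroup K]
    [NormedSpace ℝ K] {Fib : Y → Type*} (C : FiberCoords B K Fib)

open Classical in
/-- The coordinates of a point of the total space (zero outside the domain of `e`). -/
def totalFun (e : AdaptedChart B) (m : TotalSpace K Fib) : TotSp n N × K :=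
  if h : m.proj ∈ e.chart.source then (e.chart m.proj, C.coord e m.proj h m.2) else 0

open Classical in
/-- The point with given coordinates (the default value `m₀` outside the target of `e`). -/
def totalInv (e : AdaptedChart B) (m₀ : TotalSpace K Fib) (q : TotSp n N × K) :
    TotalSpace K Fib :=
  if h : q.1 ∈ e.chart.target then
    ⟨e.chart.symm q.1, (C.coord e (e.chart.symm q.1) (e.chart.map_target h)).symm q.2⟩ else m₀

lemma totalFun_of_mem (e : AdaptedChart B) {m : TotalSpace K Fib}
    (h : m.proj ∈ e.chart.source) :
    C.totalFun e m = (e.chart m.proj, C.coord e m.proj h m.2) := dif_pos h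

lemma totalInv_of_mem (e : AdaptedChart B) (m₀ : TotalSpace K Fib) {q : TotSp n N × K}
    (h : q.1 ∈ e.chart.target) :
    C.totalInv e m₀ q =
      ⟨e.chart.symm q.1, (C.coord e (e.chart.symm q.1) (e.chart.map_target h)).symm q.2⟩ :=
  dif_pos h

/-- The chart of the total space induced by an adapted chart. -/
def totalChart (e : AdaptedChart B) (m₀ : TotalSpace K Fib) :
    PartialEquiv (TotalSpace K Fib) (TotSp n N × K) where
  toFun := C.totalFun e
  invFun := C.totalInv e m₀
  source := {m | m.proj ∈ e.chart.source}
  target := {q | q.1 ∈ e.chart.target}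
  map_source' m hm := by
    have hm' : m.proj ∈ e.chart.source := hm
    rw [C.totalFun_of_mem e hm']
    exact e.chart.map_source hm'
  map_target' q hq := by
    have hq' : q.1 ∈ e.chart.target := hq
    rw [C.totalInv_of_mem e m₀ hq']
    exact e.chart.map_target hq'
  left_inv' m hm := by
    obtain ⟨y, b⟩ := m
    have hm' : y ∈ e.chart.source := hm
    have h2 : e.chart y ∈ e.chart.target := e.chart.map_source hm'
    rw [C.totalFun_of_mem e (m := ⟨y, b⟩) hm', C.totalInv_of_mem e m₀ h2]
    have key : ∀ (y' : Y) (hy' : y' ∈ e.chart.source), y' = y →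
        (⟨y', (C.coord e y' hy').symm (C.coord e y hm' b)⟩ : TotalSpace K Fib) = ⟨y, b⟩ := by
      rintro y' hy' rfl
      rw [Equiv.symm_apply_apply]
    exact key _ (e.chart.map_target h2) (e.chart.left_inv hm')
  right_inv' q hq := by
    have hq' : q.1 ∈ e.chart.target := hq
    have h2 : e.chart.symm q.1 ∈ e.chart.source := e.chart.map_target hq'
    rw [C.totalInv_of_mem e m₀ hq', C.totalFun_of_mem e (m := ⟨e.chart.symm q.1, _⟩) h2]
    rw [Equiv.apply_symm_apply, e.chart.right_inv hq']

lemma transition_source (e e' : AdaptedChart B) (m m' : TotalSpace K Fib) :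
    ((C.totalChart e m).symm.trans (C.totalChart e' m')).source =
      (e.chart.symm ≫ₕ e'.chart).source ×ˢ univ := by
  ext q
  constructor
  · rintro ⟨h1, h2⟩
    have h1' : q.1 ∈ e.chart.target := h1
    have h3 : (C.totalInv e m q).proj ∈ e'.chart.source := h2
    rw [C.totalInv_of_mem e m h1'] at h3
    exact ⟨⟨h1', h3⟩, trivial⟩
  · rintro ⟨⟨h1, h2⟩, -⟩
    have h1' : q.1 ∈ e.chart.target := h1
    refine ⟨h1', ?_⟩
    change (C.totalInv e m q).proj ∈ e'.chart.source
    rw [C.totalInv_of_mem e m h1']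
    exact h2

lemma contDiffOn_transition (e e' : AdaptedChart B) (m m' : TotalSpace K Fib) :
    ContDiffOn ℝ ∞ ((C.totalChart e m).symm.trans (C.totalChart e' m'))
      ((C.totalChart e m).symm.trans (C.totalChart e' m')).source := by
  rw [transition_source]
  obtain ⟨T, hT, hT2⟩ := C.smooth e e'
  have h1 : ContDiffOn ℝ ∞ (fun q : TotSp n N × K => (AdaptedChart.change e e' q.1, T q))
      ((e.chart.symm ≫ₕ e'.chart).source ×ˢ univ) :=
    ((AdaptedChart.contDiffOn_change e e').comp contDiffOn_fst fun q hq => hq.1).prodMk hT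
  refine h1.congr ?_
  rintro q ⟨⟨ha, hb⟩, -⟩
  have ha' : q.1 ∈ e.chart.target := ha
  have hb' : e.chart.symm q.1 ∈ e'.chart.source := hb
  change C.totalFun e' (C.totalInv e m q) = _
  rw [C.totalInv_of_mem e m ha', C.totalFun_of_mem e' (m := ⟨e.chart.symm q.1, _⟩) hb']
  rw [hT2 _ (e.chart.map_target ha') hb', Equiv.apply_symm_apply, e.chart.right_inv ha']
  rfl

variable [IsManifold 𝓘(ℝ, BaseSp n) ∞ X] [IsManifold 𝓘(ℝ, FibSp N) ∞ F]

/-- The atlas of all charts induced by adapted charts. -/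
def core : ChartedSpaceCore (TotSp n N × K) (TotalSpace K Fib) where
  atlas := {c | ∃ e m, c = C.totalChart e m}
  chartAt m := C.totalChart (B.exists_adaptedChart m.proj).choose m
  mem_chart_source m := (B.exists_adaptedChart m.proj).choose_spec
  chart_mem_atlas m := ⟨_, _, rfl⟩
  open_source := by
    rintro _ _ ⟨e, m, rfl⟩ ⟨e', m', rfl⟩
    rw [transition_source]
    exact (e.chart.symm ≫ₕ e'.chart).open_source.prod isOpen_univ
  continuousOn_toFun := by
    rintro _ _ ⟨e, m, rfl⟩ ⟨e', m', rfl⟩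
    exact (C.contDiffOn_transition e e' m m').continuousOn

lemma isManifold_core :
    @IsManifold ℝ _ (TotSp n N × K) _ _ (TotSp n N × K) _ 𝓘(ℝ, TotSp n N × K) ∞
      (TotalSpace K Fib) C.core.toTopologicalSpace C.core.toChartedSpace := by
  let _ := C.core.toTopologicalSpace
  let _ := C.core.toChartedSpace
  refine isManifold_of_contDiffOn _ _ _ ?_
  intro c c' hc hc'
  obtain ⟨_, ⟨c1, rfl⟩, hc⟩ := hc
  obtain ⟨_, ⟨c2, rfl⟩, hc'⟩ := hc'
  obtain ⟨_, ⟨⟨e, m, rfl⟩, rfl⟩, rfl⟩ := hc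
  obtain ⟨_, ⟨⟨e', m', rfl⟩, rfl⟩, rfl⟩ := hc'
  have := C.contDiffOn_transition e e' m m'
  simp only [modelWithCornersSelf_coe, modelWithCornersSelf_coe_symm, range_id, inter_univ,
    preimage_id, Function.comp_id, Function.id_comp]
  exact this

/-- Fibre coordinates on a fibre product over `Y`. -/
def prod {K' : Type*} [NormedAddCommGroup K'] [NormedSpace ℝ K'] {Fib' : Y → Type*}
    (C : FiberCoords B K Fib) (C' : FiberCoords B K' Fib') :
    FiberCoords B (K × K') (fun y => Fib y × Fib' y) where
  coord e y hy := (C.coord e y hy).prodCongr (C'.coord e y hy)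
  smooth e e' := by
    obtain ⟨T, hT, hT2⟩ := C.smooth e e'
    obtain ⟨T', hT', hT2'⟩ := C'.smooth e e'
    refine ⟨fun q => (T (q.1, q.2.1), T' (q.1, q.2.2)), ?_, ?_⟩
    · refine (hT.comp (contDiff_fst.prodMk (contDiff_fst.comp contDiff_snd)).contDiffOn
        fun q hq => ⟨hq.1, trivial⟩).prodMk
        (hT'.comp (contDiff_fst.prodMk (contDiff_snd.comp contDiff_snd)).contDiffOn
        fun q hq => ⟨hq.1, trivial⟩)
    · rintro y hy hy' ⟨b, b'⟩
      exact Prod.ext (hT2 y hy hy' b) (hT2' y hy hy' b')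

end FiberCoords

/-! ### The first jet bundle -/

section Jets

variable (B : SmoothFiberBundle n N X Y F)

/-- The fibre of `J¹Y` at `y`: linear maps `γ : T_x X → T_y Y` with `Tπ ∘ γ = id`, `x = π y`. -/
def JetFiber (y : Y) : Type :=
  {γ : TangentSpace 𝓘(ℝ, BaseSp n) (B.proj y) →L[ℝ] TangentSpace 𝓘(ℝ, TotSp n N) y //
    ∀ h, B.dproj y (γ h) = h}

variable {B}

/-- The coordinates `v^A_μ` of a jet, as a linear map `ℝ^(n+1) → ℝ^N`. -/
def AdaptedChart.jetCoord (e : AdaptedChart B) (y : Y) (γ : JetFiber B y) :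
    BaseSp n →L[ℝ] FibSp N :=
  (ContinuousLinearMap.snd ℝ (BaseSp n) (FibSp N)).comp
    ((e.dchart y).comp (γ.1.comp (e.dbaseSymm (B.proj y))))

/-- The jet with given coordinates. -/
def AdaptedChart.jetOfCoord (e : AdaptedChart B) {y : Y} (hy : y ∈ e.chart.source)
    (v : BaseSp n →L[ℝ] FibSp N) : JetFiber B y :=
  ⟨(e.dchartSymm y).comp (((ContinuousLinearMap.id ℝ (BaseSp n)).prod v).comp
      (e.dbase (B.proj y))), by
    intro h
    have h1 := AdaptedChart.fst_dchart hy (e.dchartSymm y (e.dbase (B.proj y) h,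
      v (e.dbase (B.proj y) h)))
    rw [AdaptedChart.dchart_dchartSymm hy] at h1
    have h2 := congrArg (e.dbaseSymm (B.proj y)) h1
    rw [AdaptedChart.dbaseSymm_dbase (e.proj_mem y hy)] at h2
    rw [AdaptedChart.dbaseSymm_dbase (e.proj_mem y hy)] at h2
    exact h2.symm⟩

/-- Jet coordinates as a bijection on each fibre. -/
def AdaptedChart.jetEquiv (e : AdaptedChart B) (y : Y) (hy : y ∈ e.chart.source) :
    JetFiber B y ≃ (BaseSp n →L[ℝ] FibSp N) where
  toFun := e.jetCoord y
  invFun := e.jetOfCoord hy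
  left_inv γ := by
    apply Subtype.ext
    apply ContinuousLinearMap.ext
    intro h
    have h1 : e.dchart y (γ.1 h) = (e.dbase (B.proj y) h, (e.dchart y (γ.1 h)).2) := by
      refine Prod.ext ?_ rfl
      rw [AdaptedChart.fst_dchart hy, γ.2 h]
    have h2 := AdaptedChart.dchartSymm_dchart hy (γ.1 h)
    have h3 : e.dbaseSymm (B.proj y) (e.dbase (B.proj y) h) = h :=
      AdaptedChart.dbaseSymm_dbase (e.proj_mem y hy) h
    change e.dchartSymm y (e.dbase (B.proj y) h,
      (e.dchart y (γ.1 (e.dbaseSymm (B.proj y) (e.dbase (B.proj y) h)))).2) = γ.1 h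
    rw [h3, ← h1, h2]
  right_inv v := by
    apply ContinuousLinearMap.ext
    intro h
    change (e.dchart y (e.dchartSymm y (e.dbase (B.proj y) (e.dbaseSymm (B.proj y) h),
      v (e.dbase (B.proj y) (e.dbaseSymm (B.proj y) h))))).2 = v h
    rw [AdaptedChart.dchart_dchartSymm hy, AdaptedChart.dbase_dbaseSymm (e.proj_mem y hy)]

/-- The fibre coordinates `v^A_μ` on the jet bundle. -/
def jetCoords (B : SmoothFiberBundle n N X Y F) :
    FiberCoords B (BaseSp n →L[ℝ] FibSp N) (JetFiber B) where
  coord e y hy := e.jetEquiv y hy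
  smooth e e' := by
    refine ⟨fun q => (ContinuousLinearMap.snd ℝ (BaseSp n) (FibSp N)).comp
      ((fderiv ℝ (AdaptedChart.change e e') q.1).comp
        (((ContinuousLinearMap.inl ℝ (BaseSp n) (FibSp N)) +
          (ContinuousLinearMap.inr ℝ (BaseSp n) (FibSp N)).comp q.2).comp
          (fderiv ℝ (AdaptedChart.baseChange e' e) (AdaptedChart.change e e' q.1).1))),
      ?_, ?_⟩
    · have h1 : ContDiffOn ℝ ∞ (fun q : TotSp n N × (BaseSp n →L[ℝ] FibSp N) =>
          fderiv ℝ (AdaptedChart.change e e') q.1)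
          ((e.chart.symm ≫ₕ e'.chart).source ×ˢ univ) :=
        ((AdaptedChart.contDiffOn_change e e').fderiv_of_isOpen
          (e.chart.symm ≫ₕ e'.chart).open_source (by simp)).comp contDiffOn_fst
          fun q hq => hq.1
      have h2 : ContDiffOn ℝ ∞ (fun q : TotSp n N × (BaseSp n →L[ℝ] FibSp N) =>
          fderiv ℝ (AdaptedChart.baseChange e' e) (AdaptedChart.change e e' q.1).1)
          ((e.chart.symm ≫ₕ e'.chart).source ×ˢ univ) := by
        refine ((AdaptedChart.contDiffOn_baseChange e' e).fderiv_of_isOpen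
          (e'.base.symm ≫ₕ e.base).open_source (m := ∞) (by simp)).comp
          (contDiff_fst.comp_contDiffOn
            ((AdaptedChart.contDiffOn_change e e').comp contDiffOn_fst fun q hq => hq.1)) ?_
        rintro q ⟨⟨ha, hb⟩, -⟩
        have ha' : q.1 ∈ e.chart.target := ha
        have hb' : e.chart.symm q.1 ∈ e'.chart.source := hb
        have hc : (AdaptedChart.change e e' q.1).1 = e'.base (B.proj (e.chart.symm q.1)) :=
          e'.fst_chart _ hb'
        change (AdaptedChart.change e e' q.1).1 ∈ _
        rw [hc]
        refine ⟨e'.base.map_source (e'.proj_mem _ hb'), ?_⟩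
        change e'.base.symm _ ∈ e.base.source
        rw [e'.base.left_inv (e'.proj_mem _ hb')]
        exact e.proj_mem _ (e.chart.map_target ha')
      have h3 : ContDiffOn ℝ ∞ (fun q : TotSp n N × (BaseSp n →L[ℝ] FibSp N) =>
          (ContinuousLinearMap.inl ℝ (BaseSp n) (FibSp N)) +
          (ContinuousLinearMap.inr ℝ (BaseSp n) (FibSp N)).comp q.2)
          ((e.chart.symm ≫ₕ e'.chart).source ×ˢ univ) :=
        contDiffOn_const.add (contDiffOn_const.clm_comp contDiffOn_snd)
      exact contDiffOn_const.clm_comp (h1.clm_comp (h3.clm_comp h2))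
    · intro y hy hy' γ
      apply ContinuousLinearMap.ext
      intro h
      have hc : (AdaptedChart.change e e' (e.chart y)).1 = e'.base (B.proj y) := by
        change (e'.chart (e.chart.symm (e.chart y))).1 = _
        rw [e.chart.left_inv hy]
        exact e'.fst_chart y hy'
      have h1 : ∀ (k : BaseSp n) (w : FibSp N),
          (ContinuousLinearMap.inl ℝ (BaseSp n) (FibSp N)) k +
          (ContinuousLinearMap.inr ℝ (BaseSp n) (FibSp N)) w = (k, w) := by
        intro k w; simp
      change (e'.dchart y (γ.1 (e'.dbaseSymm (B.proj y) h))).2 =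
        (fderiv ℝ (AdaptedChart.change e e') (e.chart y)
          ((ContinuousLinearMap.inl ℝ (BaseSp n) (FibSp N))
            (fderiv ℝ (AdaptedChart.baseChange e' e)
              (AdaptedChart.change e e' (e.chart y)).1 h) +
          (ContinuousLinearMap.inr ℝ (BaseSp n) (FibSp N)) (e.jetCoord y γ
            (fderiv ℝ (AdaptedChart.baseChange e' e)
              (AdaptedChart.change e e' (e.chart y)).1 h)))).2
      rw [h1, hc, AdaptedChart.fderiv_baseChange (e'.proj_mem y hy') (e.proj_mem y hy),
        AdaptedChart.fderiv_change hy hy']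
      have h2 := congrArg Subtype.val ((e.jetEquiv y hy).left_inv γ)
      have h3 := congrArg (fun T : BaseSp n →L[ℝ] TotSp n N =>
        T (e'.dbaseSymm (B.proj y) h)) h2
      exact congrArg (fun u : TotSp n N => (e'.dchart y u).2) h3.symm

end Jets

/-! ### The dual jet bundle -/

section DualJets

variable (B : SmoothFiberBundle n N X Y F)

/-- The fibre of `Z ⊂ Λ^{n+1} T^*Y` at `y`: the `(n+1)`-forms on `T_y Y` that vanish when two of
their arguments are vertical. -/
def DualFiber (y : Y) : Type :=
  {z : TangentSpace 𝓘(ℝ, TotSp n N) y [⋀^Fin (n + 1)]→L[ℝ] ℝ //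
    ∀ (u : Fin (n + 1) → TangentSpace 𝓘(ℝ, TotSp n N) y) (i j : Fin (n + 1)), i ≠ j →
      B.dproj y (u i) = 0 → B.dproj y (u j) = 0 → z u = 0}

/-- The model fibre of `Z`: the `(n+1)`-forms on `ℝ^(n+1) × ℝ^N` that vanish when two of their
arguments are vertical. -/
def dualSubmodule (n N : ℕ) : Submodule ℝ (TotSp n N [⋀^Fin (n + 1)]→L[ℝ] ℝ) where
  carrier := {w | ∀ (u : Fin (n + 1) → TotSp n N) (i j : Fin (n + 1)), i ≠ j →
      (u i).1 = 0 → (u j).1 = 0 → w u = 0}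
  zero_mem' := fun _ _ _ _ _ _ => rfl
  add_mem' := by
    intro w w' h h' u i j hij hi hj
    change w u + w' u = 0
    rw [h u i j hij hi hj, h' u i j hij hi hj, add_zero]
  smul_mem' := by
    intro c w h u i j hij hi hj
    change c • w u = 0
    rw [h u i j hij hi hj, smul_zero]

/-- The model fibre of `Z` as a normed space. -/
def DualModel (n N : ℕ) : Type := dualSubmodule n N

instance : NormedAddCommGroup (DualModel n N) :=
  inferInstanceAs (NormedAddCommGroup (dualSubmodule n N))

instance : NormedSpace ℝ (DualModel n N) := inferInstanceAs (NormedSpace ℝ (dualSubmodule n N))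

/-- The values of an element of the model fibre on tuples of basis vectors. -/
def dualEval (n N : ℕ) : DualModel n N →ₗ[ℝ]
    ((Fin (n + 1) → Fin (Module.finrank ℝ (TotSp n N))) → ℝ) where
  toFun w s := w.1 fun k => Module.finBasis ℝ (TotSp n N) (s k)
  map_add' _ _ := rfl
  map_smul' _ _ := rfl

lemma dualEval_injective (n N : ℕ) : Injective (dualEval n N) := by
  intro w w' h
  apply Subtype.ext
  apply ContinuousAlternatingMap.toAlternatingMap_injective
  refine Module.Basis.ext_alternating (Module.finBasis ℝ (TotSp n N)) ?_
  intro s _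
  exact congrFun h s

variable {B}

/-- The coordinate expression of an element of `Z`. -/
def AdaptedChart.dualEquiv (e : AdaptedChart B) (y : Y) (hy : y ∈ e.chart.source) :
    DualFiber B y ≃ DualModel n N where
  toFun z := ⟨z.1.compContinuousLinearMap (e.dchartSymm y), by
    intro u i j hij hi hj
    have key : ∀ w : TotSp n N, w.1 = 0 → B.dproj y (e.dchartSymm y w) = 0 := by
      intro w hw
      have h1 := AdaptedChart.fst_dchart hy (e.dchartSymm y w)
      rw [AdaptedChart.dchart_dchartSymm hy, hw] at h1
      have h2 := AdaptedChart.dbaseSymm_dbase (e.proj_mem y hy)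
        (B.dproj y (e.dchartSymm y w))
      rw [← h1, map_zero] at h2
      exact h2.symm
    exact z.2 (fun k => e.dchartSymm y (u k)) i j hij (key _ hi) (key _ hj)⟩
  invFun w := ⟨w.1.compContinuousLinearMap (e.dchart y), by
    intro u i j hij hi hj
    refine w.2 (fun k => e.dchart y (u k)) i j hij ?_ ?_
    · rw [AdaptedChart.fst_dchart hy, hi, map_zero]
    · rw [AdaptedChart.fst_dchart hy, hj, map_zero]⟩
  left_inv z := by
    apply Subtype.ext
    apply ContinuousAlternatingMap.ext
    intro u
    change z.1 (fun k => e.dchartSymm y (e.dchart y (u k))) = z.1 u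
    simp only [AdaptedChart.dchartSymm_dchart hy]
  right_inv w := by
    apply Subtype.ext
    apply ContinuousAlternatingMap.ext
    intro u
    change w.1 (fun k => e.dchart y (e.dchartSymm y (u k))) = w.1 u
    simp only [AdaptedChart.dchart_dchartSymm hy]

/-- The fibre coordinates on the dual jet bundle. -/
def dualCoords (B : SmoothFiberBundle n N X Y F) :
    FiberCoords B (DualModel n N) (DualFiber B) where
  coord e y hy := e.dualEquiv y hy
  smooth e e' := by
    have hker : LinearMap.ker (dualEval n N) = ⊥ :=
      LinearMap.ker_eq_bot.2 (dualEval_injective n N)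
    obtain ⟨R, hR⟩ := LinearMap.exists_leftInverse_of_injective (dualEval n N) hker
    have hR' : ∀ w, R (dualEval n N w) = w := fun w => LinearMap.congr_fun hR w
    refine ⟨fun q => R fun s => q.2.1 fun k => fderiv ℝ (AdaptedChart.change e' e)
      (AdaptedChart.change e e' q.1) (Module.finBasis ℝ (TotSp n N) (s k)), ?_, ?_⟩
    · have h1 : ContDiffOn ℝ ∞ (fun q : TotSp n N × DualModel n N =>
          fderiv ℝ (AdaptedChart.change e' e) (AdaptedChart.change e e' q.1))
          ((e.chart.symm ≫ₕ e'.chart).source ×ˢ univ) := by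
        refine ((AdaptedChart.contDiffOn_change e' e).fderiv_of_isOpen
          (e'.chart.symm ≫ₕ e.chart).open_source (m := ∞) (by simp)).comp
          ((AdaptedChart.contDiffOn_change e e').comp contDiffOn_fst fun q hq => hq.1) ?_
        rintro q ⟨⟨ha, hb⟩, -⟩
        have ha' : q.1 ∈ e.chart.target := ha
        have hb' : e.chart.symm q.1 ∈ e'.chart.source := hb
        refine ⟨e'.chart.map_source hb', ?_⟩
        change e'.chart.symm (e'.chart (e.chart.symm q.1)) ∈ e.chart.source
        rw [e'.chart.left_inv hb']
        exact e.chart.map_target ha'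
      have h2 : ContDiff ℝ ∞ R := (LinearMap.toContinuousLinearMap R).contDiff
      refine h2.comp_contDiffOn (contDiffOn_pi.2 fun s => ?_)
      let Φ := ContinuousLinearMap.flipMultilinear
        ((ContinuousAlternatingMap.toContinuousMultilinearMapCLM (R := ℝ) (ι := Fin (n + 1))
          (E := TotSp n N) (F := ℝ) (𝕜 := ℝ)).comp
          (show DualModel n N →L[ℝ] TotSp n N [⋀^Fin (n + 1)]→L[ℝ] ℝ from
            (dualSubmodule n N).subtypeL))
      have h3 : ContDiffOn ℝ ∞ (fun q : TotSp n N × DualModel n N =>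
          Φ fun k => fderiv ℝ (AdaptedChart.change e' e) (AdaptedChart.change e e' q.1)
            (Module.finBasis ℝ (TotSp n N) (s k)))
          ((e.chart.symm ≫ₕ e'.chart).source ×ˢ univ) :=
        Φ.contDiff.comp_contDiffOn
          (contDiffOn_pi.2 fun k => h1.clm_apply contDiffOn_const)
      exact h3.clm_apply contDiffOn_snd
    · intro y hy hy' z
      have hc : AdaptedChart.change e e' (e.chart y) = e'.chart y := by
        change e'.chart (e.chart.symm (e.chart y)) = _
        rw [e.chart.left_inv hy]
      rw [← hR' (e'.dualEquiv y hy' z)]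
      congr 1
      funext s
      simp only [hc]
      change z.1 (fun k => e'.dchartSymm y (Module.finBasis ℝ (TotSp n N) (s k))) =
        z.1 (fun k => e.dchartSymm y (fderiv ℝ (AdaptedChart.change e' e) (e'.chart y)
          (Module.finBasis ℝ (TotSp n N) (s k))))
      simp only [AdaptedChart.fderiv_change hy' hy, AdaptedChart.dchartSymm_dchart hy]

end DualJets

/-! ### The bundles `J¹Y`, `Z` and `M = J¹Y ×_Y Z` as manifolds -/

/-- The first jet bundle `J¹Y`. -/
def JetBundle (B : SmoothFiberBundle n N X Y F) : Type _ :=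
  TotalSpace (BaseSp n →L[ℝ] FibSp N) (JetFiber B)

/-- The dual jet bundle `Z ≅ J¹Y^⋆`. -/
def DualBundle (B : SmoothFiberBundle n N X Y F) : Type _ :=
  TotalSpace (DualModel n N) (DualFiber B)

/-- The Pontryagin bundle `M = J¹Y ×_Y Z`. -/
def Pontryagin (B : SmoothFiberBundle n N X Y F) : Type _ :=
  TotalSpace ((BaseSp n →L[ℝ] FibSp N) × DualModel n N) fun y => JetFiber B y × DualFiber B y

/-- The model space of `J¹Y`. -/
abbrev JetSp (n N : ℕ) : Type := TotSp n N × (BaseSp n →L[ℝ] FibSp N)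

/-- The model space of `Z`. -/
abbrev DualSp (n N : ℕ) : Type := TotSp n N × DualModel n N

/-- The model space of `M`. -/
abbrev PontSp (n N : ℕ) : Type := TotSp n N × ((BaseSp n →L[ℝ] FibSp N) × DualModel n N)

section Bundles

variable {B : SmoothFiberBundle n N X Y F}

namespace JetBundle

/-- The projection `J¹Y → Y`. -/
def pt (j : JetBundle B) : Y := TotalSpace.proj j

/-- The jet itself, as a linear map. -/
def jet (j : JetBundle B) : JetFiber B j.pt := TotalSpace.snd j

/-- The element of `J¹Y` given by a jet at `y`. -/
def mk (y : Y) (γ : JetFiber B y) : JetBundle B := (⟨y, γ⟩ : TotalSpace _ _)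

end JetBundle

namespace DualBundle

/-- The projection `Z → Y`. -/
def pt (z : DualBundle B) : Y := TotalSpace.proj z

/-- The form on `T_y Y` itself. -/
def form (z : DualBundle B) : DualFiber B z.pt := TotalSpace.snd z

/-- The element of `Z` given by a form on `T_y Y`. -/
def mk (y : Y) (z : DualFiber B y) : DualBundle B := (⟨y, z⟩ : TotalSpace _ _)

end DualBundle

namespace Pontryagin

/-- The projection `M → Y`. -/
def pt (m : Pontryagin B) : Y := TotalSpace.proj m

/-- The jet component `γ` of `m = (γ, z)`. -/
def jet (m : Pontryagin B) : JetFiber B m.pt := (TotalSpace.snd m).1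

/-- The form component `z` of `m = (γ, z)`. -/
def form (m : Pontryagin B) : DualFiber B m.pt := (TotalSpace.snd m).2

/-- The projection `π_{XM} : M → X`. -/
def toBase (m : Pontryagin B) : X := B.proj m.pt

/-- The projection `M → J¹Y` onto the first factor. -/
def toJet (m : Pontryagin B) : JetBundle B := JetBundle.mk m.pt m.jet

/-- The projection `π_{ZM} : M → Z` onto the second factor. -/
def toDual (m : Pontryagin B) : DualBundle B := DualBundle.mk m.pt m.form

end Pontryagin

variable [IsManifold 𝓘(ℝ, BaseSp n) ∞ X] [IsManifold 𝓘(ℝ, FibSp N) ∞ F]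

instance : TopologicalSpace (JetBundle B) := (jetCoords B).core.toTopologicalSpace

instance : ChartedSpace (JetSp n N) (JetBundle B) := (jetCoords B).core.toChartedSpace

instance : IsManifold 𝓘(ℝ, JetSp n N) ∞ (JetBundle B) := (jetCoords B).isManifold_core

instance : TopologicalSpace (DualBundle B) := (dualCoords B).core.toTopologicalSpace

instance : ChartedSpace (DualSp n N) (DualBundle B) := (dualCoords B).core.toChartedSpace

instance : IsManifold 𝓘(ℝ, DualSp n N) ∞ (DualBundle B) := (dualCoords B).isManifold_core

instance : TopologicalSpace (Pontryagin B) :=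
  ((jetCoords B).prod (dualCoords B)).core.toTopologicalSpace

instance : ChartedSpace (PontSp n N) (Pontryagin B) :=
  ((jetCoords B).prod (dualCoords B)).core.toChartedSpace

instance : IsManifold 𝓘(ℝ, PontSp n N) ∞ (Pontryagin B) :=
  ((jetCoords B).prod (dualCoords B)).isManifold_core

instance : IsManifold 𝓘(ℝ, PontSp n N) 1 (Pontryagin B) :=
  IsManifold.of_le (n := ∞) (by simp)

end Bundles

/-! ### Canonical forms, the generalized energy and the action -/

section Theory

variable [IsManifold 𝓘(ℝ, BaseSp n) ∞ X] [IsManifold 𝓘(ℝ, FibSp N) ∞ F]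
  (B : SmoothFiberBundle n N X Y F)

/-- The canonical `(n+1)`-form `Θ` on `Z`: `Θ(z) = (π_{YZ})^* z`. -/
def canonicalForm : DiffForm (DualSp n N) (DualBundle B) (n + 1) := fun z =>
  z.form.1.compContinuousLinearMap
    (mfderiv 𝓘(ℝ, DualSp n N) 𝓘(ℝ, TotSp n N) DualBundle.pt z)

/-- The canonical multisymplectic form `Ω = -dΘ` on `Z`. -/
def multisymplecticForm : DiffForm (DualSp n N) (DualBundle B) (n + 1 + 1) := fun z =>
  -dform (canonicalForm B) z

/-- `Θ_M = (π_{ZM})^* Θ`. -/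
def thetaM : DiffForm (PontSp n N) (Pontryagin B) (n + 1) :=
  pullback Pontryagin.toDual (canonicalForm B)

/-- `Ω_M = (π_{ZM})^* Ω`. -/
def omegaM : DiffForm (PontSp n N) (Pontryagin B) (n + 1 + 1) :=
  pullback Pontryagin.toDual (multisymplecticForm B)

variable {B}
variable (η : DiffForm (BaseSp n) X (n + 1)) (L : JetBundle B → ℝ)

/-- The Lagrangian density `𝓛 = L η : J¹Y → Λ^{n+1} X`. -/
def lagrangianDensity (j : JetBundle B) :
    TangentSpace 𝓘(ℝ, BaseSp n) (B.proj j.pt) [⋀^Fin (n + 1)]→L[ℝ] ℝ :=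
  L j • η (B.proj j.pt)

/-- The duality pairing `⟨z, γ⟩ = γ^* z ∈ Λ^{n+1}_x X`. -/
def pairing (m : Pontryagin B) :
    TangentSpace 𝓘(ℝ, BaseSp n) m.toBase [⋀^Fin (n + 1)]→L[ℝ] ℝ :=
  m.form.1.compContinuousLinearMap m.jet.1

/-- The generalized energy density `𝓔(γ, z) = ⟨z, γ⟩ - 𝓛(γ) ∈ Λ^{n+1}_x X`. -/
def energyDensity (m : Pontryagin B) :
    TangentSpace 𝓘(ℝ, BaseSp n) m.toBase [⋀^Fin (n + 1)]→L[ℝ] ℝ :=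
  let l : TangentSpace 𝓘(ℝ, BaseSp n) m.toBase [⋀^Fin (n + 1)]→L[ℝ] ℝ :=
    lagrangianDensity η L m.toJet
  pairing m - l

/-- The generalized energy density as an `(n+1)`-form on `M`. -/
def energyForm : DiffForm (PontSp n N) (Pontryagin B) (n + 1) := fun m =>
  (energyDensity η L m).compContinuousLinearMap
    (mfderiv 𝓘(ℝ, PontSp n N) 𝓘(ℝ, BaseSp n) Pontryagin.toBase m)

/-- `Ω_𝓔 = Ω_M + d𝓔`. -/
def omegaE : DiffForm (PontSp n N) (Pontryagin B) (n + 1 + 1) := fun m =>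
  omegaM B m + dform (energyForm η L) m

/-- A smooth section of `π_{XM} : M → X`. -/
def IsSmoothSection (ψ : X → Pontryagin B) : Prop :=
  ContMDiff 𝓘(ℝ, BaseSp n) 𝓘(ℝ, PontSp n N) ∞ ψ ∧ ∀ x, (ψ x).toBase = x

/-- The Hamilton-Pontryagin action `S_U(ψ) = ∫_U ψ^*(Θ_M - 𝓔)`. -/
def action [T2Space X] [SigmaCompactSpace X] (U : Set X) (ψ : X → Pontryagin B) : ℝ :=
  integralOn η U (pullback ψ fun m => thetaM B m - energyForm η L m)

/-- A vertical variation supported over `U`: a smooth one-parameter family of fibre-preserving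
diffeomorphisms of `M`, starting at the identity and equal to the identity outside a compact
subset of `M` lying over `U`. -/
structure VerticalVariation (B : SmoothFiberBundle n N X Y F) (U : Set X) where
  diffeo : ℝ → Diffeomorph 𝓘(ℝ, PontSp n N) 𝓘(ℝ, PontSp n N) (Pontryagin B) (Pontryagin B) ∞
  smooth : ContMDiff (𝓘(ℝ, ℝ).prod 𝓘(ℝ, PontSp n N)) 𝓘(ℝ, PontSp n N) ∞
    fun p : ℝ × Pontryagin B => diffeo p.1 p.2
  zero : ∀ m, diffeo 0 m = m
  vertical : ∀ t m, (diffeo t m).toBase = m.toBase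
  support : ∃ K : Set (Pontryagin B), IsCompact K ∧ (∀ m ∈ K, m.toBase ∈ U) ∧
    ∀ t, ∀ m ∉ K, diffeo t m = m

/-- `ψ` is a critical point of the Hamilton-Pontryagin action: for every open `U ⊂ X` with
compact closure and every vertical variation over `U`, the action `S_U(η_t ∘ ψ)` has derivative
zero at `t = 0`. -/
def IsCriticalPoint [T2Space X] [SigmaCompactSpace X] (ψ : X → Pontryagin B) : Prop :=
  ∀ U : Set X, IsOpen U → IsCompact (closure U) → ∀ V : VerticalVariation B U,
    HasDerivAt (fun t : ℝ => action η L U fun x => V.diffeo t (ψ x)) 0 0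

/-- A smooth `π_{XM}`-vertical vector field on `M`. -/
def IsVerticalField (V : ∀ m : Pontryagin B, TangentSpace 𝓘(ℝ, PontSp n N) m) : Prop :=
  ContMDiff 𝓘(ℝ, PontSp n N) 𝓘(ℝ, PontSp n N).tangent ∞
    (fun m => (⟨m, V m⟩ : TangentBundle 𝓘(ℝ, PontSp n N) (Pontryagin B))) ∧
  ∀ m, mfderiv 𝓘(ℝ, PontSp n N) 𝓘(ℝ, BaseSp n) Pontryagin.toBase m (V m) = 0

/-- `ψ^*(V ⌟ Ω_𝓔) = 0` for every vertical vector field `V` on `M`. -/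
def SatisfiesIntrinsicEquation (ψ : X → Pontryagin B) : Prop :=
  ∀ V : (∀ m : Pontryagin B, TangentSpace 𝓘(ℝ, PontSp n N) m), IsVerticalField V →
    ∀ x, pullback (E := BaseSp n) ψ (contract V (omegaE η L)) x = 0

/-! ### Coordinate expressions -/

namespace AdaptedChart

variable (e : AdaptedChart B)

/-- The frame `∂_1, …, ∂_{n+1}` of coordinate vectors of `Y` at `y`. -/
def frame (y : Y) : Fin (n + 1) → TangentSpace 𝓘(ℝ, TotSp n N) y := fun μ =>
  e.dchartSymm y (baseVec μ, 0)

/-- The coordinate `p` of `z = p d^{n+1}x + p_A^μ dy^A ∧ d^n x_μ`. -/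
def pCoord (m : Pontryagin B) : ℝ := m.form.1 (e.frame m.pt)

/-- The coordinate `p_A^μ` of `z = p d^{n+1}x + p_A^μ dy^A ∧ d^n x_μ`: the value of `z` on the
tuple `∂_1, …, ∂_{n+1}` with `∂_μ` replaced by `∂/∂y^A`. -/
def momentumCoord (A : Fin N) (μ : Fin (n + 1)) (m : Pontryagin B) : ℝ :=
  m.form.1 (update (e.frame m.pt) μ (e.dchartSymm m.pt (0, fibVec A)))

/-- The coordinate `y^A`. -/
def yCoord (A : Fin N) (m : Pontryagin B) : ℝ := (e.chart m.pt).2 A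

/-- The coordinate `v^A_μ`. -/
def vCoord (A : Fin N) (μ : Fin (n + 1)) (m : Pontryagin B) : ℝ :=
  e.jetCoord m.pt m.jet (baseVec μ) A

open Classical in
/-- The Lagrangian in coordinates: `𝓛 = L(x, y, v) d^{n+1}x` (zero outside the coordinate
domain). -/
def localLagrangian (q : JetSp n N) : ℝ :=
  if h : q.1 ∈ e.chart.target then
    lagrangianDensity η L
      (JetBundle.mk (e.chart.symm q.1) (e.jetOfCoord (e.chart.map_target h) q.2))
      fun μ => e.dbaseSymm (B.proj (e.chart.symm q.1)) (baseVec μ)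
  else 0

/-- The jet coordinates `(x, y, v)` of a point of `M`. -/
def jetPoint (m : Pontryagin B) : JetSp n N := (e.chart m.pt, e.jetCoord m.pt m.jet)

/-- `∂L/∂y^A` at the jet component of a point of `M`. -/
def dLdy (A : Fin N) (m : Pontryagin B) : ℝ :=
  fderiv ℝ (e.localLagrangian η L) (e.jetPoint m) ((0, fibVec A), 0)

/-- `∂L/∂v^A_μ` at the jet component of a point of `M`. -/
def dLdv (A : Fin N) (μ : Fin (n + 1)) (m : Pontryagin B) : ℝ :=
  fderiv ℝ (e.localLagrangian η L) (e.jetPoint m)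
    (0, (EuclideanSpace.proj μ : BaseSp n →L[ℝ] ℝ).smulRight (fibVec A))

/-- The partial derivative `∂f/∂x^μ` at `x` of a function on `X` in the coordinates of `e`. -/
def partialX (μ : Fin (n + 1)) (f : X → ℝ) (x : X) : ℝ :=
  fderiv ℝ (fun a => f (e.base.symm a)) (e.base x) (baseVec μ)

end AdaptedChart

/-- The implicit Euler-Lagrange equations `∂y^A/∂x^μ = v^A_μ`, `∂p_A^μ/∂x^μ = ∂L/∂y^A`,
`p_A^μ = ∂L/∂v^A_μ` in all bundle coordinates. -/
def ImplicitEulerLagrange (ψ : X → Pontryagin B) : Prop :=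
  ∀ (e : AdaptedChart B) (x : X), (ψ x).pt ∈ e.chart.source →
    (∀ A μ, e.partialX μ (fun x' => e.yCoord A (ψ x')) x = e.vCoord A μ (ψ x)) ∧
    (∀ A, ∑ μ, e.partialX μ (fun x' => e.momentumCoord A μ (ψ x')) x = e.dLdy η L A (ψ x)) ∧
    (∀ A μ, e.momentumCoord A μ (ψ x) = e.dLdv η L A μ (ψ x))

/-- The covariant Legendre transformation `p_A^μ = ∂L/∂v^A_μ`, `p = L - (∂L/∂v^A_μ) v^A_μ` in all
bundle coordinates. -/
def CovariantLegendre (ψ : X → Pontryagin B) : Prop :=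
  ∀ (e : AdaptedChart B) (x : X), (ψ x).pt ∈ e.chart.source →
    (∀ A μ, e.momentumCoord A μ (ψ x) = e.dLdv η L A μ (ψ x)) ∧
    e.pCoord (ψ x) = e.localLagrangian η L (e.jetPoint (ψ x)) -
      ∑ A, ∑ μ, e.dLdv η L A μ (ψ x) * e.vCoord A μ (ψ x)

/-- The generalized energy constraint `𝓔 = 0` along `ψ`. -/
def EnergyConstraint (ψ : X → Pontryagin B) : Prop :=
  ∀ x, energyDensity η L (ψ x) = 0

end Theory

end HamiltonPontryagin

end

open HamiltonPontryagin

/-!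
The pivot of the argument is the Euler-Lagrange expression of a section `ψ` in bundle coordinates,
`δp_A^μ (∂_μ y^A - v^A_μ) + (∂L/∂v^A_μ - p_A^μ) δv^A_μ + (∂L/∂y^A - ∂_μ p_A^μ) δy^A`,
a linear form in the vertical direction `δ` (`eulerLagrange`). Its vanishing in all adapted charts,
`EulerLagrangeVanishes`, is shown to be equivalent to each of the three conditions of the theorem.

* The implicit Euler-Lagrange equations are its components. The one point to check is that the
  momenta `p_A^μ` can be varied independently in the space of forms that vanish on two vertical
  vectors (`eulerLagrangeVanishes_iff`).

* In coordinates `Θ_M - 𝓔` pulls back along `ψ` to the density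
  `(p_A^μ (∂_μ y^A - v^A_μ) + L) d^{n+1}x`, in which `p` has dropped out. Its derivative along a
  family of sections is the Euler-Lagrange expression of the variation plus the divergence of
  `p_A^μ δy^A` (`hasDerivAt_density`), and the divergence of a variation with compact support in a
  chart integrates to zero (`integralOn_firstVariation`). If `ψ` is critical and the expression
  were nonzero at some point, the variation in that direction, cut off by a bump function, would
  have nonzero derivative (`eulerLagrangeVanishes_of_isCriticalPoint`); the required diffeomorphisms
  of `M` are translations in coordinates multiplied by a bump function
  (`AdaptedChart.exists_verticalVariation`). Conversely, a vertical variation `η_λ` need not be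
  supported in one chart. With a partition of unity `σ_k` of `X`, the families `η_{σ_k λ} ∘ ψ` are
  supported in charts and their first variations add up to that of `η_λ ∘ ψ`, because where the
  Euler-Lagrange expression vanishes the first variation is a divergence that is additive in the
  variation (`isCriticalPoint_of_eulerLagrangeVanishes`).

* The exterior derivative, defined through the preferred chart at each point, can be computed in
  any coordinates (`dform_apply_of_eventuallyEq`). Computing `dΘ` and `d𝓔` in the coordinates of an
  adapted chart shows that the coefficient of `ψ^*(V ⌟ Ω_𝓔)` is minus the Euler-Lagrange expression
  in the direction `V` (`coeffIn_pullback_contract`), and every vertical vector at a point extends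
  to a vertical vector field (`satisfiesIntrinsicEquation_iff`).

Finally `𝓔 = (p + p_A^μ v^A_μ - L) d^{n+1}x` in coordinates, so that in the presence of the implicit
Euler-Lagrange equations, which contain `p_A^μ = ∂L/∂v^A_μ`, the constraint `𝓔 ∘ ψ = 0` is the
remaining half of the covariant Legendre transformation
(`energyConstraint_iff_covariantLegendre`).
-/

set_option linter.unusedSectionVars false

noncomputable section

namespace HamiltonPontryagin

section

variable {n N : ℕ} {X Y F : Type*}
  [TopologicalSpace X] [ChartedSpace (BaseSp n) X]
  [TopologicalSpace Y] [ChartedSpace (TotSp n N) Y]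
  [TopologicalSpace F] [ChartedSpace (FibSp N) F]

/-! ### Charts of the bundles over `Y` induced by adapted charts -/

namespace FiberCoords

variable {B : SmoothFiberBundle n N X Y F} {K : Type*} [NormedAddCommGroup K]
    [NormedSpace ℝ K] {Fib : Y → Type*} (C : FiberCoords B K Fib)

theorem proj_totalInv (e : AdaptedChart B) (m : TotalSpace K Fib) {q : TotSp n N × K}
    (h : q.1 ∈ e.chart.target) : (C.totalInv e m q).proj = e.chart.symm q.1 := by
  rw [C.totalInv_of_mem e m h]

theorem totalFun_totalInv (e : AdaptedChart B) (m : TotalSpace K Fib) {q : TotSp n N × K}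
    (h : q.1 ∈ e.chart.target) : C.totalFun e (C.totalInv e m q) = q :=
  (C.totalChart e m).right_inv' h

theorem totalInv_totalFun (e : AdaptedChart B) (m₀ : TotalSpace K Fib) {m : TotalSpace K Fib}
    (h : m.proj ∈ e.chart.source) : C.totalInv e m₀ (C.totalFun e m) = m :=
  (C.totalChart e m₀).left_inv' h

theorem fst_totalFun (e : AdaptedChart B) {m : TotalSpace K Fib}
    (h : m.proj ∈ e.chart.source) : (C.totalFun e m).1 = e.chart m.proj := by
  rw [C.totalFun_of_mem e h]

variable [IsManifold 𝓘(ℝ, BaseSp n) ∞ X] [IsManifold 𝓘(ℝ, FibSp N) ∞ F]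

/-- Every chart induced by an adapted chart, not only a preferred one, is a smooth chart. -/
theorem contMDiffOn_totalFun (e : AdaptedChart B) :
    letI := C.core.toTopologicalSpace
    letI := C.core.toChartedSpace
    ContMDiffOn 𝓘(ℝ, TotSp n N × K) 𝓘(ℝ, TotSp n N × K) ∞ (C.totalFun e)
      {m | m.proj ∈ e.chart.source} := by
  let _ := C.core.toTopologicalSpace
  let _ := C.core.toChartedSpace
  have := C.isManifold_core
  intro m hm
  have h : C.core.openPartialHomeomorph (C.totalChart e m) ⟨e, m, rfl⟩ ∈
      atlas (TotSp n N × K) (TotalSpace K Fib) :=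
    mem_iUnion.2 ⟨_, mem_iUnion.2 ⟨⟨e, m, rfl⟩, rfl⟩⟩
  exact contMDiffOn_of_mem_maximalAtlas
    (IsManifold.subset_maximalAtlas (I := 𝓘(ℝ, TotSp n N × K)) (n := ∞) h) m hm

theorem contMDiffOn_totalInv (e : AdaptedChart B) (m : TotalSpace K Fib) :
    letI := C.core.toTopologicalSpace
    letI := C.core.toChartedSpace
    ContMDiffOn 𝓘(ℝ, TotSp n N × K) 𝓘(ℝ, TotSp n N × K) ∞ (C.totalInv e m)
      {q | q.1 ∈ e.chart.target} := by
  let _ := C.core.toTopologicalSpace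
  let _ := C.core.toChartedSpace
  have := C.isManifold_core
  have h : C.core.openPartialHomeomorph (C.totalChart e m) ⟨e, m, rfl⟩ ∈
      atlas (TotSp n N × K) (TotalSpace K Fib) :=
    mem_iUnion.2 ⟨_, mem_iUnion.2 ⟨⟨e, m, rfl⟩, rfl⟩⟩
  exact contMDiffOn_symm_of_mem_maximalAtlas
    (IsManifold.subset_maximalAtlas (I := 𝓘(ℝ, TotSp n N × K)) (n := ∞) h)

theorem isOpen_source (e : AdaptedChart B) :
    letI := C.core.toTopologicalSpace
    IsOpen {m : TotalSpace K Fib | m.proj ∈ e.chart.source} := by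
  let _ := C.core.toTopologicalSpace
  by_cases hne : Nonempty (TotalSpace K Fib)
  · obtain ⟨m⟩ := hne
    exact C.core.open_source' (e := C.totalChart e m) ⟨e, m, rfl⟩
  · have : {m : TotalSpace K Fib | m.proj ∈ e.chart.source} = ∅ := by
      ext m; exact (hne ⟨m⟩).elim
    rw [this]; exact isOpen_empty

/-- The projection of a bundle with fibre coordinates to `Y` is smooth. -/
theorem contMDiff_proj :
    letI := C.core.toTopologicalSpace
    letI := C.core.toChartedSpace
    ContMDiff 𝓘(ℝ, TotSp n N × K) 𝓘(ℝ, TotSp n N) ∞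
      (fun m : TotalSpace K Fib => m.proj) := by
  let _ := C.core.toTopologicalSpace
  let _ := C.core.toChartedSpace
  intro m
  obtain ⟨e, he⟩ := B.exists_adaptedChart m.proj
  have hO := C.isOpen_source e
  have h1 : ContMDiffOn 𝓘(ℝ, TotSp n N × K) 𝓘(ℝ, TotSp n N) ∞
      (fun m : TotalSpace K Fib => e.chart.symm (C.totalFun e m).1)
      {m | m.proj ∈ e.chart.source} := by
    refine e.smooth_chart_symm.comp
      ((contDiff_fst.contMDiff (f := fun q : TotSp n N × K => q.1)).comp_contMDiffOn
        (C.contMDiffOn_totalFun e)) ?_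
    intro m hm
    change (C.totalFun e m).1 ∈ e.chart.target
    rw [C.fst_totalFun e hm]
    exact e.chart.map_source hm
  refine (h1.contMDiffAt (hO.mem_nhds he)).congr_of_eventuallyEq ?_
  filter_upwards [hO.mem_nhds he] with m' hm'
  rw [C.fst_totalFun e hm', e.chart.left_inv hm']

end FiberCoords

variable {B : SmoothFiberBundle n N X Y F}

/-- The adapted chart underlying the preferred charts of `J¹Y`, `Z` and `M` over `y`. -/
def prefChart [IsManifold 𝓘(ℝ, BaseSp n) ∞ X] [IsManifold 𝓘(ℝ, FibSp N) ∞ F]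
    (B : SmoothFiberBundle n N X Y F) (y : Y) : AdaptedChart B :=
  (B.exists_adaptedChart y).choose

theorem mem_prefChart_source [IsManifold 𝓘(ℝ, BaseSp n) ∞ X] [IsManifold 𝓘(ℝ, FibSp N) ∞ F]
    (y : Y) : y ∈ (prefChart B y).chart.source :=
  (B.exists_adaptedChart y).choose_spec

namespace AdaptedChart

variable (e : AdaptedChart B)

/-- The domain in `M` of the coordinates induced by an adapted chart. -/
def pSource : Set (Pontryagin B) := {m | m.pt ∈ e.chart.source}

/-- The domain in the model space of the coordinates induced by an adapted chart. -/
def pTarget : Set (PontSp n N) := {q | q.1 ∈ e.chart.target}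

/-- The coordinates `((x, y), (v, w))` on `M` induced by an adapted chart. -/
def pFun : Pontryagin B → PontSp n N := ((jetCoords B).prod (dualCoords B)).totalFun e

/-- The point of `M` with given coordinates (with default value `m₀`). -/
def pInv (m₀ : Pontryagin B) : PontSp n N → Pontryagin B :=
  ((jetCoords B).prod (dualCoords B)).totalInv e m₀

variable {e}

theorem pFun_of_mem {m : Pontryagin B} (h : m ∈ e.pSource) :
    e.pFun m = (e.chart m.pt, (e.jetCoord m.pt m.jet, e.dualEquiv m.pt h m.form)) :=
  ((jetCoords B).prod (dualCoords B)).totalFun_of_mem e h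

theorem pFun_fst {m : Pontryagin B} (h : m ∈ e.pSource) : (e.pFun m).1 = e.chart m.pt := by
  rw [pFun_of_mem h]

theorem pFun_fst_fst {m : Pontryagin B} (h : m ∈ e.pSource) :
    (e.pFun m).1.1 = e.base m.toBase := by
  rw [pFun_of_mem h]; exact e.fst_chart _ h

theorem toBase_mem {m : Pontryagin B} (h : m ∈ e.pSource) : m.toBase ∈ e.base.source :=
  e.proj_mem _ h

theorem pFun_mem {m : Pontryagin B} (h : m ∈ e.pSource) : e.pFun m ∈ e.pTarget := by
  change (e.pFun m).1 ∈ e.chart.target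
  rw [pFun_fst h]; exact e.chart.map_source h

theorem pFun_pInv (m₀ : Pontryagin B) {q : PontSp n N} (h : q ∈ e.pTarget) :
    e.pFun (e.pInv m₀ q) = q :=
  ((jetCoords B).prod (dualCoords B)).totalFun_totalInv e m₀ h

theorem pInv_pFun (m₀ : Pontryagin B) {m : Pontryagin B} (h : m ∈ e.pSource) :
    e.pInv m₀ (e.pFun m) = m :=
  ((jetCoords B).prod (dualCoords B)).totalInv_totalFun e m₀ h

theorem pt_pInv (m₀ : Pontryagin B) {q : PontSp n N} (h : q ∈ e.pTarget) :
    (e.pInv m₀ q).pt = e.chart.symm q.1 :=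
  ((jetCoords B).prod (dualCoords B)).proj_totalInv e m₀ h

theorem pInv_mem (m₀ : Pontryagin B) {q : PontSp n N} (h : q ∈ e.pTarget) :
    e.pInv m₀ q ∈ e.pSource := by
  change (e.pInv m₀ q).pt ∈ e.chart.source
  rw [pt_pInv m₀ h]; exact e.chart.map_target h

theorem isOpen_pTarget : IsOpen e.pTarget :=
  e.chart.open_target.preimage continuous_fst

variable [IsManifold 𝓘(ℝ, BaseSp n) ∞ X] [IsManifold 𝓘(ℝ, FibSp N) ∞ F]

variable (e) in
theorem isOpen_pSource : IsOpen e.pSource :=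
  ((jetCoords B).prod (dualCoords B)).isOpen_source e

variable (e) in
theorem contMDiffOn_pFun :
    ContMDiffOn 𝓘(ℝ, PontSp n N) 𝓘(ℝ, PontSp n N) ∞ e.pFun e.pSource :=
  ((jetCoords B).prod (dualCoords B)).contMDiffOn_totalFun e

variable (e) in
theorem contMDiffOn_pInv (m₀ : Pontryagin B) :
    ContMDiffOn 𝓘(ℝ, PontSp n N) 𝓘(ℝ, PontSp n N) ∞ (e.pInv m₀) e.pTarget :=
  ((jetCoords B).prod (dualCoords B)).contMDiffOn_totalInv e m₀

end AdaptedChart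

/-! ### Smoothness of the projections of the Pontryagin bundle -/

section Projections

theorem totalFun_toDual {e : AdaptedChart B} {m : Pontryagin B} (h : m ∈ e.pSource) :
    (dualCoords B).totalFun e m.toDual = ((e.pFun m).1, (e.pFun m).2.2) := by
  rw [AdaptedChart.pFun_of_mem h]
  exact (dualCoords B).totalFun_of_mem e (m := m.toDual) h

theorem totalFun_toJet {e : AdaptedChart B} {m : Pontryagin B} (h : m ∈ e.pSource) :
    (jetCoords B).totalFun e m.toJet = ((e.pFun m).1, (e.pFun m).2.1) := by
  rw [AdaptedChart.pFun_of_mem h]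
  exact (jetCoords B).totalFun_of_mem e (m := m.toJet) h

variable [IsManifold 𝓘(ℝ, BaseSp n) ∞ X] [IsManifold 𝓘(ℝ, FibSp N) ∞ F]

theorem contMDiff_pt :
    ContMDiff 𝓘(ℝ, PontSp n N) 𝓘(ℝ, TotSp n N) ∞ (Pontryagin.pt (B := B)) :=
  ((jetCoords B).prod (dualCoords B)).contMDiff_proj

theorem contMDiff_dualPt :
    ContMDiff 𝓘(ℝ, DualSp n N) 𝓘(ℝ, TotSp n N) ∞ (DualBundle.pt (B := B)) :=
  (dualCoords B).contMDiff_proj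

theorem contMDiff_toBase :
    ContMDiff 𝓘(ℝ, PontSp n N) 𝓘(ℝ, BaseSp n) ∞ (Pontryagin.toBase (B := B)) :=
  B.contMDiff_proj.comp contMDiff_pt

/-- The point of `Z` with given coordinates (with default value `z₀`). -/
def dualInv (e : AdaptedChart B) (z₀ : DualBundle B) : DualSp n N → DualBundle B :=
  (dualCoords B).totalInv e z₀

/-- The point of `J¹Y` with given coordinates (with default value `j₀`). -/
def jetInv (e : AdaptedChart B) (j₀ : JetBundle B) : JetSp n N → JetBundle B :=
  (jetCoords B).totalInv e j₀

theorem contMDiffOn_dualInv (e : AdaptedChart B) (z₀ : DualBundle B) :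
    ContMDiffOn 𝓘(ℝ, DualSp n N) 𝓘(ℝ, DualSp n N) ∞ (dualInv e z₀)
      {q | q.1 ∈ e.chart.target} :=
  (dualCoords B).contMDiffOn_totalInv e z₀

theorem contMDiffOn_jetInv (e : AdaptedChart B) (j₀ : JetBundle B) :
    ContMDiffOn 𝓘(ℝ, JetSp n N) 𝓘(ℝ, JetSp n N) ∞ (jetInv e j₀)
      {q | q.1 ∈ e.chart.target} :=
  (jetCoords B).contMDiffOn_totalInv e j₀

theorem contMDiff_toDual :
    ContMDiff 𝓘(ℝ, PontSp n N) 𝓘(ℝ, DualSp n N) ∞ (Pontryagin.toDual (B := B)) := by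
  intro m
  obtain ⟨e, he⟩ := B.exists_adaptedChart m.pt
  have hm : m ∈ e.pSource := he
  have h1 : ContMDiffOn 𝓘(ℝ, PontSp n N) 𝓘(ℝ, DualSp n N) ∞
      (fun m' => ((e.pFun m').1, (e.pFun m').2.2)) e.pSource :=
    ((contDiff_fst.prodMk (contDiff_snd.comp contDiff_snd)).contMDiff
      (f := fun q : PontSp n N => (q.1, q.2.2))).comp_contMDiffOn e.contMDiffOn_pFun
  have h2 : ContMDiffOn 𝓘(ℝ, PontSp n N) 𝓘(ℝ, DualSp n N) ∞
      (fun m' => (dualInv e m.toDual ((e.pFun m').1, (e.pFun m').2.2)))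
      e.pSource := by
    refine (contMDiffOn_dualInv e m.toDual).comp h1 ?_
    intro m' hm'
    exact AdaptedChart.pFun_mem hm'
  refine (h2.contMDiffAt (e.isOpen_pSource.mem_nhds hm)).congr_of_eventuallyEq ?_
  filter_upwards [e.isOpen_pSource.mem_nhds hm] with m' hm'
  rw [← totalFun_toDual hm']
  exact ((dualCoords B).totalInv_totalFun e m.toDual (m := m'.toDual) hm').symm

theorem contMDiff_toJet :
    ContMDiff 𝓘(ℝ, PontSp n N) 𝓘(ℝ, JetSp n N) ∞ (Pontryagin.toJet (B := B)) := by
  intro m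
  obtain ⟨e, he⟩ := B.exists_adaptedChart m.pt
  have hm : m ∈ e.pSource := he
  have h1 : ContMDiffOn 𝓘(ℝ, PontSp n N) 𝓘(ℝ, JetSp n N) ∞
      (fun m' => ((e.pFun m').1, (e.pFun m').2.1)) e.pSource :=
    ((contDiff_fst.prodMk (contDiff_fst.comp contDiff_snd)).contMDiff
      (f := fun q : PontSp n N => (q.1, q.2.1))).comp_contMDiffOn e.contMDiffOn_pFun
  have h2 : ContMDiffOn 𝓘(ℝ, PontSp n N) 𝓘(ℝ, JetSp n N) ∞
      (fun m' => (jetInv e m.toJet ((e.pFun m').1, (e.pFun m').2.1)))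
      e.pSource := by
    refine (contMDiffOn_jetInv e m.toJet).comp h1 ?_
    intro m' hm'
    exact AdaptedChart.pFun_mem hm'
  refine (h2.contMDiffAt (e.isOpen_pSource.mem_nhds hm)).congr_of_eventuallyEq ?_
  filter_upwards [e.isOpen_pSource.mem_nhds hm] with m' hm'
  rw [← totalFun_toJet hm']
  exact ((jetCoords B).totalInv_totalFun e m.toJet (m := m'.toJet) hm').symm

end Projections

end

section

variable {n N : ℕ}

/-! ### Linear algebra of the model fibre of `Z` -/

theorem baseVec_eq_basis : (baseVec : Fin (n + 1) → BaseSp n) =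
    (EuclideanSpace.basisFun (Fin (n + 1)) ℝ).toBasis := by
  funext μ
  simp [baseVec]

instance : FiniteDimensional ℝ (DualModel n N) :=
  FiniteDimensional.of_injective (dualEval n N) (dualEval_injective n N)

/-- The coordinate vectors `∂_μ` of the base, as vectors of the total space. -/
def baseFrame (n N : ℕ) : Fin (n + 1) → TotSp n N := fun μ => (baseVec μ, 0)

/-- A form that vanishes on two vertical vectors is affine in the vertical parts of its
arguments. -/
theorem dualModel_apply_prod (w : DualModel n N) (b : Fin (n + 1) → BaseSp n)
    (h : Fin (n + 1) → FibSp N) :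
    w.1 (fun i => (b i, h i)) = w.1 (fun i => (b i, 0)) +
      ∑ μ, w.1 (update (fun i => ((b i, 0) : TotSp n N)) μ (0, h μ)) := by
  classical
  have h1 : (fun i => ((b i, h i) : TotSp n N)) =
      (fun i => ((0, h i) : TotSp n N)) + fun i => ((b i, 0) : TotSp n N) := by
    funext i; simp
  rw [h1]
  change w.1.toMultilinearMap _ = _
  rw [MultilinearMap.map_add_univ]
  -- in the multilinear expansion only the terms with at most one vertical argument survive
  rw [← Finset.sum_subset (s₁ := insert ∅ (Finset.univ.image fun μ : Fin (n + 1) => {μ}))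
    (Finset.subset_univ _)]
  · rw [Finset.sum_insert (by simp), Finset.sum_image (by intro a _ b _ hab; simpa using hab)]
    congr 1
    · refine Finset.sum_congr rfl fun μ _ => ?_
      rw [Finset.piecewise_singleton]; rfl
  · intro s _ hs
    have hc : 1 < s.card := by
      by_contra hc
      apply hs
      rcases Nat.lt_or_eq_of_le (not_lt.1 hc) with hc | hc
      · rw [Finset.card_eq_zero.1 (Nat.lt_one_iff.1 hc)]; simp
      · obtain ⟨a, rfl⟩ := Finset.card_eq_one.1 hc
        simp
    obtain ⟨i, hi, j, hj, hij⟩ := Finset.one_lt_card.1 hc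
    exact w.2 _ i j hij (by simp [Finset.piecewise_eq_of_mem _ _ _ hi])
      (by simp [Finset.piecewise_eq_of_mem _ _ _ hj])

/-- The momentum part of a form: `mom μ w h` is the value of `w` on the coordinate frame of the base
with `∂_μ` replaced by the vertical vector `h`, that is `p_A^μ h^A`. -/
def mom (μ : Fin (n + 1)) : DualModel n N →L[ℝ] FibSp N →L[ℝ] ℝ :=
  (LinearMap.mk₂ ℝ (fun (w : DualModel n N) (h : FibSp N) =>
      w.1 (update (baseFrame n N) μ (0, h)))
    (fun _ _ _ => rfl) (fun _ _ _ => rfl)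
    (fun w h h' => by
      rw [← w.1.map_update_add]; simp)
    (fun c w h => by
      rw [← w.1.map_update_smul]; simp)).toContinuousBilinearMap

theorem mom_apply (μ : Fin (n + 1)) (w : DualModel n N) (h : FibSp N) :
    mom μ w h = w.1 (update (baseFrame n N) μ (0, h)) := rfl

/-- The pullback `γ^* z` in coordinates, `p + p_A^μ v^A_μ`. -/
theorem dualModel_apply_graph (w : DualModel n N) (h : Fin (n + 1) → FibSp N) :
    w.1 (fun i => (baseVec i, h i)) = w.1 (baseFrame n N) + ∑ μ, mom μ w (h μ) :=
  dualModel_apply_prod w _ h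

/-- The standard volume form of `ℝ^(n+1)`. -/
def vol (n : ℕ) : BaseSp n [⋀^Fin (n + 1)]→L[ℝ] ℝ where
  toMultilinearMap :=
    ((EuclideanSpace.basisFun (Fin (n + 1)) ℝ).toBasis.det).toMultilinearMap
  map_eq_zero_of_eq' := (EuclideanSpace.basisFun (Fin (n + 1)) ℝ).toBasis.det.map_eq_zero_of_eq'
  cont := by
    change Continuous fun v => (EuclideanSpace.basisFun (Fin (n + 1)) ℝ).toBasis.det v
    simp only [Module.Basis.det_apply]
    refine Continuous.matrix_det ?_
    refine continuous_matrix fun i j => ?_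
    change Continuous fun v : Fin (n + 1) → BaseSp n => v j i
    fun_prop

theorem vol_apply (v : Fin (n + 1) → BaseSp n) :
    vol n v = (EuclideanSpace.basisFun (Fin (n + 1)) ℝ).toBasis.det v := rfl

@[simp] theorem vol_baseVec : vol n baseVec = 1 := by
  rw [vol_apply, baseVec_eq_basis, Module.Basis.det_self]

/-- A form of top degree is the standard volume form times its value on the coordinate frame. -/
theorem topForm_apply (α : BaseSp n [⋀^Fin (n + 1)]→L[ℝ] ℝ) (v : Fin (n + 1) → BaseSp n) :
    α v = α baseVec * vol n v := by
  have h := α.toAlternatingMap.eq_smul_basis_det (EuclideanSpace.basisFun (Fin (n + 1)) ℝ).toBasis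
  have h2 := congrArg (fun f : BaseSp n [⋀^Fin (n + 1)]→ₗ[ℝ] ℝ => f v) h
  rw [← baseVec_eq_basis] at h2
  exact h2

theorem vol_comp (T : BaseSp n →L[ℝ] BaseSp n) (v : Fin (n + 1) → BaseSp n) :
    vol n (fun i => T (v i)) = T.det * vol n v := by
  simp only [vol_apply]
  exact (EuclideanSpace.basisFun (Fin (n + 1)) ℝ).toBasis.det_comp (T : BaseSp n →ₗ[ℝ] BaseSp n) v

theorem topForm_comp (α : BaseSp n [⋀^Fin (n + 1)]→L[ℝ] ℝ) (T : BaseSp n →L[ℝ] BaseSp n) :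
    α (fun i => T (baseVec i)) = T.det * α baseVec := by
  rw [topForm_apply, vol_comp, vol_baseVec]; ring

/-- The map `ℝ^(n+1) × ℝ^N → ℝ^(n+1)` which replaces the coordinate `x^μ` by `y^A`. -/
def replaceCoord (A : Fin N) (μ : Fin (n + 1)) : TotSp n N →L[ℝ] BaseSp n :=
  ContinuousLinearMap.fst ℝ (BaseSp n) (FibSp N)
    - ((EuclideanSpace.proj μ : BaseSp n →L[ℝ] ℝ).comp
        (ContinuousLinearMap.fst ℝ (BaseSp n) (FibSp N))).smulRight (baseVec μ)
    + ((EuclideanSpace.proj A : FibSp N →L[ℝ] ℝ).comp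
        (ContinuousLinearMap.snd ℝ (BaseSp n) (FibSp N))).smulRight (baseVec μ)

theorem replaceCoord_apply (A : Fin N) (μ : Fin (n + 1)) (u : TotSp n N) :
    replaceCoord A μ u = u.1 - u.1 μ • baseVec μ + u.2 A • baseVec μ := rfl

/-- The form `dy^A ∧ d^n x_μ`, written as the pullback of `d^{n+1}x` under the map replacing `x^μ`
by `y^A`. -/
def momBasis (A : Fin N) (μ : Fin (n + 1)) : DualModel n N :=
  ⟨(vol n).compContinuousLinearMap (replaceCoord A μ), by
    intro u i j hij hi hj
    change vol n (fun k => replaceCoord A μ (u k)) = 0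
    have key : ∀ c d : ℝ, ∀ v : Fin (n + 1) → BaseSp n, v i = c • baseVec μ →
        v j = d • baseVec μ → vol n v = 0 := by
      intro c d v hvi hvj
      have h1 : v = update (update v i (c • baseVec μ)) j (d • baseVec μ) := by
        rw [← hvi, ← hvj]; simp
      rw [h1, (vol n).map_update_smul, update_comm hij, (vol n).map_update_smul]
      rw [(vol n).map_eq_zero_of_eq _ (i := i) (j := j) _ hij]
      · simp
      · simp [hij.symm]
    refine key ((u i).2 A) ((u j).2 A) _ ?_ ?_
    · rw [replaceCoord_apply, hi]; simp
    · rw [replaceCoord_apply, hj]; simp⟩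

theorem mom_momBasis (A : Fin N) (μ ν : Fin (n + 1)) (h : FibSp N) :
    mom ν (momBasis A μ) h = if ν = μ then h A else 0 := by
  rw [mom_apply]
  change vol n (fun k => replaceCoord A μ (update (baseFrame n N) ν (0, h) k)) = _
  have hb : ∀ k, replaceCoord A μ (baseFrame n N k) = if k = μ then 0 else baseVec k := by
    intro k
    rw [replaceCoord_apply]
    by_cases hk : k = μ
    · subst hk; simp [baseFrame, baseVec]
    · simp [baseFrame, baseVec, hk, Ne.symm hk]
  by_cases hν : ν = μ
  · subst hν
    have : (fun k => replaceCoord A ν (update (baseFrame n N) ν (0, h) k)) =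
        update baseVec ν (h A • baseVec ν) := by
      funext k
      by_cases hk : k = ν
      · subst hk; simp [replaceCoord_apply]
      · simp [hk, hb]
    rw [this, (vol n).map_update_smul]
    simp
  · rw [if_neg hν]
    refine (vol n).map_coord_zero μ ?_
    rw [update_of_ne (Ne.symm hν), hb, if_pos rfl]

/-- The momenta `p_A^μ` are independent: they detect every collection of vertical vectors. -/
theorem mom_eq_zero_of_forall {h : Fin (n + 1) → FibSp N}
    (H : ∀ w : DualModel n N, ∑ μ, mom μ w (h μ) = 0) : h = 0 := by
  funext μ
  ext A
  have := H (momBasis A μ)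
  simpa [mom_momBasis] using this

end

section

variable {n N : ℕ}

/-! ### The first variation formula in coordinates -/

section Slices

variable {E G : Type*} [NormedAddCommGroup E] [NormedSpace ℝ E]
  [NormedAddCommGroup G] [NormedSpace ℝ G]

/-- Near `a` the derivative in the parameter at `0` is a value of the total derivative. -/
theorem eventually_deriv_slice_eq {q : ℝ × E → G} {a : E} (hq : ContDiffAt ℝ ∞ q (0, a)) :
    ∀ᶠ b in 𝓝 a, DifferentiableAt ℝ q (0, b) ∧
      HasDerivAt (fun t => q (t, b)) (fderiv ℝ q (0, b) (1, 0)) 0 := by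
  have h1 : ∀ᶠ p in 𝓝 ((0 : ℝ), a), DifferentiableAt ℝ q p := by
    have := (hq.of_le (m := 1) (by simp)).eventually (by simp)
    filter_upwards [this] with p hp
    exact hp.differentiableAt (by simp)
  have h2 : Filter.Tendsto (fun b : E => ((0 : ℝ), b)) (𝓝 a) (𝓝 ((0 : ℝ), a)) :=
    (Continuous.prodMk_right (0 : ℝ)).tendsto a
  filter_upwards [h2.eventually h1] with b hb
  refine ⟨hb, ?_⟩
  exact hb.hasFDerivAt.comp_hasDerivAt (0 : ℝ) ((hasDerivAt_id (0 : ℝ)).prodMk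
    (hasDerivAt_const (0 : ℝ) b))

theorem contDiffAt_deriv_slice {q : ℝ × E → G} {a : E} (hq : ContDiffAt ℝ ∞ q (0, a)) :
    ContDiffAt ℝ ∞ (fun b => deriv (fun t => q (t, b)) 0) a := by
  have h1 : ContDiffAt ℝ ∞ (fun b : E => fderiv ℝ q ((0 : ℝ), b) ((1 : ℝ), (0 : E))) a := by
    have h2 : ContDiffAt ℝ ∞ (fderiv ℝ q) ((0 : ℝ), a) := hq.fderiv_right (by simp)
    exact (h2.comp a (contDiffAt_const.prodMk contDiffAt_id)).clm_apply contDiffAt_const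
  refine h1.congr_of_eventuallyEq ?_
  filter_upwards [eventually_deriv_slice_eq hq] with b hb
  exact hb.2.deriv

theorem contDiffAt_slice {q : ℝ × E → G} {t : ℝ} {a : E} (hq : ContDiffAt ℝ ∞ q (t, a)) :
    ContDiffAt ℝ ∞ (fun b => q (t, b)) a :=
  ContDiffAt.comp a hq (contDiffAt_const.prodMk contDiffAt_id)

/-- The partial derivative in the parameter commutes with the derivative in the space variable. -/
theorem hasDerivAt_fderiv_slice {q : ℝ × E → G} {a : E} (hq : ContDiffAt ℝ ∞ q (0, a)) (v : E) :
    HasDerivAt (fun t => fderiv ℝ (fun b => q (t, b)) a v)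
      (fderiv ℝ (fun b => deriv (fun t => q (t, b)) 0) a v) 0 := by
  have hd : ContDiffAt ℝ ∞ (fderiv ℝ q) ((0 : ℝ), a) := hq.fderiv_right (by simp)
  have hd' : HasFDerivAt (fderiv ℝ q) (fderiv ℝ (fderiv ℝ q) (0, a)) ((0 : ℝ), a) :=
    (hd.differentiableAt (by simp)).hasFDerivAt
  have h1 : fderiv ℝ (fun b => deriv (fun t => q (t, b)) 0) a v =
      fderiv ℝ (fderiv ℝ q) (0, a) (0, v) (1, 0) := by
    have h2 : (fun b => deriv (fun t => q (t, b)) 0) =ᶠ[𝓝 a]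
        fun b => fderiv ℝ q ((0 : ℝ), b) ((1 : ℝ), (0 : E)) := by
      filter_upwards [eventually_deriv_slice_eq hq] with b hb
      exact hb.2.deriv
    rw [h2.fderiv_eq]
    have h3 : HasFDerivAt (fun b : E => fderiv ℝ q ((0 : ℝ), b))
        ((fderiv ℝ (fderiv ℝ q) (0, a)).comp (ContinuousLinearMap.inr ℝ ℝ E)) a :=
      hd'.comp a (hasFDerivAt_prodMk_right (0 : ℝ) a)
    have h4 := h3.clm_apply (hasFDerivAt_const ((1 : ℝ), (0 : E)) a)
    rw [h4.fderiv]
    simp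
  -- symmetry of the second derivative
  have hsymm : fderiv ℝ (fderiv ℝ q) (0, a) (0, v) (1, 0) =
      fderiv ℝ (fderiv ℝ q) (0, a) (1, 0) (0, v) :=
    (hq.isSymmSndFDerivAt (by simpa using (WithTop.coe_le_coe.2 le_top :
      ((2 : ℕ∞) : WithTop ℕ∞) ≤ ∞))) _ _
  rw [h1, hsymm]
  have h5 : HasDerivAt (fun t : ℝ => fderiv ℝ q (t, a)) (fderiv ℝ (fderiv ℝ q) (0, a) (1, 0)) 0 :=
    hd'.comp_hasDerivAt (0 : ℝ) ((hasDerivAt_id (0 : ℝ)).prodMk (hasDerivAt_const (0 : ℝ) a))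
  have h6 := h5.clm_apply (hasDerivAt_const (0 : ℝ) ((0 : ℝ), v))
  simp only [map_zero, add_zero] at h6
  refine h6.congr_of_eventuallyEq ?_
  have h7 : ∀ᶠ p in 𝓝 ((0 : ℝ), a), DifferentiableAt ℝ q p := by
    have := (hq.of_le (m := 1) (by simp)).eventually (by simp)
    filter_upwards [this] with p hp
    exact hp.differentiableAt (by simp)
  have h8 : Filter.Tendsto (fun t : ℝ => (t, a)) (𝓝 0) (𝓝 ((0 : ℝ), a)) :=
    (Continuous.prodMk_left a).tendsto 0
  filter_upwards [h8.eventually h7] with t ht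
  have h9 : HasFDerivAt (fun b : E => q (t, b))
        ((fderiv ℝ q (t, a)).comp (ContinuousLinearMap.inr ℝ ℝ E)) a :=
      ht.hasFDerivAt.comp a (hasFDerivAt_prodMk_right t a)
  rw [h9.fderiv]; simp

end Slices

/-- The integrand of the Hamilton-Pontryagin action in coordinates,
`p_A^μ (∂_μ y^A - v^A_μ) + L(x, y, v)`; the coordinate `p` drops out. -/
def density (ℓ : JetSp n N → ℝ) (Q : BaseSp n → PontSp n N) (a : BaseSp n) : ℝ :=
  ∑ μ, mom μ (Q a).2.2
    (fderiv ℝ (fun b => (Q b).1.2) a (baseVec μ) - (Q a).2.1 (baseVec μ)) +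
    ℓ ((Q a).1, (Q a).2.1)

/-- The Euler-Lagrange expression of the density, paired with a variation `δ`:
`δp_A^μ (∂_μ y^A - v^A_μ) + (∂L/∂v^A_μ - p_A^μ) δv^A_μ + (∂L/∂y^A - ∂_μ p_A^μ) δy^A`. -/
def eulerLagrange (ℓ : JetSp n N → ℝ) (Q : BaseSp n → PontSp n N) (a : BaseSp n)
    (δ : PontSp n N) : ℝ :=
  ∑ μ, (mom μ δ.2.2 (fderiv ℝ (fun b => (Q b).1.2) a (baseVec μ) - (Q a).2.1 (baseVec μ))
    - mom μ (Q a).2.2 (δ.2.1 (baseVec μ))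
    - mom μ (fderiv ℝ (fun b => (Q b).2.2) a (baseVec μ)) δ.1.2) +
    fderiv ℝ ℓ ((Q a).1, (Q a).2.1) (δ.1, δ.2.1)

/-- Integration by parts at the level of densities: the variation of the density is the
Euler-Lagrange expression plus the divergence of `p_A^μ δy^A`. -/
theorem hasDerivAt_density {ℓ : JetSp n N → ℝ} {q : ℝ × BaseSp n → PontSp n N} {a : BaseSp n}
    (hq : ContDiffAt ℝ ∞ q (0, a))
    (hℓ : DifferentiableAt ℝ ℓ ((q (0, a)).1, (q (0, a)).2.1)) :
    HasDerivAt (fun t => density ℓ (fun b => q (t, b)) a)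
      (eulerLagrange ℓ (fun b => q (0, b)) a (deriv (fun t => q (t, a)) 0) +
        ∑ μ, fderiv ℝ (fun b => mom μ (q (0, b)).2.2 (deriv (fun t => q (t, b)) 0).1.2) a
          (baseVec μ)) 0 := by
  have hδ := contDiffAt_deriv_slice hq
  have hev := eventually_deriv_slice_eq hq
  have hqt : HasDerivAt (fun t => q (t, a)) (deriv (fun t => q (t, a)) 0) 0 := by
    have := hev.self_of_nhds.2
    rwa [this.deriv]
  set δ := fun b => deriv (fun t => q (t, b)) 0 with hδd
  have hs := contDiffAt_slice hq
  have hyt : ∀ v, HasDerivAt (fun t => fderiv ℝ (fun b => (q (t, b)).1.2) a v)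
      (fderiv ℝ (fun b => (δ b).1.2) a v) 0 := by
    intro v
    have hy : ContDiffAt ℝ ∞ (fun p => (q p).1.2) (0, a) := hq.fst.snd
    have h1 := hasDerivAt_fderiv_slice hy v
    have h2 : (fun b => deriv (fun t => (q (t, b)).1.2) 0) =ᶠ[𝓝 a] fun b => (δ b).1.2 := by
      filter_upwards [hev] with b hb
      have hb1 : HasDerivAt (fun t => (q (t, b)).1) (fderiv ℝ q (0, b) (1, 0)).1 0 :=
        hb.2.fst
      have h3 : HasDerivAt (fun t => (q (t, b)).1.2) (fderiv ℝ q (0, b) (1, 0)).1.2 0 :=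
        hb1.snd
      rw [h3.deriv]
      change _ = (deriv (fun t => q (t, b)) 0).1.2
      rw [hb.2.deriv]
    rwa [h2.fderiv_eq] at h1
  have hq1 : HasDerivAt (fun t => (q (t, a)).1) (δ a).1 0 := hqt.fst
  have hq2 : HasDerivAt (fun t => (q (t, a)).2) (δ a).2 0 := hqt.snd
  have hv : HasDerivAt (fun t => (q (t, a)).2.1) (δ a).2.1 0 := hq2.fst
  have hw : HasDerivAt (fun t => (q (t, a)).2.2) (δ a).2.2 0 := hq2.snd
  have hmain : ∀ μ : Fin (n + 1), HasDerivAt (fun t => mom μ (q (t, a)).2.2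
      (fderiv ℝ (fun b => (q (t, b)).1.2) a (baseVec μ) - (q (t, a)).2.1 (baseVec μ)))
      (mom μ (δ a).2.2
        (fderiv ℝ (fun b => (q (0, b)).1.2) a (baseVec μ) - (q (0, a)).2.1 (baseVec μ)) +
        mom μ (q (0, a)).2.2
          (fderiv ℝ (fun b => (δ b).1.2) a (baseVec μ) - (δ a).2.1 (baseVec μ))) 0 := by
    intro μ
    have h1 : HasDerivAt (fun t => mom μ (q (t, a)).2.2) (mom μ (δ a).2.2) 0 :=
      (mom μ).hasFDerivAt.comp_hasDerivAt (0 : ℝ) hw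
    have h2 : HasDerivAt (fun t => (q (t, a)).2.1 (baseVec μ)) ((δ a).2.1 (baseVec μ)) 0 := by
      simpa using hv.clm_apply (hasDerivAt_const (0 : ℝ) (baseVec μ))
    exact h1.clm_apply ((hyt (baseVec μ)).sub h2)
  have hl : HasDerivAt (fun t => ℓ ((q (t, a)).1, (q (t, a)).2.1))
      (fderiv ℝ ℓ ((q (0, a)).1, (q (0, a)).2.1) ((δ a).1, (δ a).2.1)) 0 :=
    hℓ.hasFDerivAt.comp_hasDerivAt (0 : ℝ) (hq1.prodMk hv)
  have htot := (HasDerivAt.fun_sum fun μ (_ : μ ∈ Finset.univ) => hmain μ).add hl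
  refine htot.congr_deriv ?_
  -- the product rule trades `p_A^μ ∂_μ δy^A` for `-∂_μ p_A^μ δy^A` and a divergence
  have hdiv : ∀ μ : Fin (n + 1), fderiv ℝ (fun b => mom μ (q (0, b)).2.2 (δ b).1.2) a
      (baseVec μ) = mom μ (q (0, a)).2.2 (fderiv ℝ (fun b => (δ b).1.2) a (baseVec μ)) +
        mom μ (fderiv ℝ (fun b => (q (0, b)).2.2) a (baseVec μ)) (δ a).1.2 := by
    intro μ
    have hwd : DifferentiableAt ℝ (fun b => (q (0, b)).2.2) a :=
      hs.snd.snd.differentiableAt (by simp)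
    have h1 : HasFDerivAt (fun b => mom μ (q (0, b)).2.2)
        ((mom μ).comp (fderiv ℝ (fun b => (q (0, b)).2.2) a)) a :=
      (mom μ).hasFDerivAt.comp a hwd.hasFDerivAt
    have h2 : DifferentiableAt ℝ (fun b => (δ b).1.2) a :=
      hδ.fst.snd.differentiableAt (by simp)
    rw [(h1.clm_apply h2.hasFDerivAt).fderiv]
    rfl
  change _ = eulerLagrange ℓ (fun b => q (0, b)) a (δ a) +
    ∑ μ, fderiv ℝ (fun b => mom μ (q (0, b)).2.2 (δ b).1.2) a (baseVec μ)
  simp only [hdiv, eulerLagrange]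
  rw [add_right_comm, ← Finset.sum_add_distrib]
  congr 1
  refine Finset.sum_congr rfl fun μ _ => ?_
  simp only [map_sub]
  ring

end

section

variable {n : ℕ} {X : Type*} [TopologicalSpace X] [ChartedSpace (BaseSp n) X]

/-! ### Top-degree forms on the base in arbitrary smooth charts -/

/-- A smooth chart of the base, which need not be a preferred one. -/
structure IsSmoothChart (c : OpenPartialHomeomorph X (BaseSp n)) : Prop where
  smooth : ContMDiffOn 𝓘(ℝ, BaseSp n) 𝓘(ℝ, BaseSp n) ∞ c c.source
  smooth_symm : ContMDiffOn 𝓘(ℝ, BaseSp n) 𝓘(ℝ, BaseSp n) ∞ c.symm c.target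

theorem isSmoothChart_chartAt [IsManifold 𝓘(ℝ, BaseSp n) ∞ X] (i : X) :
    IsSmoothChart (chartAt (BaseSp n) i) :=
  ⟨contMDiffOn_chart, contMDiffOn_chart_symm⟩

/-- The vectors of `T_x X`, `x = c⁻¹ a`, given by the coordinate frame of the chart `c`. -/
def chartFrame (c : OpenPartialHomeomorph X (BaseSp n)) (a : BaseSp n) :
    Fin (n + 1) → BaseSp n :=
  fun μ => mfderiv 𝓘(ℝ, BaseSp n) 𝓘(ℝ, BaseSp n) c.symm a (baseVec μ)

/-- The value of a form at a point, as a form on the model space. -/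
def formAt (α : DiffForm (BaseSp n) X (n + 1)) (x : X) : BaseSp n [⋀^Fin (n + 1)]→L[ℝ] ℝ := α x

/-- The coefficient of a form of top degree in a chart. -/
def coeffIn (c : OpenPartialHomeomorph X (BaseSp n)) (α : DiffForm (BaseSp n) X (n + 1))
    (a : BaseSp n) : ℝ :=
  (formAt α (c.symm a)) (chartFrame c a)

/-- The Jacobian determinant of the change of charts from `c` to `c'`. -/
def jac (c c' : OpenPartialHomeomorph X (BaseSp n)) (a : BaseSp n) : ℝ :=
  vol n fun μ => fderiv ℝ (fun b => c' (c.symm b)) a (baseVec μ)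

theorem jac_eq_det (c c' : OpenPartialHomeomorph X (BaseSp n)) (a : BaseSp n) :
    jac c c' a = (fderiv ℝ (fun b => c' (c.symm b)) a).det := by
  rw [jac, vol_comp, vol_baseVec, mul_one]

variable {c c' : OpenPartialHomeomorph X (BaseSp n)}

theorem contDiffOn_chartChange (hc : IsSmoothChart c) (hc' : IsSmoothChart c') :
    ContDiffOn ℝ ∞ (fun b => c' (c.symm b)) (c.symm ≫ₕ c').source := by
  rw [← contMDiffOn_iff_contDiffOn]
  exact hc'.smooth.comp (hc.smooth_symm.mono fun q hq => hq.1) fun q hq => hq.2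

theorem contDiffOn_jac (hc : IsSmoothChart c) (hc' : IsSmoothChart c') :
    ContDiffOn ℝ ∞ (jac c c') (c.symm ≫ₕ c').source := by
  refine (vol n).toContinuousMultilinearMap.contDiff.comp_contDiffOn (contDiffOn_pi.2 fun μ => ?_)
  exact ((contDiffOn_chartChange hc hc').fderiv_of_isOpen (c.symm ≫ₕ c').open_source
    (by simp)).clm_apply contDiffOn_const

theorem chartFrame_change (hc : IsSmoothChart c) (hc' : IsSmoothChart c') {a : BaseSp n}
    (ha : a ∈ c.target) (ha' : c.symm a ∈ c'.source) (μ : Fin (n + 1)) :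
    chartFrame c a μ = mfderiv 𝓘(ℝ, BaseSp n) 𝓘(ℝ, BaseSp n) c'.symm (c' (c.symm a))
      (fderiv ℝ (fun b => c' (c.symm b)) a (baseVec μ)) := by
  have hO : (c.symm ≫ₕ c').source ∈ 𝓝 a := (c.symm ≫ₕ c').open_source.mem_nhds ⟨ha, ha'⟩
  have h1 : HasMFDerivAt 𝓘(ℝ, BaseSp n) 𝓘(ℝ, BaseSp n) (fun b => c' (c.symm b)) a
      (fderiv ℝ (fun b => c' (c.symm b)) a) :=
    (((contDiffOn_chartChange hc hc').contDiffAt hO).differentiableAt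
      (by simp)).hasFDerivAt.hasMFDerivAt
  have h2 := (hc'.smooth_symm.contMDiffAt (c'.open_target.mem_nhds
    (c'.map_source ha'))).mdifferentiableAt (by simp) |>.hasMFDerivAt
  have h3 := h2.comp a h1
  have h4 : HasMFDerivAt 𝓘(ℝ, BaseSp n) 𝓘(ℝ, BaseSp n) c.symm a _ :=
    h3.congr_of_eventuallyEq (by
      filter_upwards [hO] with b hb
      exact (c'.left_inv hb.2).symm)
  rw [chartFrame, h4.mfderiv]
  rfl

/-- The coefficient of a form of top degree transforms with the Jacobian determinant. -/
theorem coeffIn_change (hc : IsSmoothChart c) (hc' : IsSmoothChart c')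
    (α : DiffForm (BaseSp n) X (n + 1)) {a : BaseSp n}
    (ha : a ∈ c.target) (ha' : c.symm a ∈ c'.source) :
    coeffIn c α a = jac c c' a * coeffIn c' α (c' (c.symm a)) := by
  rw [coeffIn, coeffIn, jac_eq_det]
  rw [c'.left_inv ha', funext (chartFrame_change hc hc' ha ha')]
  exact topForm_comp ((formAt α (c.symm a)).compContinuousLinearMap
    (mfderiv 𝓘(ℝ, BaseSp n) 𝓘(ℝ, BaseSp n) c'.symm (c' (c.symm a)))) _

theorem vol_chartFrame_ne_zero (hc : IsSmoothChart c) {a : BaseSp n} (ha : a ∈ c.target) :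
    vol n (chartFrame c a) ≠ 0 := by
  set x := c.symm a with hx
  have hxs : x ∈ c.source := c.map_target ha
  have h1 := (hc.smooth.contMDiffAt (c.open_source.mem_nhds hxs)).mdifferentiableAt (by simp)
    |>.hasMFDerivAt
  have h2 := (hc.smooth_symm.contMDiffAt (c.open_target.mem_nhds ha)).mdifferentiableAt (by simp)
    |>.hasMFDerivAt
  have h3 : HasMFDerivAt 𝓘(ℝ, BaseSp n) 𝓘(ℝ, BaseSp n) (fun b => c (c.symm b)) a _ :=
    h1.comp a h2
  have h4 : HasMFDerivAt 𝓘(ℝ, BaseSp n) 𝓘(ℝ, BaseSp n) (fun b => c (c.symm b)) a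
      (ContinuousLinearMap.id ℝ (BaseSp n)) := by
    refine (hasMFDerivAt_id a).congr_of_eventuallyEq ?_
    filter_upwards [c.open_target.mem_nhds ha] with b hb
    exact c.right_inv hb
  have h5 := hasMFDerivAt_unique h3 h4
  intro h0
  have h6 := vol_comp (show BaseSp n →L[ℝ] BaseSp n from
    mfderiv 𝓘(ℝ, BaseSp n) 𝓘(ℝ, BaseSp n) c x) (chartFrame c a)
  rw [h0, mul_zero] at h6
  have h7 : (fun i => (show BaseSp n →L[ℝ] BaseSp n from
    mfderiv 𝓘(ℝ, BaseSp n) 𝓘(ℝ, BaseSp n) c x) (chartFrame c a i)) = baseVec := by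
    funext i
    exact congrArg (fun T : BaseSp n →L[ℝ] BaseSp n => T (baseVec i)) h5
  rw [h7, vol_baseVec] at h6
  exact one_ne_zero h6

theorem coeffIn_eq_mul_vol (c : OpenPartialHomeomorph X (BaseSp n))
    (α : DiffForm (BaseSp n) X (n + 1)) (a : BaseSp n) :
    coeffIn c α a = (formAt α (c.symm a)) baseVec *
      vol n (chartFrame c a) := topForm_apply _ _

theorem coeffIn_ne_zero {η : DiffForm (BaseSp n) X (n + 1)} (hη : IsVolumeForm η)
    (hc : IsSmoothChart c) {a : BaseSp n} (ha : a ∈ c.target) : coeffIn c η a ≠ 0 := by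
  rw [coeffIn_eq_mul_vol]
  refine mul_ne_zero (fun h => hη.2 (c.symm a) ?_) (vol_chartFrame_ne_zero hc ha)
  apply ContinuousAlternatingMap.ext
  intro v
  exact (topForm_apply (formAt η (c.symm a)) v).trans (by rw [h, zero_mul]; rfl)

section

variable [IsManifold 𝓘(ℝ, BaseSp n) ∞ X]

theorem contDiffOn_coeffIn {η : DiffForm (BaseSp n) X (n + 1)} (hη : IsSmoothForm η)
    (hc : IsSmoothChart c) : ContDiffOn ℝ ∞ (coeffIn c η) c.target := by
  intro a ha
  set i := c.symm a with hi
  have hi' : i ∈ (chartAt (BaseSp n) i).source := mem_chart_source _ _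
  have hO : (c.symm ≫ₕ chartAt (BaseSp n) i).source ∈ 𝓝 a :=
    (c.symm ≫ₕ chartAt (BaseSp n) i).open_source.mem_nhds ⟨ha, hi'⟩
  have h1 : ContDiffOn ℝ ∞ (coeffIn (chartAt (BaseSp n) i) η) (chartAt (BaseSp n) i).target := by
    have := (ContinuousAlternatingMap.apply ℝ (BaseSp n) ℝ
      (baseVec : Fin (n + 1) → BaseSp n)).contDiff.comp_contDiffOn (hη i)
    exact this
  have h2 := (contDiffOn_jac hc (isSmoothChart_chartAt i)).mul
    (h1.comp (contDiffOn_chartChange hc (isSmoothChart_chartAt i))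
      fun b hb => (chartAt (BaseSp n) i).map_source hb.2)
  refine ContDiffAt.contDiffWithinAt ((h2.contDiffAt hO).congr_of_eventuallyEq ?_)
  filter_upwards [hO] with b hb
  exact coeffIn_change hc (isSmoothChart_chartAt i) η hb.1 hb.2

/-- A form of top degree with continuous coefficients. -/
def IsContForm (α : DiffForm (BaseSp n) X (n + 1)) : Prop :=
  ∀ i : X, ContinuousOn (coeffIn (chartAt (BaseSp n) i) α) (chartAt (BaseSp n) i).target

theorem IsContForm.continuousOn {α : DiffForm (BaseSp n) X (n + 1)} (hα : IsContForm α)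
    (hc : IsSmoothChart c) : ContinuousOn (coeffIn c α) c.target := by
  intro a ha
  set i := c.symm a with hi
  have hi' : i ∈ (chartAt (BaseSp n) i).source := mem_chart_source _ _
  have hO : (c.symm ≫ₕ chartAt (BaseSp n) i).source ∈ 𝓝 a :=
    (c.symm ≫ₕ chartAt (BaseSp n) i).open_source.mem_nhds ⟨ha, hi'⟩
  have h2 := (contDiffOn_jac hc (isSmoothChart_chartAt i)).continuousOn.mul
    ((hα i).comp (contDiffOn_chartChange hc (isSmoothChart_chartAt i)).continuousOn
      fun b hb => (chartAt (BaseSp n) i).map_source hb.2)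
  refine ContinuousAt.continuousWithinAt ((h2.continuousAt hO).congr ?_)
  filter_upwards [hO] with b hb
  exact (coeffIn_change hc (isSmoothChart_chartAt i) α hb.1 hb.2).symm

end

/-! ### One-parameter families of top-degree forms -/

/-- The derivative at `t = 0` of a one-parameter family of forms of top degree. -/
def derivForm (α : ℝ → DiffForm (BaseSp n) X (n + 1)) : DiffForm (BaseSp n) X (n + 1) := fun x =>
  deriv (fun t => (formAt (α t) x) baseVec) 0 • vol n

theorem coeffIn_derivForm (α : ℝ → DiffForm (BaseSp n) X (n + 1))
    (c : OpenPartialHomeomorph X (BaseSp n)) (a : BaseSp n) :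
    coeffIn c (derivForm α) a = deriv (fun t => coeffIn c (α t) a) 0 := by
  have h1 : (fun t => coeffIn c (α t) a) = fun t =>
      (formAt (α t) (c.symm a)) baseVec *
        vol n (chartFrame c a) := by
    funext t
    exact coeffIn_eq_mul_vol c (α t) a
  rw [h1, deriv_mul_const_field]
  rfl

/-- A one-parameter family of forms of top degree with jointly smooth coefficients. -/
def IsSmoothFormFamily (α : ℝ → DiffForm (BaseSp n) X (n + 1)) : Prop :=
  ∀ i : X, ContDiffOn ℝ ∞ (fun p : ℝ × BaseSp n => coeffIn (chartAt (BaseSp n) i) (α p.1) p.2)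
    (univ ×ˢ (chartAt (BaseSp n) i).target)

theorem IsSmoothFormFamily.isContForm {α : ℝ → DiffForm (BaseSp n) X (n + 1)}
    (hα : IsSmoothFormFamily α) (t : ℝ) : IsContForm (α t) := fun i =>
  (hα i).continuousOn.comp (Continuous.prodMk_right t).continuousOn fun _ ha => ⟨trivial, ha⟩

/-- The partial derivative of a smooth function of a parameter and a point, with respect to the
parameter. -/
theorem hasDerivAt_of_contDiffOn {f : ℝ × BaseSp n → ℝ} {T : Set (BaseSp n)} (hT : IsOpen T)
    (hf : ContDiffOn ℝ ∞ f (univ ×ˢ T)) {t : ℝ} {a : BaseSp n} (ha : a ∈ T) :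
    HasDerivAt (fun t => f (t, a)) (fderiv ℝ f (t, a) (1, 0)) t := by
  have h1 : DifferentiableAt ℝ f (t, a) :=
    (hf.contDiffAt ((isOpen_univ.prod hT).mem_nhds ⟨trivial, ha⟩)).differentiableAt (by simp)
  exact h1.hasFDerivAt.comp_hasDerivAt t ((hasDerivAt_id t).prodMk (hasDerivAt_const t a))

theorem continuousOn_fderiv_param {f : ℝ × BaseSp n → ℝ} {T : Set (BaseSp n)} (hT : IsOpen T)
    (hf : ContDiffOn ℝ ∞ f (univ ×ˢ T)) :
    ContinuousOn (fun p => fderiv ℝ f p (1, 0)) (univ ×ˢ T) :=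
  (hf.continuousOn_fderiv_of_isOpen (isOpen_univ.prod hT) (by simp)).clm_apply continuousOn_const

theorem IsSmoothFormFamily.isContForm_derivForm {α : ℝ → DiffForm (BaseSp n) X (n + 1)}
    (hα : IsSmoothFormFamily α) : IsContForm (derivForm α) := by
  intro i
  have h1 := (continuousOn_fderiv_param (chartAt (BaseSp n) i).open_target (hα i)).comp
    (Continuous.prodMk_right (0 : ℝ)).continuousOn (s := (chartAt (BaseSp n) i).target)
    fun _ ha => ⟨trivial, ha⟩
  refine h1.congr fun a ha => ?_
  rw [coeffIn_derivForm]
  exact (hasDerivAt_of_contDiffOn (chartAt (BaseSp n) i).open_target (hα i) ha).deriv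

theorem continuousOn_sign {E : Type*} [TopologicalSpace E] {f : E → ℝ} {s : Set E}
    (hf : ContinuousOn f s) (h0 : ∀ a ∈ s, f a ≠ 0) :
    ContinuousOn (fun a => Real.sign (f a)) s := by
  have h1 : ContinuousOn (fun a => f a / |f a|) s :=
    hf.div hf.abs fun a ha => abs_ne_zero.2 (h0 a ha)
  refine h1.congr fun a ha => ?_
  rcases lt_or_gt_of_ne (h0 a ha) with h | h
  · simp only [Real.sign_of_neg h, abs_of_neg h, div_neg, div_self h.ne]
  · simp only [Real.sign_of_pos h, abs_of_pos h, div_self h.ne']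

theorem sign_mul_self_mul (x y z : ℝ) :
    Real.sign (x * y) * (x * z) = |x| * (Real.sign y * z) := by
  rcases lt_trichotomy x 0 with h | rfl | h
  · rw [abs_of_neg h]
    rcases lt_trichotomy y 0 with h' | rfl | h'
    · rw [Real.sign_of_pos (mul_pos_of_neg_of_neg h h'), Real.sign_of_neg h']; ring
    · simp
    · rw [Real.sign_of_neg (mul_neg_of_neg_of_pos h h'), Real.sign_of_pos h']; ring
  · simp
  · rw [abs_of_pos h]
    rcases lt_trichotomy y 0 with h' | rfl | h'
    · rw [Real.sign_of_neg (mul_neg_of_pos_of_neg h h'), Real.sign_of_neg h']; ring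
    · simp
    · rw [Real.sign_of_pos (mul_pos h h'), Real.sign_of_pos h']; ring

end

section

/-! ### Integration of top-degree forms -/

section

variable {n : ℕ} {X : Type*} [TopologicalSpace X] [ChartedSpace (BaseSp n) X]
  [IsManifold 𝓘(ℝ, BaseSp n) ∞ X] [T2Space X] [SigmaCompactSpace X]
  {c : OpenPartialHomeomorph X (BaseSp n)} {η : DiffForm (BaseSp n) X (n + 1)}

/-- The contribution of the `i`-th preferred chart to the integral of a form. -/
def intPiece (η α : DiffForm (BaseSp n) X (n + 1)) (i : X) (a : BaseSp n) : ℝ :=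
  chartPartition n X i ((chartAt (BaseSp n) i).symm a) *
    (Real.sign (coeffIn (chartAt (BaseSp n) i) η a) * coeffIn (chartAt (BaseSp n) i) α a)

/-- The domain of integration in the `i`-th preferred chart. -/
def intDomain (U : Set X) (i : X) : Set (BaseSp n) :=
  (chartAt (BaseSp n) i).target ∩ (chartAt (BaseSp n) i).symm ⁻¹' U

theorem integralOn_def (η α : DiffForm (BaseSp n) X (n + 1)) (U : Set X) :
    integralOn η U α = ∑ᶠ i : X, ∫ a in intDomain U i, intPiece η α i a := rfl

theorem isOpen_intDomain {U : Set X} (hU : IsOpen U) (i : X) : IsOpen (intDomain (n := n) U i) :=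
  (chartAt (BaseSp n) i).isOpen_inter_preimage_symm hU

/-- Over a relatively compact set only finitely many charts contribute to the integral. -/
theorem exists_finset_chartPartition {K : Set X} (hK : IsCompact K) :
    ∃ I : Finset X, ∀ i ∉ I, ∀ x ∈ K, chartPartition n X i x = 0 := by
  have h := (chartPartition n X).locallyFinite.finite_nonempty_inter_compact hK
  refine ⟨h.toFinset, fun i hi x hx => ?_⟩
  by_contra h0
  exact hi (h.mem_toFinset.2 ⟨x, h0, hx⟩)

theorem integralOn_eq_sum {U : Set X} {I : Finset X} (hUo : IsOpen U)
    (hI : ∀ i ∉ I, ∀ x ∈ U, chartPartition n X i x = 0) (α : DiffForm (BaseSp n) X (n + 1)) :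
    integralOn η U α = ∑ i ∈ I, ∫ a in intDomain U i, intPiece η α i a := by
  rw [integralOn_def]
  refine finsum_eq_sum_of_support_subset _ fun i hi => ?_
  by_contra hiI
  apply hi
  change ∫ a in intDomain U i, intPiece η α i a = 0
  rw [MeasureTheory.setIntegral_congr_fun (g := fun _ => 0)
    (isOpen_intDomain hUo i).measurableSet]
  · simp
  · intro a ha
    change _ * _ = (0 : ℝ)
    rw [hI i hiI _ ha.2, zero_mul]

/-- The compact part of the `i`-th chart domain that contributes to integrals over `U`. -/
def intCompact (n : ℕ) {X : Type*} [TopologicalSpace X] [ChartedSpace (BaseSp n) X]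
    [IsManifold 𝓘(ℝ, BaseSp n) ∞ X] [T2Space X] [SigmaCompactSpace X] (U : Set X) (i : X) :
    Set (BaseSp n) :=
  chartAt (BaseSp n) i '' (closure U ∩ tsupport (chartPartition n X i))

theorem isCompact_intCompact {U : Set X} (hU : IsCompact (closure U)) (i : X) :
    IsCompact (intCompact n U i) :=
  (hU.inter_right (isClosed_tsupport _)).image_of_continuousOn
    ((chartAt (BaseSp n) i).continuousOn.mono fun _ hx => chartPartition_isSubordinate i hx.2)

theorem intCompact_subset (U : Set X) (i : X) :
    intCompact n U i ⊆ (chartAt (BaseSp n) i).target := by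
  rintro _ ⟨x, hx, rfl⟩
  exact (chartAt (BaseSp n) i).map_source (chartPartition_isSubordinate i hx.2)

theorem chartPartition_eq_zero {U : Set X} {i : X} {a : BaseSp n} (ha : a ∈ intDomain U i)
    (ha' : a ∉ intCompact n U i) :
    chartPartition n X i ((chartAt (BaseSp n) i).symm a) = 0 := by
  by_contra h
  refine ha' ⟨(chartAt (BaseSp n) i).symm a, ⟨subset_closure ha.2, subset_tsupport _ h⟩, ?_⟩
  exact (chartAt (BaseSp n) i).right_inv ha.1

theorem continuousOn_chartPartition (i : X) :
    ContinuousOn (fun a => chartPartition n X i ((chartAt (BaseSp n) i).symm a))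
      (chartAt (BaseSp n) i).target :=
  (chartPartition n X i).contMDiff.continuous.comp_continuousOn
    (chartAt (BaseSp n) i).continuousOn_symm

theorem IsVolumeForm.continuousOn_sign (hη : IsVolumeForm η) (hc : IsSmoothChart c) :
    ContinuousOn (fun a => Real.sign (coeffIn c η a)) c.target :=
  HamiltonPontryagin.continuousOn_sign (contDiffOn_coeffIn hη.1 hc).continuousOn
    fun _ ha => coeffIn_ne_zero hη hc ha

theorem continuousOn_intPiece (hη : IsVolumeForm η) {α : DiffForm (BaseSp n) X (n + 1)}
    (hα : IsContForm α) (i : X) :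
    ContinuousOn (intPiece η α i) (chartAt (BaseSp n) i).target :=
  (continuousOn_chartPartition i).mul
    ((hη.continuousOn_sign (isSmoothChart_chartAt i)).mul (hα i))

theorem integrableOn_intPiece (hη : IsVolumeForm η) {α : DiffForm (BaseSp n) X (n + 1)}
    (hα : IsContForm α) {U : Set X} (hUo : IsOpen U) (hU : IsCompact (closure U)) (i : X) :
    MeasureTheory.IntegrableOn (intPiece η α i) (intDomain U i) := by
  have h1 : MeasureTheory.IntegrableOn (intPiece η α i) (intCompact n U i) :=
    ((continuousOn_intPiece hη hα i).mono (intCompact_subset U i)).integrableOn_compact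
      (isCompact_intCompact hU i)
  refine (h1.mono_set (inter_subset_right (s := intDomain U i))).of_forall_sdiff_eq_zero
    (isOpen_intDomain hUo i).measurableSet ?_
  rintro a ⟨ha, ha'⟩
  rw [intPiece, chartPartition_eq_zero ha fun h => ha' ⟨ha, h⟩, zero_mul]

theorem integralOn_sum (hη : IsVolumeForm η) {ι : Type*} (J : Finset ι)
    {α : ι → DiffForm (BaseSp n) X (n + 1)} {β : DiffForm (BaseSp n) X (n + 1)}
    (hα : ∀ k ∈ J, IsContForm (α k)) {U : Set X} (hUo : IsOpen U) (hU : IsCompact (closure U))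
    (hβ : ∀ (i : X), ∀ a ∈ intDomain U i, coeffIn (chartAt (BaseSp n) i) β a =
      ∑ k ∈ J, coeffIn (chartAt (BaseSp n) i) (α k) a) :
    integralOn η U β = ∑ k ∈ J, integralOn η U (α k) := by
  obtain ⟨I, hI⟩ := exists_finset_chartPartition (n := n) hU
  have hI' : ∀ i ∉ I, ∀ x ∈ U, chartPartition n X i x = 0 :=
    fun i hi x hx => hI i hi x (subset_closure hx)
  simp only [integralOn_eq_sum hUo hI']
  rw [Finset.sum_comm]
  refine Finset.sum_congr rfl fun i _ => ?_
  rw [← MeasureTheory.integral_finsetSum _ fun k hk => integrableOn_intPiece hη (hα k hk) hUo hU i]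
  refine MeasureTheory.setIntegral_congr_fun (isOpen_intDomain hUo i).measurableSet fun a ha => ?_
  simp only [intPiece, hβ i a ha, Finset.mul_sum]

/-- The integral of a form supported in a compact part of the domain of a smooth chart can be
computed in this chart. -/
theorem integralOn_eq_of_support (hη : IsVolumeForm η) (hc : IsSmoothChart c)
    {α : DiffForm (BaseSp n) X (n + 1)} (hα : IsContForm α) {U : Set X} (hUo : IsOpen U)
    {K : Set X} (hK : IsCompact K) (hKU : K ⊆ U) (hKc : K ⊆ c.source)
    (h0 : ∀ x ∉ K, (formAt α x) = 0) :
    integralOn η U α = ∫ a in c.target, Real.sign (coeffIn c η a) * coeffIn c α a := by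
  obtain ⟨I, hI⟩ := exists_finset_chartPartition (n := n) hK
  have hcoeff : ∀ (c' : OpenPartialHomeomorph X (BaseSp n)) (a : BaseSp n), c'.symm a ∉ K →
      coeffIn c' α a = 0 := by
    intro c' a ha
    rw [coeffIn, h0 _ ha]; rfl
  -- each contribution is transported to the chart `c` by the change of variables formula
  have hpiece : ∀ i : X, ∫ a in intDomain U i, intPiece η α i a =
      ∫ b in c.target, chartPartition n X i (c.symm b) *
        (Real.sign (coeffIn c η b) * coeffIn c α b) := by
    intro i
    set d := chartAt (BaseSp n) i with hd
    have hdS : IsSmoothChart d := isSmoothChart_chartAt i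
    set S := (d.symm ≫ₕ c).source with hS
    have hSo : IsOpen S := (d.symm ≫ₕ c).open_source
    have hSmem : ∀ a, a ∈ S ↔ a ∈ d.target ∧ d.symm a ∈ c.source := fun a => Iff.rfl
    set g : BaseSp n → ℝ := fun b => chartPartition n X i (c.symm b) *
        (Real.sign (coeffIn c η b) * coeffIn c α b) with hg
    -- off the domain of `c` and off `U` the form vanishes, so that only the overlap of the charts
    -- matters; `chartPartition` takes care of the part of `c.target` outside the image of the overlap
    have e1 : ∫ a in S ∩ intDomain U i, intPiece η α i a =
        ∫ a in intDomain U i, intPiece η α i a := by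
      refine (MeasureTheory.setIntegral_eq_of_subset_of_forall_sdiff_eq_zero
        (isOpen_intDomain hUo i).measurableSet inter_subset_right ?_).symm
      rintro a ⟨ha, ha'⟩
      have : d.symm a ∉ K := fun hk => ha' ⟨⟨ha.1, hKc hk⟩, ha⟩
      rw [intPiece, hcoeff _ _ this, mul_zero, mul_zero]
    have e2 : ∫ a in S ∩ intDomain U i, intPiece η α i a = ∫ a in S, intPiece η α i a := by
      refine (MeasureTheory.setIntegral_eq_of_subset_of_forall_sdiff_eq_zero
        hSo.measurableSet inter_subset_left ?_).symm
      rintro a ⟨ha, ha'⟩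
      have : d.symm a ∉ K := fun hk => ha' ⟨ha, ha.1, hKU hk⟩
      rw [intPiece, hcoeff _ _ this, mul_zero, mul_zero]
    have e3 : ∫ b in (fun a => c (d.symm a)) '' S, g b = ∫ b in c.target, g b := by
      refine (MeasureTheory.setIntegral_eq_of_subset_of_forall_sdiff_eq_zero
        c.open_target.measurableSet ?_ ?_).symm
      · rintro _ ⟨a, ha, rfl⟩
        exact c.map_source ha.2
      · rintro b ⟨hb, hb'⟩
        have : c.symm b ∉ d.source := by
          intro h
          refine hb' ⟨d (c.symm b), ⟨d.map_source h, ?_⟩, ?_⟩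
          · change d.symm (d (c.symm b)) ∈ c.source
            rw [d.left_inv h]; exact c.map_target hb
          · change c (d.symm (d (c.symm b))) = b
            rw [d.left_inv h, c.right_inv hb]
        have h1 : chartPartition n X i (c.symm b) = 0 := by
          by_contra h1
          exact this (chartPartition_isSubordinate i (subset_tsupport _ h1))
        simp only [hg, h1, zero_mul]
    rw [← e1, e2, ← e3, MeasureTheory.integral_image_eq_integral_abs_det_fderiv_smul
      MeasureTheory.volume hSo.measurableSet
      (f' := fun a => fderiv ℝ (fun b => c (d.symm b)) a)]
    · refine MeasureTheory.setIntegral_congr_fun hSo.measurableSet fun a ha => ?_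
      simp only [intPiece, hg, smul_eq_mul]
      rw [coeffIn_change hdS hc η ha.1 ha.2, coeffIn_change hdS hc α ha.1 ha.2,
        sign_mul_self_mul, jac_eq_det, c.left_inv ((hSmem a).1 ha).2]
      ring
    · intro a ha
      exact (((contDiffOn_chartChange hdS hc).contDiffAt (hSo.mem_nhds ha)).differentiableAt
        (by simp)).hasFDerivAt.hasFDerivWithinAt
    · exact (d.symm ≫ₕ c).injOn
  have hk : IsCompact (c '' K) := hK.image_of_continuousOn (c.continuousOn.mono hKc)
  have hkt : c '' K ⊆ c.target := by
    rintro _ ⟨x, hx, rfl⟩; exact c.map_source (hKc hx)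
  have hoff : ∀ b ∈ c.target, b ∉ c '' K → c.symm b ∉ K :=
    fun b hb hb' hK' => hb' ⟨_, hK', c.right_inv hb⟩
  -- the integrands vanish outside the compact image of `K`
  have hint : ∀ i ∈ I, MeasureTheory.IntegrableOn (fun b => chartPartition n X i (c.symm b) *
      (Real.sign (coeffIn c η b) * coeffIn c α b)) c.target := by
    intro i _
    have h1 : ContinuousOn (fun b => chartPartition n X i (c.symm b) *
        (Real.sign (coeffIn c η b) * coeffIn c α b)) c.target :=
      ((chartPartition n X i).contMDiff.continuous.comp_continuousOn c.continuousOn_symm).mul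
        ((hη.continuousOn_sign hc).mul (hα.continuousOn hc))
    refine ((h1.mono hkt).integrableOn_compact hk).of_forall_sdiff_eq_zero
      c.open_target.measurableSet ?_
    rintro b ⟨hb, hb'⟩
    rw [hcoeff _ _ (hoff b hb hb'), mul_zero, mul_zero]
  rw [integralOn_def, finsum_eq_sum_of_support_subset (s := I)]
  · simp only [hpiece]
    rw [← MeasureTheory.integral_finsetSum _ hint]
    refine MeasureTheory.setIntegral_congr_fun c.open_target.measurableSet fun b hb => ?_
    simp only [← Finset.sum_mul]
    by_cases hbK : c.symm b ∈ K
    · have h1 := (chartPartition n X).sum_eq_one (mem_univ (c.symm b))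
      rw [finsum_eq_sum_of_support_subset (s := I)] at h1
      · rw [h1, one_mul]
      · intro i hi
        by_contra hiI
        exact hi (hI i hiI _ hbK)
    · rw [hcoeff _ _ hbK]; ring
  · intro i hi
    by_contra hiI
    apply hi
    change ∫ a in intDomain U i, intPiece η α i a = 0
    rw [MeasureTheory.setIntegral_congr_fun (g := fun _ => 0)
      (isOpen_intDomain hUo i).measurableSet]
    · simp
    · intro a ha
      by_cases hbK : (chartAt (BaseSp n) i).symm a ∈ K
      · simp only [intPiece, hI i hiI _ hbK, zero_mul]
      · simp only [intPiece, hcoeff _ _ hbK, mul_zero]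

/-- Differentiation under the integral sign for integrals of forms. -/
theorem hasDerivAt_integralOn (hη : IsVolumeForm η) {α : ℝ → DiffForm (BaseSp n) X (n + 1)}
    (hα : IsSmoothFormFamily α) {U : Set X} (hUo : IsOpen U) (hU : IsCompact (closure U)) :
    HasDerivAt (fun t => integralOn η U (α t)) (integralOn η U (derivForm α)) 0 := by
  obtain ⟨I, hI⟩ := exists_finset_chartPartition (n := n) hU
  have hI' : ∀ i ∉ I, ∀ x ∈ U, chartPartition n X i x = 0 :=
    fun i hi x hx => hI i hi x (subset_closure hx)
  simp only [integralOn_eq_sum hUo hI']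
  refine HasDerivAt.fun_sum fun i _ => ?_
  set d := chartAt (BaseSp n) i with hd
  set D := intDomain (n := n) U i with hD
  set k := intCompact n U i with hk
  have hDm : MeasurableSet D := (isOpen_intDomain hUo i).measurableSet
  have hkc : IsCompact k := isCompact_intCompact hU i
  -- the weight `chartPartition` restricts the integration to the compact set `k`, on which the
  -- derivative in the parameter is bounded uniformly in `t ∈ [-1, 1]`
  have hcut : ∀ β : DiffForm (BaseSp n) X (n + 1),
      ∫ a in D, intPiece η β i a = ∫ a in D ∩ k, intPiece η β i a := by
    intro β
    refine MeasureTheory.setIntegral_eq_of_subset_of_forall_sdiff_eq_zero hDm inter_subset_left ?_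
    rintro a ⟨ha, ha'⟩
    rw [intPiece, chartPartition_eq_zero ha fun h => ha' ⟨ha, h⟩, zero_mul]
  simp only [hcut]
  set f : ℝ × BaseSp n → ℝ := fun p => coeffIn d (α p.1) p.2 with hf
  have hfs : ContDiffOn ℝ ∞ f (univ ×ˢ d.target) := hα i
  set ρ : BaseSp n → ℝ := fun a => chartPartition n X i (d.symm a) *
    Real.sign (coeffIn d η a) with hρ
  have hρc : ContinuousOn ρ d.target :=
    (continuousOn_chartPartition i).mul (hη.continuousOn_sign (isSmoothChart_chartAt i))
  have hkt : k ⊆ d.target := intCompact_subset U i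
  have hf' := continuousOn_fderiv_param d.open_target hfs
  have hbdc : ContinuousOn (fun p : ℝ × BaseSp n => ρ p.2 * fderiv ℝ f p (1, 0))
      (Icc (-1) 1 ×ˢ k) :=
    (hρc.comp continuousOn_snd fun p hp => hkt hp.2).mul
      (hf'.mono fun p hp => ⟨trivial, hkt hp.2⟩)
  obtain ⟨C, hC⟩ := (isCompact_Icc.prod hkc).exists_bound_of_continuousOn hbdc
  have hmeas : MeasurableSet (D ∩ k) := hDm.inter hkc.measurableSet
  have hpiece : ∀ t a, intPiece η (α t) i a = ρ a * f (t, a) := by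
    intro t a; simp only [intPiece, hρ, hf]; ring
  have hpiece' : ∀ a ∈ D, intPiece η (derivForm α) i a = ρ a * fderiv ℝ f (0, a) (1, 0) := by
    intro a ha
    simp only [intPiece, coeffIn_derivForm, hρ]
    rw [(hasDerivAt_of_contDiffOn d.open_target hfs ha.1).deriv]; ring
  have hint : ∀ β, IsContForm β → MeasureTheory.IntegrableOn (intPiece η β i) (D ∩ k) :=
    fun β hβ => (integrableOn_intPiece hη hβ hUo hU i).mono_set inter_subset_left
  have hfin : MeasureTheory.volume (D ∩ k) < ⊤ :=
    (MeasureTheory.measure_mono inter_subset_right).trans_lt hkc.measure_lt_top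
  have main := hasDerivAt_integral_of_dominated_loc_of_deriv_le
    (μ := MeasureTheory.volume.restrict (D ∩ k))
    (F := fun t a => intPiece η (α t) i a)
    (F' := fun t a => ρ a * fderiv ℝ f (t, a) (1, 0)) (x₀ := 0) (s := Icc (-1) 1)
    (bound := fun _ => C) (Icc_mem_nhds (by norm_num) (by norm_num))
    (Filter.Eventually.of_forall fun t => (hint _ (hα.isContForm t)).aestronglyMeasurable)
    (hint _ (hα.isContForm 0)) ?_ ?_ ?_ ?_
  · refine main.2.congr_deriv ?_
    exact MeasureTheory.setIntegral_congr_fun hmeas fun a ha => (hpiece' a ha.1).symm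
  · refine (hint _ hα.isContForm_derivForm).aestronglyMeasurable.congr ?_
    refine (MeasureTheory.ae_restrict_iff' hmeas).2 (Filter.Eventually.of_forall fun a ha => ?_)
    exact hpiece' a ha.1
  · refine (MeasureTheory.ae_restrict_iff' hmeas).2 (Filter.Eventually.of_forall fun a ha => ?_)
    intro t ht
    exact hC (t, a) ⟨ht, ha.2⟩
  · exact MeasureTheory.integrableOn_const hfin.ne
  · refine (MeasureTheory.ae_restrict_iff' hmeas).2 (Filter.Eventually.of_forall fun a ha => ?_)
    intro t _
    simp only [hpiece]
    exact (hasDerivAt_of_contDiffOn d.open_target hfs ha.1.1).const_mul (ρ a)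

end

/-- The divergence theorem for a compactly supported vector field, weighted with the locally
constant sign of a nowhere vanishing function. -/
theorem setIntegral_sign_mul_fderiv_eq_zero {E : Type*} [NormedAddCommGroup E] [NormedSpace ℝ E]
    [FiniteDimensional ℝ E] [MeasurableSpace E] [BorelSpace E]
    (μ : MeasureTheory.Measure E) [μ.IsAddHaarMeasure]
    {D k : Set E} (hD : IsOpen D) (hk : IsCompact k) (hkD : k ⊆ D) {s g : E → ℝ}
    (hs : ContinuousOn s D) (hs0 : ∀ a ∈ D, s a ≠ 0) (hg : ContDiffOn ℝ ∞ g D)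
    (h0 : ∀ a ∈ D, a ∉ k → g a = 0) (v : E) :
    MeasureTheory.IntegrableOn (fun a => Real.sign (s a) * fderiv ℝ g a v) D μ ∧
    ∫ a in D, Real.sign (s a) * fderiv ℝ g a v ∂μ = 0 := by
  classical
  -- `G` is the extension by zero of `g`, multiplied by the sign, which is locally constant
  set G : E → ℝ := fun a => if a ∈ D then Real.sign (s a) * g a else 0 with hG
  have hlocD : ∀ a ∈ D, G =ᶠ[𝓝 a] fun b => Real.sign (s a) * g b := by
    intro a ha
    have h1 : ∀ᶠ b in 𝓝 a, Real.sign (s b) = Real.sign (s a) := by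
      have hc : ContinuousAt s a := hs.continuousAt (hD.mem_nhds ha)
      rcases lt_or_gt_of_ne (hs0 a ha) with h | h
      · filter_upwards [hc.eventually (gt_mem_nhds h)] with b hb
        rw [Real.sign_of_neg hb, Real.sign_of_neg h]
      · filter_upwards [hc.eventually (lt_mem_nhds h)] with b hb
        rw [Real.sign_of_pos hb, Real.sign_of_pos h]
    filter_upwards [h1, hD.mem_nhds ha] with b hb hbD
    simp only [hG, if_pos hbD, hb]
  have hloc0 : ∀ a ∉ k, G =ᶠ[𝓝 a] fun _ => 0 := by
    intro a ha
    filter_upwards [hk.isClosed.isOpen_compl.mem_nhds ha] with b hb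
    by_cases hbD : b ∈ D
    · simp only [hG, if_pos hbD, h0 b hbD hb, mul_zero]
    · simp only [hG, if_neg hbD]
  have hGs : ContDiff ℝ ∞ G := by
    rw [contDiff_iff_contDiffAt]
    intro a
    by_cases ha : a ∈ D
    · exact (contDiffAt_const.mul (hg.contDiffAt (hD.mem_nhds ha))).congr_of_eventuallyEq
        (hlocD a ha)
    · exact contDiffAt_const.congr_of_eventuallyEq (hloc0 a fun h => ha (hkD h))
  have hGc : HasCompactSupport G :=
    HasCompactSupport.intro hk fun a ha => (hloc0 a ha).self_of_nhds
  have hder : ∀ a ∈ D, Real.sign (s a) * fderiv ℝ g a v = fderiv ℝ G a v := by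
    intro a ha
    rw [(hlocD a ha).fderiv_eq]
    have hga : DifferentiableAt ℝ g a :=
      (hg.contDiffAt (hD.mem_nhds ha)).differentiableAt (by simp)
    rw [fderiv_const_mul hga]
    rfl
  have hdc : Continuous fun a => fderiv ℝ G a v :=
    (hGs.continuous_fderiv (by simp)).clm_apply continuous_const
  have hds : HasCompactSupport fun a => fderiv ℝ G a v := hGc.fderiv_apply ℝ v
  have hint : MeasureTheory.Integrable (fun a => fderiv ℝ G a v) μ :=
    hdc.integrable_of_hasCompactSupport hds
  refine ⟨hint.integrableOn.congr_fun (fun a ha => (hder a ha).symm) hD.measurableSet, ?_⟩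
  rw [MeasureTheory.setIntegral_congr_fun hD.measurableSet hder]
  rw [MeasureTheory.setIntegral_eq_integral_of_forall_compl_eq_zero]
  -- integration by parts against the constant function `1`
  · have h := integral_mul_fderiv_eq_neg_fderiv_mul_of_integrable (μ := μ) (𝕜 := ℝ)
      (f := fun _ : E => (1 : ℝ)) (g := G) (v := v) (by simp)
      (by simpa using hint) (by simpa using hGs.continuous.integrable_of_hasCompactSupport hGc)
      (by intro x _; fun_prop) (fun x _ => hGs.differentiable (by simp) x)
    simpa using h
  · intro a ha
    rw [(hloc0 a fun h => ha (hkD h)).fderiv_eq]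
    simp

end

section

variable {n N : ℕ} {X Y F : Type*}
  [TopologicalSpace X] [ChartedSpace (BaseSp n) X]
  [TopologicalSpace Y] [ChartedSpace (TotSp n N) Y]
  [TopologicalSpace F] [ChartedSpace (FibSp N) F]
  {B : SmoothFiberBundle n N X Y F}

/-! ### The action in coordinates -/

theorem AdaptedChart.isSmoothChart_base (e : AdaptedChart B) : IsSmoothChart e.base :=
  ⟨e.smooth_base, e.smooth_base_symm⟩

theorem form_apply_eq {e : AdaptedChart B} {m : Pontryagin B} (h : m ∈ e.pSource)
    (ξ : Fin (n + 1) → TangentSpace 𝓘(ℝ, TotSp n N) m.pt) :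
    m.form.1 ξ = (e.pFun m).2.2.1 fun i => e.dchart m.pt (ξ i) := by
  rw [AdaptedChart.pFun_of_mem h]
  change m.form.1 ξ = m.form.1 fun i => e.dchartSymm m.pt (e.dchart m.pt (ξ i))
  congr 1
  funext i
  exact (AdaptedChart.dchartSymm_dchart h (ξ i)).symm

theorem dchart_jet {e : AdaptedChart B} {m : Pontryagin B} (h : m ∈ e.pSource)
    (u : TangentSpace 𝓘(ℝ, BaseSp n) m.toBase) :
    e.dchart m.pt (m.jet.1 u) = (e.dbase m.toBase u, (e.pFun m).2.1 (e.dbase m.toBase u)) := by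
  rw [AdaptedChart.pFun_of_mem h]
  refine Prod.ext ?_ ?_
  · change (e.dchart m.pt (m.jet.1 u)).1 = e.dbase m.toBase u
    rw [AdaptedChart.fst_dchart h, m.jet.2 u]
    rfl
  · change (e.dchart m.pt (m.jet.1 u)).2 =
      (e.dchart m.pt (m.jet.1 (e.dbaseSymm (B.proj m.pt) (e.dbase (B.proj m.pt) u)))).2
    exact congrArg (fun z => (e.dchart m.pt (m.jet.1 z)).2)
      (AdaptedChart.dbaseSymm_dbase (e.proj_mem _ h) u).symm

variable [IsManifold 𝓘(ℝ, BaseSp n) ∞ X] [IsManifold 𝓘(ℝ, FibSp N) ∞ F]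

theorem AdaptedChart.localLagrangian_eq (e : AdaptedChart B) (η : DiffForm (BaseSp n) X (n + 1))
    (L : JetBundle B → ℝ) (j₀ : JetBundle B) {q : JetSp n N} (hq : q.1 ∈ e.chart.target) :
    e.localLagrangian η L q = L (jetInv e j₀ q) * coeffIn e.base η q.1.1 := by
  have h1 : jetInv e j₀ q =
      JetBundle.mk (e.chart.symm q.1) (e.jetOfCoord (e.chart.map_target hq) q.2) :=
    (jetCoords B).totalInv_of_mem e j₀ hq
  have hs := e.chart.map_target hq
  have h2 : e.base (B.proj (e.chart.symm q.1)) = q.1.1 := by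
    rw [← e.fst_chart _ hs, e.chart.right_inv hq]
  have h3 : e.base.symm q.1.1 = B.proj (e.chart.symm q.1) := by
    rw [← h2, e.base.left_inv (e.proj_mem _ hs)]
  rw [AdaptedChart.localLagrangian, dif_pos hq, ← h1]
  have h4 : coeffIn e.base η q.1.1 = formAt η (B.proj (e.chart.symm q.1))
      fun μ => e.dbaseSymm (B.proj (e.chart.symm q.1)) (baseVec μ) := by
    rw [← h3]
    change formAt η (e.base.symm q.1.1) (chartFrame e.base q.1.1) =
      formAt η (e.base.symm q.1.1) (chartFrame e.base (e.base (e.base.symm q.1.1)))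
    rw [h3, h2]
  rw [h4, h1]
  rfl

theorem AdaptedChart.contDiffOn_localLagrangian (e : AdaptedChart B)
    {η : DiffForm (BaseSp n) X (n + 1)} (hη : IsVolumeForm η) {L : JetBundle B → ℝ}
    (hL : ContMDiff 𝓘(ℝ, JetSp n N) 𝓘(ℝ, ℝ) ∞ L) (j₀ : JetBundle B) :
    ContDiffOn ℝ ∞ (e.localLagrangian η L) {q | q.1 ∈ e.chart.target} := by
  have h1 : ContDiffOn ℝ ∞ (fun q => L (jetInv e j₀ q)) {q | q.1 ∈ e.chart.target} := by
    rw [← contMDiffOn_iff_contDiffOn]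
    exact hL.comp_contMDiffOn (contMDiffOn_jetInv e j₀)
  have h2 : ContDiffOn ℝ ∞ (fun q : JetSp n N => coeffIn e.base η q.1.1)
      {q | q.1 ∈ e.chart.target} := by
    refine (contDiffOn_coeffIn hη.1 e.isSmoothChart_base).comp
      (contDiff_fst.comp contDiff_fst).contDiffOn ?_
    intro q hq
    have hq' : q.1 ∈ e.chart.target := hq
    have hs := e.chart.map_target hq'
    have h2 : e.base (B.proj (e.chart.symm q.1)) = q.1.1 := by
      rw [← e.fst_chart _ hs, e.chart.right_inv hq']
    change q.1.1 ∈ e.base.target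
    rw [← h2]
    exact e.base.map_source (e.proj_mem _ hs)
  exact (h1.mul h2).congr fun q hq => e.localLagrangian_eq η L j₀ hq

/-- The integrand `Θ_M - 𝓔` of the Hamilton-Pontryagin action. -/
def actionForm (η : DiffForm (BaseSp n) X (n + 1)) (L : JetBundle B → ℝ) :
    DiffForm (PontSp n N) (Pontryagin B) (n + 1) := fun m => thetaM B m - energyForm η L m

theorem thetaM_apply (m : Pontryagin B) (v : Fin (n + 1) → TangentSpace 𝓘(ℝ, PontSp n N) m) :
    thetaM B m v = m.form.1 fun i =>
      mfderiv 𝓘(ℝ, PontSp n N) 𝓘(ℝ, TotSp n N) Pontryagin.pt m (v i) := by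
  have h1 : HasMFDerivAt 𝓘(ℝ, PontSp n N) 𝓘(ℝ, DualSp n N) (Pontryagin.toDual (B := B)) m _ :=
    ((contMDiff_toDual (B := B)).mdifferentiableAt (by simp)).hasMFDerivAt
  have h2 : HasMFDerivAt 𝓘(ℝ, DualSp n N) 𝓘(ℝ, TotSp n N) (DualBundle.pt (B := B)) m.toDual _ :=
    ((contMDiff_dualPt (B := B)).mdifferentiableAt (by simp)).hasMFDerivAt
  have h3 : mfderiv 𝓘(ℝ, PontSp n N) 𝓘(ℝ, TotSp n N) (Pontryagin.pt (B := B)) m = _ :=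
    (h2.comp m h1).mfderiv
  rw [h3]
  rfl

theorem IsSmoothSection.mfderiv_toBase {ψ : X → Pontryagin B} (hψ : IsSmoothSection ψ) (x : X)
    (u : BaseSp n) :
    (mfderiv 𝓘(ℝ, PontSp n N) 𝓘(ℝ, BaseSp n) Pontryagin.toBase (ψ x)
      (mfderiv 𝓘(ℝ, BaseSp n) 𝓘(ℝ, PontSp n N) ψ x u) : BaseSp n) = u := by
  have h1 : HasMFDerivAt 𝓘(ℝ, BaseSp n) 𝓘(ℝ, PontSp n N) ψ x _ :=
    (hψ.1.mdifferentiableAt (by simp)).hasMFDerivAt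
  have h2 : HasMFDerivAt 𝓘(ℝ, PontSp n N) 𝓘(ℝ, BaseSp n) (Pontryagin.toBase (B := B)) (ψ x) _ :=
    ((contMDiff_toBase (B := B)).mdifferentiableAt (by simp)).hasMFDerivAt
  have h3 := h2.comp x h1
  have h4 : Pontryagin.toBase ∘ ψ = id := funext hψ.2
  rw [h4] at h3
  exact congrArg (fun T : BaseSp n →L[ℝ] BaseSp n => T u)
    (hasMFDerivAt_unique h3 (hasMFDerivAt_id x))

/-- The values of `ψ^*(Θ_M - 𝓔)`. -/
theorem pullback_actionForm_apply (η : DiffForm (BaseSp n) X (n + 1)) (L : JetBundle B → ℝ)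
    {ψ : X → Pontryagin B} (hψ : IsSmoothSection ψ) (x : X) (u : Fin (n + 1) → BaseSp n) :
    formAt (pullback ψ (actionForm η L)) x u =
      (ψ x).form.1 (fun i => mfderiv 𝓘(ℝ, PontSp n N) 𝓘(ℝ, TotSp n N) Pontryagin.pt (ψ x)
        (mfderiv 𝓘(ℝ, BaseSp n) 𝓘(ℝ, PontSp n N) ψ x (u i))) -
      (ψ x).form.1 (fun i => (ψ x).jet.1 (u i)) + L (ψ x).toJet * formAt η x u := by
  have h1 : formAt (pullback ψ (actionForm η L)) x u =
      thetaM B (ψ x) (fun i => mfderiv 𝓘(ℝ, BaseSp n) 𝓘(ℝ, PontSp n N) ψ x (u i)) -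
      energyForm η L (ψ x) (fun i => mfderiv 𝓘(ℝ, BaseSp n) 𝓘(ℝ, PontSp n N) ψ x (u i)) := rfl
  have h2 : energyForm η L (ψ x) (fun i => mfderiv 𝓘(ℝ, BaseSp n) 𝓘(ℝ, PontSp n N) ψ x (u i)) =
      energyDensity η L (ψ x) u := by
    change energyDensity η L (ψ x) (fun i => mfderiv 𝓘(ℝ, PontSp n N) 𝓘(ℝ, BaseSp n)
      Pontryagin.toBase (ψ x) (mfderiv 𝓘(ℝ, BaseSp n) 𝓘(ℝ, PontSp n N) ψ x (u i))) = _
    congr 1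
    funext i
    exact hψ.mfderiv_toBase x (u i)
  have h3 : energyDensity η L (ψ x) u = (ψ x).form.1 (fun i => (ψ x).jet.1 (u i)) -
      L (ψ x).toJet * formAt η (ψ x).toBase u := rfl
  rw [h1, h2, h3, thetaM_apply, hψ.2 x]
  ring

/-- The coordinate expression of a section, in the chart `c` of the base and the coordinates of
`M` induced by the adapted chart `e`. -/
def localSection (e : AdaptedChart B) (c : OpenPartialHomeomorph X (BaseSp n))
    (ψ : X → Pontryagin B) (a : BaseSp n) : PontSp n N := e.pFun (ψ (c.symm a))

/-- Smooth one-parameter families of sections of `π_{XM}`. -/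
structure IsSmoothFamily (Ψ : ℝ → X → Pontryagin B) : Prop where
  smooth : ContMDiff (𝓘(ℝ, ℝ).prod 𝓘(ℝ, BaseSp n)) 𝓘(ℝ, PontSp n N) ∞
    fun p : ℝ × X => Ψ p.1 p.2
  toBase : ∀ t x, (Ψ t x).toBase = x

theorem IsSmoothFamily.isSmoothSection {Ψ : ℝ → X → Pontryagin B} (hΨ : IsSmoothFamily Ψ)
    (t : ℝ) : IsSmoothSection (Ψ t) :=
  ⟨hΨ.smooth.comp (contMDiff_const.prodMk contMDiff_id), hΨ.toBase t⟩

variable {e : AdaptedChart B} {c : OpenPartialHomeomorph X (BaseSp n)}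

/-- The parameters and points at which a family of sections lies in the domain of a chart. -/
def familyDomain (e : AdaptedChart B) (c : OpenPartialHomeomorph X (BaseSp n))
    (Ψ : ℝ → X → Pontryagin B) : Set (ℝ × BaseSp n) :=
  {p | p.2 ∈ c.target ∧ Ψ p.1 (c.symm p.2) ∈ e.pSource}

theorem IsSmoothFamily.contMDiffOn_comp {Ψ : ℝ → X → Pontryagin B} (hΨ : IsSmoothFamily Ψ)
    (hc : IsSmoothChart c) :
    ContMDiffOn 𝓘(ℝ, ℝ × BaseSp n) 𝓘(ℝ, PontSp n N) ∞
      (fun p : ℝ × BaseSp n => Ψ p.1 (c.symm p.2)) {p | p.2 ∈ c.target} := by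
  have h1 : ContMDiffOn 𝓘(ℝ, ℝ × BaseSp n) 𝓘(ℝ, BaseSp n) ∞
      (fun p : ℝ × BaseSp n => c.symm p.2) {p | p.2 ∈ c.target} :=
    hc.smooth_symm.comp (contDiff_snd.contMDiff.contMDiffOn) fun p hp => hp
  have h2 : ContMDiffOn 𝓘(ℝ, ℝ × BaseSp n) 𝓘(ℝ, ℝ) ∞
      (fun p : ℝ × BaseSp n => p.1) {p | p.2 ∈ c.target} :=
    contDiff_fst.contMDiff.contMDiffOn
  exact hΨ.smooth.comp_contMDiffOn (h2.prodMk h1)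

theorem IsSmoothFamily.isOpen_familyDomain {Ψ : ℝ → X → Pontryagin B} (hΨ : IsSmoothFamily Ψ)
    (hc : IsSmoothChart c) : IsOpen (familyDomain e c Ψ) :=
  (hΨ.contMDiffOn_comp hc).continuousOn.isOpen_inter_preimage
    (c.open_target.preimage continuous_snd) e.isOpen_pSource

theorem IsSmoothFamily.contDiffOn_localSection {Ψ : ℝ → X → Pontryagin B} (hΨ : IsSmoothFamily Ψ)
    (hc : IsSmoothChart c) :
    ContDiffOn ℝ ∞ (fun p : ℝ × BaseSp n => localSection e c (Ψ p.1) p.2)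
      (familyDomain e c Ψ) := by
  rw [← contMDiffOn_iff_contDiffOn]
  exact e.contMDiffOn_pFun.comp ((hΨ.contMDiffOn_comp hc).mono fun p hp => hp.1) fun p hp => hp.2

theorem IsSmoothSection.isSmoothFamily_const {ψ : X → Pontryagin B} (hψ : IsSmoothSection ψ) :
    IsSmoothFamily fun _ : ℝ => ψ :=
  ⟨hψ.1.comp contMDiff_snd, fun _ => hψ.2⟩

/-- The points at which a section lies in the domain of a chart. -/
def sectionDomain (e : AdaptedChart B) (c : OpenPartialHomeomorph X (BaseSp n))
    (ψ : X → Pontryagin B) : Set (BaseSp n) := {a | a ∈ c.target ∧ ψ (c.symm a) ∈ e.pSource}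

theorem IsSmoothSection.isOpen_sectionDomain {ψ : X → Pontryagin B} (hψ : IsSmoothSection ψ)
    (hc : IsSmoothChart c) : IsOpen (sectionDomain e c ψ) :=
  (hψ.isSmoothFamily_const.isOpen_familyDomain hc).preimage (Continuous.prodMk_right (0 : ℝ))

theorem IsSmoothSection.contDiffOn_localSection {ψ : X → Pontryagin B} (hψ : IsSmoothSection ψ)
    (hc : IsSmoothChart c) :
    ContDiffOn ℝ ∞ (localSection e c ψ) (sectionDomain e c ψ) :=
  (hψ.isSmoothFamily_const.contDiffOn_localSection hc).comp
    (contDiff_const.prodMk contDiff_id).contDiffOn (f := fun a => ((0 : ℝ), a)) fun _ ha => ha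

theorem IsSmoothSection.contDiffAt_localSection {ψ : X → Pontryagin B} (hψ : IsSmoothSection ψ)
    (hc : IsSmoothChart c) {a : BaseSp n} (ha : a ∈ sectionDomain e c ψ) :
    ContDiffAt ℝ ∞ (localSection e c ψ) a :=
  (hψ.contDiffOn_localSection hc).contDiffAt ((hψ.isOpen_sectionDomain hc).mem_nhds ha)

theorem hasMFDerivAt_chart_symm (hc : IsSmoothChart c) {a : BaseSp n} (ha : a ∈ c.target) :
    HasMFDerivAt 𝓘(ℝ, BaseSp n) 𝓘(ℝ, BaseSp n) c.symm a
      (mfderiv 𝓘(ℝ, BaseSp n) 𝓘(ℝ, BaseSp n) c.symm a) :=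
  ((hc.smooth_symm.contMDiffAt (c.open_target.mem_nhds ha)).mdifferentiableAt
    (by simp)).hasMFDerivAt

/-- The derivative of the `Y`-component of a section in coordinates. -/
theorem dchart_mfderiv_section {ψ : X → Pontryagin B} (hψ : IsSmoothSection ψ)
    (hc : IsSmoothChart c) {a : BaseSp n} (ha : a ∈ sectionDomain e c ψ) (v : BaseSp n) :
    e.dchart (ψ (c.symm a)).pt (mfderiv 𝓘(ℝ, PontSp n N) 𝓘(ℝ, TotSp n N) Pontryagin.pt
      (ψ (c.symm a)) (mfderiv 𝓘(ℝ, BaseSp n) 𝓘(ℝ, PontSp n N) ψ (c.symm a)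
        (mfderiv 𝓘(ℝ, BaseSp n) 𝓘(ℝ, BaseSp n) c.symm a v))) =
      fderiv ℝ (fun b => (localSection e c ψ b).1) a v := by
  have h0 := hasMFDerivAt_chart_symm hc ha.1
  have h1 : HasMFDerivAt 𝓘(ℝ, BaseSp n) 𝓘(ℝ, PontSp n N) ψ (c.symm a) _ :=
    (hψ.1.mdifferentiableAt (by simp)).hasMFDerivAt
  have h2 : HasMFDerivAt 𝓘(ℝ, PontSp n N) 𝓘(ℝ, TotSp n N) (Pontryagin.pt (B := B))
      (ψ (c.symm a)) _ :=
    ((contMDiff_pt (B := B)).mdifferentiableAt (by simp)).hasMFDerivAt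
  have h3 : HasMFDerivAt 𝓘(ℝ, TotSp n N) 𝓘(ℝ, TotSp n N) e.chart (ψ (c.symm a)).pt
      (e.dchart (ψ (c.symm a)).pt) :=
    (e.mdiff_chart.mdifferentiableAt ha.2).hasMFDerivAt
  have h4 := ((h3.comp (ψ (c.symm a)) h2).comp (c.symm a) h1).comp a h0
  have h5 := h4.congr_of_eventuallyEq (f₁ := fun b => (localSection e c ψ b).1) (by
    filter_upwards [(hψ.isOpen_sectionDomain hc).mem_nhds ha] with b hb
    exact AdaptedChart.pFun_fst hb.2)
  rw [← mfderiv_eq_fderiv, h5.mfderiv]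
  rfl

theorem dbase_chartFrame {ψ : X → Pontryagin B} (hψ : IsSmoothSection ψ)
    (hc : IsSmoothChart c) {a : BaseSp n} (ha : a ∈ sectionDomain e c ψ) (v : BaseSp n) :
    e.dbase (ψ (c.symm a)).toBase
        (mfderiv 𝓘(ℝ, BaseSp n) 𝓘(ℝ, BaseSp n) c.symm a v) =
      (fderiv ℝ (fun b => (localSection e c ψ b).1) a v).1 := by
  rw [← dchart_mfderiv_section hψ hc ha v, AdaptedChart.fst_dchart ha.2]
  have h1 : HasMFDerivAt 𝓘(ℝ, PontSp n N) 𝓘(ℝ, TotSp n N) (Pontryagin.pt (B := B))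
      (ψ (c.symm a)) _ :=
    ((contMDiff_pt (B := B)).mdifferentiableAt (by simp)).hasMFDerivAt
  have h2 : HasMFDerivAt 𝓘(ℝ, TotSp n N) 𝓘(ℝ, BaseSp n) B.proj (ψ (c.symm a)).pt
      (B.dproj (ψ (c.symm a)).pt) :=
    (B.contMDiff_proj.mdifferentiableAt (by simp)).hasMFDerivAt
  have h3 : mfderiv 𝓘(ℝ, PontSp n N) 𝓘(ℝ, BaseSp n) (Pontryagin.toBase (B := B))
    (ψ (c.symm a)) = _ := (h2.comp _ h1).mfderiv
  have h4 := hψ.mfderiv_toBase (c.symm a) (mfderiv 𝓘(ℝ, BaseSp n) 𝓘(ℝ, BaseSp n) c.symm a v)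
  rw [h3] at h4
  exact congrArg (e.dbase (ψ (c.symm a)).toBase) h4.symm

/-- The coefficient of `ψ^*(Θ_M - 𝓔)` in an arbitrary chart of the base, in terms of the
coordinates of `ψ` induced by an adapted chart. -/
theorem coeffIn_pullback_actionForm (η : DiffForm (BaseSp n) X (n + 1)) (L : JetBundle B → ℝ)
    {ψ : X → Pontryagin B} (hψ : IsSmoothSection ψ) (hc : IsSmoothChart c) {a : BaseSp n}
    (ha : a ∈ sectionDomain e c ψ) :
    coeffIn c (pullback ψ (actionForm η L)) a =
      (localSection e c ψ a).2.2.1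
        (fun i => fderiv ℝ (fun b => (localSection e c ψ b).1) a (baseVec i)) -
      (localSection e c ψ a).2.2.1
        (fun i => ((fderiv ℝ (fun b => (localSection e c ψ b).1) a (baseVec i)).1,
          (localSection e c ψ a).2.1
            (fderiv ℝ (fun b => (localSection e c ψ b).1) a (baseVec i)).1)) +
      L (ψ (c.symm a)).toJet * coeffIn c η a := by
  have h := pullback_actionForm_apply η L hψ (c.symm a) (chartFrame c a)
  rw [form_apply_eq ha.2, form_apply_eq ha.2] at h
  refine h.trans ?_
  refine congrArg₂ (· + ·) (congrArg₂ (· - ·) ?_ ?_) rfl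
  · congr 1
    funext i
    exact dchart_mfderiv_section hψ hc ha (baseVec i)
  · congr 1
    funext i
    have := dbase_chartFrame hψ hc ha (baseVec i)
    refine (dchart_jet ha.2 (chartFrame c a i)).trans ?_
    exact Prod.ext this (congrArg (localSection e c ψ a).2.1 this)

theorem localSection_base {ψ : X → Pontryagin B} (hψ : IsSmoothSection ψ) {a : BaseSp n}
    (ha : a ∈ sectionDomain e e.base ψ) : (localSection e e.base ψ a).1.1 = a := by
  rw [localSection, AdaptedChart.pFun_fst_fst ha.2, hψ.2, e.base.right_inv ha.1]

theorem fderiv_localSection_fst {ψ : X → Pontryagin B} (hψ : IsSmoothSection ψ) {a : BaseSp n}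
    (ha : a ∈ sectionDomain e e.base ψ) (v : BaseSp n) :
    fderiv ℝ (fun b => (localSection e e.base ψ b).1) a v =
      (v, fderiv ℝ (fun b => (localSection e e.base ψ b).1.2) a v) := by
  have h1 := (hψ.contDiffAt_localSection e.isSmoothChart_base ha).fst.differentiableAt (by simp)
  have h2 : HasFDerivAt (fun b => (localSection e e.base ψ b).1)
    (fderiv ℝ (fun b => (localSection e e.base ψ b).1) a) a := h1.hasFDerivAt
  refine Prod.ext ?_ ?_
  · have h3 : HasFDerivAt (fun b => (localSection e e.base ψ b).1.1) _ a := h2.fst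
    have h4 := (hasFDerivAt_id (𝕜 := ℝ) a).congr_of_eventuallyEq
      (f₁ := fun b => (localSection e e.base ψ b).1.1) (by
      filter_upwards [(hψ.isOpen_sectionDomain e.isSmoothChart_base).mem_nhds ha] with b hb
      exact localSection_base hψ hb)
    exact congrArg (fun T : BaseSp n →L[ℝ] BaseSp n => T v) (h3.unique h4)
  · have h3 : HasFDerivAt (fun b => (localSection e e.base ψ b).1.2) _ a := h2.snd
    exact (congrArg (fun T : BaseSp n →L[ℝ] FibSp N => T v) h3.fderiv).symm

theorem localLagrangian_section (η : DiffForm (BaseSp n) X (n + 1)) (L : JetBundle B → ℝ)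
    {ψ : X → Pontryagin B} (hψ : IsSmoothSection ψ) {a : BaseSp n}
    (ha : a ∈ sectionDomain e e.base ψ) :
    e.localLagrangian η L ((localSection e e.base ψ a).1, (localSection e e.base ψ a).2.1) =
      L (ψ (e.base.symm a)).toJet * coeffIn e.base η a := by
  rw [e.localLagrangian_eq η L (ψ (e.base.symm a)).toJet
    (q := ((localSection e e.base ψ a).1, (localSection e e.base ψ a).2.1))
    (AdaptedChart.pFun_mem ha.2)]
  change L (jetInv e _ _) * coeffIn e.base η (localSection e e.base ψ a).1.1 = _
  rw [localSection_base hψ ha, localSection, ← totalFun_toJet ha.2]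
  congr 2
  exact (jetCoords B).totalInv_totalFun e _ (m := (ψ (e.base.symm a)).toJet) ha.2

/-- In bundle coordinates the integrand of the action is the density
`p_A^μ (∂_μ y^A - v^A_μ) + L`. -/
theorem coeffIn_pullback_actionForm_base (η : DiffForm (BaseSp n) X (n + 1))
    (L : JetBundle B → ℝ) {ψ : X → Pontryagin B} (hψ : IsSmoothSection ψ) {a : BaseSp n}
    (ha : a ∈ sectionDomain e e.base ψ) :
    coeffIn e.base (pullback ψ (actionForm η L)) a =
      density (e.localLagrangian η L) (localSection e e.base ψ) a := by
  rw [coeffIn_pullback_actionForm η L hψ e.isSmoothChart_base ha]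
  simp only [fderiv_localSection_fst hψ ha]
  rw [dualModel_apply_graph, dualModel_apply_graph, density, localLagrangian_section η L hψ ha]
  simp only [map_sub, Finset.sum_sub_distrib]
  ring

/-- The value of an element of the model fibre on a tuple, as a multilinear map with values in
linear functionals. -/
def dualApply (n N : ℕ) :
    ContinuousMultilinearMap ℝ (fun _ : Fin (n + 1) => TotSp n N) (DualModel n N →L[ℝ] ℝ) :=
  ContinuousLinearMap.flipMultilinear
    ((ContinuousAlternatingMap.toContinuousMultilinearMapCLM (R := ℝ) (ι := Fin (n + 1))
      (E := TotSp n N) (F := ℝ) (𝕜 := ℝ)).comp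
      (show DualModel n N →L[ℝ] TotSp n N [⋀^Fin (n + 1)]→L[ℝ] ℝ from
        (dualSubmodule n N).subtypeL))

/-- The integrands of the actions along a smooth family of sections form a smooth family. -/
theorem IsSmoothFamily.isSmoothFormFamily {Ψ : ℝ → X → Pontryagin B} (hΨ : IsSmoothFamily Ψ)
    {η : DiffForm (BaseSp n) X (n + 1)} (hη : IsVolumeForm η) {L : JetBundle B → ℝ}
    (hL : ContMDiff 𝓘(ℝ, JetSp n N) 𝓘(ℝ, ℝ) ∞ L) :
    IsSmoothFormFamily fun t => pullback (Ψ t) (actionForm η L) := by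
  rintro i ⟨t, a⟩ ⟨-, ha⟩
  set c := chartAt (BaseSp n) i with hcd
  have hc : IsSmoothChart c := isSmoothChart_chartAt i
  have ha' : a ∈ c.target := ha
  -- the coefficient is smooth near `(t, a)` by its formula in an adapted chart around `Ψ t (c⁻¹ a)`,
  -- which is used together with the given chart `c` of the base
  obtain ⟨e, he⟩ := B.exists_adaptedChart (Ψ t (c.symm a)).pt
  have hmem : (t, a) ∈ familyDomain e c Ψ := ⟨ha', he⟩
  have hO := (hΨ.isOpen_familyDomain hc (e := e)).mem_nhds hmem
  set q : ℝ × BaseSp n → PontSp n N := fun p => localSection e c (Ψ p.1) p.2 with hqd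
  have hq : ContDiffAt ℝ ∞ q (t, a) := (hΨ.contDiffOn_localSection hc).contDiffAt hO
  have hdq : ∀ i, ContDiffAt ℝ ∞ (fun p => (fderiv ℝ q p (0, baseVec i)).1) (t, a) := fun i =>
    ((hq.fderiv_right (m := ∞) (by simp)).clm_apply contDiffAt_const).fst
  have hw : ContDiffAt ℝ ∞ (fun p => (q p).2.2) (t, a) := hq.snd.snd
  have hv : ContDiffAt ℝ ∞ (fun p => (q p).2.1) (t, a) := hq.snd.fst
  have h1 : ContDiffAt ℝ ∞ (fun p => (q p).2.2.1
      fun i => (fderiv ℝ q p (0, baseVec i)).1) (t, a) :=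
    ((dualApply n N).contDiff.contDiffAt.comp (t, a) (contDiffAt_pi.2 hdq)).clm_apply hw
  have h2 : ContDiffAt ℝ ∞ (fun p => (q p).2.2.1 fun i =>
      ((fderiv ℝ q p (0, baseVec i)).1.1, (q p).2.1 (fderiv ℝ q p (0, baseVec i)).1.1)) (t, a) :=
    ((dualApply n N).contDiff.contDiffAt.comp (t, a) (contDiffAt_pi.2 fun i =>
      (hdq i).fst.prodMk (hv.clm_apply (hdq i).fst))).clm_apply hw
  have h3 : ContDiffAt ℝ ∞ (fun p : ℝ × BaseSp n => L (Ψ p.1 (c.symm p.2)).toJet) (t, a) := by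
    have h4 : ContDiffOn ℝ ∞ (fun p : ℝ × BaseSp n => L (Ψ p.1 (c.symm p.2)).toJet)
        {p | p.2 ∈ c.target} := by
      rw [← contMDiffOn_iff_contDiffOn]
      exact (hL.comp contMDiff_toJet).comp_contMDiffOn (hΨ.contMDiffOn_comp hc)
    exact h4.contDiffAt ((c.open_target.preimage continuous_snd).mem_nhds ha')
  have h5 : ContDiffAt ℝ ∞ (fun p : ℝ × BaseSp n => coeffIn c η p.2) (t, a) :=
    ((contDiffOn_coeffIn hη.1 hc).contDiffAt (c.open_target.mem_nhds ha')).comp (t, a)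
      contDiffAt_snd
  have htot := (h1.sub h2).add (h3.mul h5)
  refine ContDiffAt.contDiffWithinAt (htot.congr_of_eventuallyEq ?_)
  have hd : ∀ᶠ p in 𝓝 (t, a), DifferentiableAt ℝ q p := by
    have := (hq.of_le (m := 1) (by simp)).eventually (by simp)
    filter_upwards [this] with p hp
    exact hp.differentiableAt (by simp)
  filter_upwards [hO, hd] with p hp hdp
  have hder : ∀ v, fderiv ℝ (fun b => (localSection e c (Ψ p.1) b).1) p.2 v =
      (fderiv ℝ q p (0, v)).1 := by
    intro v
    have h6 : HasFDerivAt (fun b => q (p.1, b))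
        ((fderiv ℝ q p).comp (ContinuousLinearMap.inr ℝ ℝ (BaseSp n))) p.2 :=
      HasFDerivAt.comp (g := q) (f := fun b => (p.1, b)) p.2 hdp.hasFDerivAt
        (hasFDerivAt_prodMk_right p.1 p.2)
    have h7 : HasFDerivAt (fun b => (localSection e c (Ψ p.1) b).1) _ p.2 := h6.fst
    rw [h7.fderiv]; simp
  have h8 := coeffIn_pullback_actionForm η L (hΨ.isSmoothSection p.1) hc (e := e) (a := p.2) hp
  simp only [hder] at h8
  exact h8

/-- The first variation of the integrand of the action along a family of sections, as a form on
the base. -/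
def firstVariation (η : DiffForm (BaseSp n) X (n + 1)) (L : JetBundle B → ℝ)
    (Ψ : ℝ → X → Pontryagin B) : DiffForm (BaseSp n) X (n + 1) :=
  derivForm fun t => pullback (Ψ t) (actionForm η L)

/-- The variation of a family of sections in coordinates. -/
def localVariation (e : AdaptedChart B) (Ψ : ℝ → X → Pontryagin B) (a : BaseSp n) : PontSp n N :=
  deriv (fun t => localSection e e.base (Ψ t) a) 0

/-- The first variation in bundle coordinates. -/
theorem coeffIn_firstVariation {η : DiffForm (BaseSp n) X (n + 1)} (hη : IsVolumeForm η)
    {L : JetBundle B → ℝ} (hL : ContMDiff 𝓘(ℝ, JetSp n N) 𝓘(ℝ, ℝ) ∞ L)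
    {Ψ : ℝ → X → Pontryagin B} (hΨ : IsSmoothFamily Ψ) {a : BaseSp n}
    (ha : a ∈ sectionDomain e e.base (Ψ 0)) :
    coeffIn e.base (firstVariation η L Ψ) a =
      eulerLagrange (e.localLagrangian η L) (localSection e e.base (Ψ 0)) a
        (localVariation e Ψ a) +
      ∑ μ, fderiv ℝ (fun b => mom μ (localSection e e.base (Ψ 0) b).2.2
        (localVariation e Ψ b).1.2) a (baseVec μ) := by
  have hc := e.isSmoothChart_base
  have hmem : ((0 : ℝ), a) ∈ familyDomain e e.base Ψ := ha
  have hO := (hΨ.isOpen_familyDomain hc (e := e)).mem_nhds hmem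
  have hq := (hΨ.contDiffOn_localSection hc (e := e)).contDiffAt hO
  have hℓ : DifferentiableAt ℝ (e.localLagrangian η L)
      ((localSection e e.base (Ψ 0) a).1, (localSection e e.base (Ψ 0) a).2.1) := by
    refine ((e.contDiffOn_localLagrangian hη hL (Ψ 0 (e.base.symm a)).toJet).contDiffAt
      ((e.chart.open_target.preimage continuous_fst).mem_nhds ?_)).differentiableAt (by simp)
    exact AdaptedChart.pFun_mem ha.2
  have h1 := hasDerivAt_density hq hℓ
  rw [firstVariation, coeffIn_derivForm]
  have h2 : (fun t => coeffIn e.base (pullback (Ψ t) (actionForm η L)) a) =ᶠ[𝓝 0]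
      fun t => density (e.localLagrangian η L) (fun b => localSection e e.base (Ψ t) b) a := by
    have h3 : Filter.Tendsto (fun t : ℝ => (t, a)) (𝓝 0) (𝓝 ((0 : ℝ), a)) :=
      (Continuous.prodMk_left a).tendsto 0
    filter_upwards [h3 hO] with t ht
    exact coeffIn_pullback_actionForm_base η L (hΨ.isSmoothSection t) ht
  rw [h2.deriv_eq]
  exact h1.deriv

end

section

variable {n N : ℕ} {X Y F : Type*}
  [TopologicalSpace X] [ChartedSpace (BaseSp n) X]
  [TopologicalSpace Y] [ChartedSpace (TotSp n N) Y]
  [TopologicalSpace F] [ChartedSpace (FibSp N) F]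
  {B : SmoothFiberBundle n N X Y F}
  [IsManifold 𝓘(ℝ, BaseSp n) ∞ X] [IsManifold 𝓘(ℝ, FibSp N) ∞ F]
  [T2Space X] [SigmaCompactSpace X]
  {η : DiffForm (BaseSp n) X (n + 1)} {L : JetBundle B → ℝ}

/-! ### The first variation of the action -/

/-- The Euler-Lagrange expression of `ψ` vanishes in all bundle coordinates. -/
def EulerLagrangeVanishes (η : DiffForm (BaseSp n) X (n + 1)) (L : JetBundle B → ℝ)
    (ψ : X → Pontryagin B) : Prop :=
  ∀ (e : AdaptedChart B) (x : X), ψ x ∈ e.pSource → ∀ δ : PontSp n N, δ.1.1 = 0 →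
    eulerLagrange (e.localLagrangian η L) (localSection e e.base ψ) (e.base x) δ = 0

theorem formAt_pullback_congr (α : DiffForm (PontSp n N) (Pontryagin B) (n + 1))
    {f g : X → Pontryagin B} {x : X} (h : f =ᶠ[𝓝 x] g) :
    formAt (pullback f α) x = formAt (pullback g α) x := by
  apply ContinuousAlternatingMap.ext
  intro u
  have key : ∀ (m m' : Pontryagin B) (T T' : BaseSp n →L[ℝ] PontSp n N), m = m' → T = T' →
      (α m : PontSp n N [⋀^Fin (n + 1)]→L[ℝ] ℝ) (fun i => T (u i)) =
      (α m' : PontSp n N [⋀^Fin (n + 1)]→L[ℝ] ℝ) (fun i => T' (u i)) := by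
    rintro m _ T _ rfl rfl; rfl
  exact key _ _ (mfderiv 𝓘(ℝ, BaseSp n) 𝓘(ℝ, PontSp n N) f x)
    (mfderiv 𝓘(ℝ, BaseSp n) 𝓘(ℝ, PontSp n N) g x) h.self_of_nhds h.mfderiv_eq

theorem formAt_firstVariation_eq_zero {Ψ : ℝ → X → Pontryagin B} {C : Set X} (hC : IsClosed C)
    (hfix : ∀ x ∉ C, ∀ t, Ψ t x = Ψ 0 x) {x : X} (hx : x ∉ C) :
    formAt (firstVariation η L Ψ) x = 0 := by
  have h1 : (fun t => formAt (pullback (Ψ t) (actionForm η L)) x baseVec) =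
      fun _ => formAt (pullback (Ψ 0) (actionForm η L)) x baseVec := by
    funext t
    rw [formAt_pullback_congr]
    filter_upwards [hC.isOpen_compl.mem_nhds hx] with x' hx'
    exact hfix x' hx' t
  have h2 : formAt (firstVariation η L Ψ) x =
      deriv (fun t => formAt (pullback (Ψ t) (actionForm η L)) x baseVec) 0 • vol n := rfl
  rw [h2, h1, deriv_const, zero_smul]

theorem contDiffAt_localVariation {Ψ : ℝ → X → Pontryagin B} (hΨ : IsSmoothFamily Ψ)
    {e : AdaptedChart B} {a : BaseSp n} (ha : a ∈ sectionDomain e e.base (Ψ 0)) :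
    ContDiffAt ℝ ∞ (localVariation e Ψ) a := by
  have hmem : ((0 : ℝ), a) ∈ familyDomain e e.base Ψ := ha
  exact contDiffAt_deriv_slice ((hΨ.contDiffOn_localSection e.isSmoothChart_base).contDiffAt
    ((hΨ.isOpen_familyDomain e.isSmoothChart_base).mem_nhds hmem))

theorem contDiffAt_momentum_variation {Ψ : ℝ → X → Pontryagin B} (hΨ : IsSmoothFamily Ψ)
    {e : AdaptedChart B} {a : BaseSp n} (ha : a ∈ sectionDomain e e.base (Ψ 0))
    (μ : Fin (n + 1)) :
    ContDiffAt ℝ ∞ (fun b => mom μ (localSection e e.base (Ψ 0) b).2.2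
        (localVariation e Ψ b).1.2) a :=
  ((mom μ).contDiff.contDiffAt.comp a
    ((hΨ.isSmoothSection 0).contDiffAt_localSection e.isSmoothChart_base ha).snd.snd).clm_apply
    (contDiffAt_localVariation hΨ ha).fst.snd

/-- Base coordinates are not varied. -/
theorem localVariation_fst_fst {Ψ : ℝ → X → Pontryagin B} (hΨ : IsSmoothFamily Ψ)
    {e : AdaptedChart B} {a : BaseSp n} (ha : a ∈ sectionDomain e e.base (Ψ 0)) :
    (localVariation e Ψ a).1.1 = 0 := by
  have hmem : ((0 : ℝ), a) ∈ familyDomain e e.base Ψ := ha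
  have hO := (hΨ.isOpen_familyDomain e.isSmoothChart_base (e := e)).mem_nhds hmem
  have h1 := (eventually_deriv_slice_eq ((hΨ.contDiffOn_localSection
    e.isSmoothChart_base (e := e)).contDiffAt hO)).self_of_nhds.2
  have h2 : HasDerivAt (fun t => localSection e e.base (Ψ t) a) (localVariation e Ψ a) 0 := by
    rw [localVariation, h1.deriv]; exact h1
  have h3 : HasDerivAt (fun t => (localSection e e.base (Ψ t) a).1) (localVariation e Ψ a).1 0 :=
    h2.fst
  have h4 : HasDerivAt (fun t => (localSection e e.base (Ψ t) a).1.1)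
    (localVariation e Ψ a).1.1 0 := h3.fst
  have h5 : (fun t => (localSection e e.base (Ψ t) a).1.1) =ᶠ[𝓝 0] fun _ => a := by
    have h6 : Filter.Tendsto (fun t : ℝ => (t, a)) (𝓝 0) (𝓝 ((0 : ℝ), a)) :=
      (Continuous.prodMk_left a).tendsto 0
    filter_upwards [h6 hO] with t ht
    exact localSection_base (hΨ.isSmoothSection t) ht
  exact h4.unique ((hasDerivAt_const (0 : ℝ) a).congr_of_eventuallyEq h5)

/-- For a variation supported in the domain of an adapted chart, the divergence term of the first
variation integrates to zero, and only the Euler-Lagrange expression remains. -/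
theorem integralOn_firstVariation (hη : IsVolumeForm η)
    (hL : ContMDiff 𝓘(ℝ, JetSp n N) 𝓘(ℝ, ℝ) ∞ L) {Ψ : ℝ → X → Pontryagin B}
    (hΨ : IsSmoothFamily Ψ) (e : AdaptedChart B) {U : Set X} (hUo : IsOpen U) {C : Set X}
    (hC : IsCompact C) (hCU : C ⊆ U) (hCe : ∀ x ∈ C, Ψ 0 x ∈ e.pSource)
    (hfix : ∀ x ∉ C, ∀ t, Ψ t x = Ψ 0 x) :
    MeasureTheory.IntegrableOn (fun a => Real.sign (coeffIn e.base η a) *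
        eulerLagrange (e.localLagrangian η L) (localSection e e.base (Ψ 0)) a
          (localVariation e Ψ a)) (sectionDomain e e.base (Ψ 0)) ∧
    integralOn η U (firstVariation η L Ψ) = ∫ a in sectionDomain e e.base (Ψ 0),
      Real.sign (coeffIn e.base η a) *
        eulerLagrange (e.localLagrangian η L) (localSection e e.base (Ψ 0)) a
          (localVariation e Ψ a) := by
  have hc := e.isSmoothChart_base
  set D := sectionDomain e e.base (Ψ 0) with hDdef
  have hDo : IsOpen D := (hΨ.isSmoothSection 0).isOpen_sectionDomain hc
  have hCs : C ⊆ e.base.source := fun x hx => by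
    have := AdaptedChart.toBase_mem (hCe x hx)
    rwa [hΨ.toBase] at this
  have hzero : ∀ x ∉ C, formAt (firstVariation η L Ψ) x = 0 := fun x hx =>
    formAt_firstVariation_eq_zero hC.isClosed hfix hx
  have hcoef : ∀ a, e.base.symm a ∉ C → coeffIn e.base (firstVariation η L Ψ) a = 0 := by
    intro a ha
    rw [coeffIn, hzero _ ha]; rfl
  have hcont : IsContForm (firstVariation η L Ψ) :=
    (hΨ.isSmoothFormFamily hη hL).isContForm_derivForm
  set k := e.base '' C with hk
  have hkc : IsCompact k := hC.image_of_continuousOn (e.base.continuousOn.mono hCs)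
  have hkD : k ⊆ D := by
    rintro _ ⟨x, hx, rfl⟩
    refine ⟨e.base.map_source (hCs hx), ?_⟩
    rw [e.base.left_inv (hCs hx)]; exact hCe x hx
  have hoff : ∀ a ∈ e.base.target, a ∉ k → e.base.symm a ∉ C := fun a ha ha' hx =>
    ha' ⟨_, hx, e.base.right_inv ha⟩
  have hDt : D ⊆ e.base.target := fun a ha => ha.1
  set s := fun a => Real.sign (coeffIn e.base η a) with hs
  have h1 : integralOn η U (firstVariation η L Ψ) =
      ∫ a in D, s a * coeffIn e.base (firstVariation η L Ψ) a := by
    rw [integralOn_eq_of_support hη hc hcont hUo hC hCU hCs hzero]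
    refine MeasureTheory.setIntegral_eq_of_subset_of_forall_sdiff_eq_zero
      e.base.open_target.measurableSet hDt ?_
    rintro a ⟨ha, ha'⟩
    rw [hcoef a (hoff a ha fun h => ha' (hkD h)), mul_zero]
  have hint : MeasureTheory.IntegrableOn
      (fun a => s a * coeffIn e.base (firstVariation η L Ψ) a) D := by
    have h2 : ContinuousOn (fun a => s a * coeffIn e.base (firstVariation η L Ψ) a)
      e.base.target := (hη.continuousOn_sign hc).mul (hcont.continuousOn hc)
    refine ((h2.mono (hkD.trans hDt)).integrableOn_compact hkc).of_forall_sdiff_eq_zero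
      hDo.measurableSet ?_
    rintro a ⟨ha, ha'⟩
    rw [hcoef a (hoff a ha.1 ha'), mul_zero]
  set g : Fin (n + 1) → BaseSp n → ℝ := fun μ b => mom μ (localSection e e.base (Ψ 0) b).2.2
        (localVariation e Ψ b).1.2 with hg
  have hdiv : ∀ μ, MeasureTheory.IntegrableOn (fun a => s a * fderiv ℝ (g μ) a (baseVec μ)) D ∧
      ∫ a in D, s a * fderiv ℝ (g μ) a (baseVec μ) = 0 := by
    intro μ
    refine setIntegral_sign_mul_fderiv_eq_zero MeasureTheory.volume hDo hkc hkD
      ((contDiffOn_coeffIn hη.1 hc).continuousOn.mono hDt)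
      (fun a ha => coeffIn_ne_zero hη hc ha.1)
      (fun a ha => (contDiffAt_momentum_variation hΨ ha μ).contDiffWithinAt) ?_ _
    intro a ha ha'
    have h3 : localVariation e Ψ a = 0 := by
      have : (fun t => localSection e e.base (Ψ t) a) =
          fun _ => localSection e e.base (Ψ 0) a := by
        funext t
        rw [localSection, hfix _ (hoff a ha.1 ha') t, localSection]
      rw [localVariation, this, deriv_const]
    simp [h3]
  -- pointwise, the first variation minus the divergence is the Euler-Lagrange expression
  have hEL : ∀ a ∈ D, s a * coeffIn e.base (firstVariation η L Ψ) a -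
      ∑ μ, s a * fderiv ℝ (g μ) a (baseVec μ) = s a *
        eulerLagrange (e.localLagrangian η L) (localSection e e.base (Ψ 0)) a
          (localVariation e Ψ a) := by
    intro a ha
    rw [coeffIn_firstVariation hη hL hΨ ha, mul_add, Finset.mul_sum]
    ring
  have hsum : MeasureTheory.IntegrableOn
      (fun a => ∑ μ, s a * fderiv ℝ (g μ) a (baseVec μ)) D :=
    MeasureTheory.integrable_finsetSum _ fun μ _ => (hdiv μ).1
  refine ⟨(hint.sub hsum).congr_fun hEL hDo.measurableSet, ?_⟩
  rw [h1, ← MeasureTheory.setIntegral_congr_fun hDo.measurableSet hEL,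
    MeasureTheory.integral_sub hint hsum, MeasureTheory.integral_finsetSum _ fun μ _ => (hdiv μ).1]
  simp [hdiv]

/-- The first variation of the action along an arbitrary smooth family of sections. -/
theorem hasDerivAt_action (hη : IsVolumeForm η) (hL : ContMDiff 𝓘(ℝ, JetSp n N) 𝓘(ℝ, ℝ) ∞ L)
    {Ψ : ℝ → X → Pontryagin B} (hΨ : IsSmoothFamily Ψ) {U : Set X} (hUo : IsOpen U)
    (hU : IsCompact (closure U)) :
    HasDerivAt (fun t => action η L U (Ψ t)) (integralOn η U (firstVariation η L Ψ)) 0 :=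
  hasDerivAt_integralOn hη (hΨ.isSmoothFormFamily hη hL) hUo hU

theorem VerticalVariation.isSmoothFamily {U : Set X} (V : VerticalVariation B U)
    {ψ : X → Pontryagin B} (hψ : IsSmoothSection ψ) {τ : ℝ → X → ℝ}
    (hτ : ContMDiff (𝓘(ℝ, ℝ).prod 𝓘(ℝ, BaseSp n)) 𝓘(ℝ, ℝ) ∞ fun p : ℝ × X => τ p.1 p.2) :
    IsSmoothFamily fun t x => V.diffeo (τ t x) (ψ x) :=
  ⟨V.smooth.comp (hτ.prodMk (hψ.1.comp contMDiff_snd)), fun t x => by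
    rw [V.vertical, hψ.2]⟩

/-- If the Euler-Lagrange expressions vanish, then so does the first variation of the action: the
variation is cut into pieces supported in adapted charts by reparametrizing time with a partition
of unity of the base. -/
theorem isCriticalPoint_of_eulerLagrangeVanishes (hη : IsVolumeForm η)
    (hL : ContMDiff 𝓘(ℝ, JetSp n N) 𝓘(ℝ, ℝ) ∞ L) {ψ : X → Pontryagin B}
    (hψ : IsSmoothSection ψ) (hEL : EulerLagrangeVanishes η L ψ) : IsCriticalPoint η L ψ := by
  intro U hUo hU V
  have hid : IsSmoothFamily fun t x => V.diffeo t (ψ x) := V.isSmoothFamily hψ contMDiff_fst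
  refine (hasDerivAt_action hη hL hid hUo hU).congr_deriv ?_
  obtain ⟨K, hK, hKU, hKfix⟩ := V.support
  set C : Set X := Pontryagin.toBase '' K with hCdef
  have hC : IsCompact C := hK.image (contMDiff_toBase (B := B)).continuous
  have hCU : C ⊆ U := by rintro _ ⟨m, hm, rfl⟩; exact hKU m hm
  have hfix : ∀ x ∉ C, ∀ t, V.diffeo t (ψ x) = ψ x := fun x hx t =>
    hKfix t _ fun h => hx ⟨_, h, hψ.2 x⟩
  -- a partition of unity of `X` subordinate to the preimages under `ψ` of adapted chart domains
  set ch : X → AdaptedChart B := fun x => prefChart B (ψ x).pt with hch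
  obtain ⟨σ, hσ⟩ := SmoothPartitionOfUnity.exists_isSubordinate 𝓘(ℝ, BaseSp n)
    (isClosed_univ (X := X)) (fun x => ψ ⁻¹' (ch x).pSource)
    (fun x => (ch x).isOpen_pSource.preimage hψ.1.continuous)
    (fun x _ => mem_iUnion.2 ⟨x, mem_prefChart_source (ψ x).pt⟩)
  have hJ := σ.locallyFinite.finite_nonempty_inter_compact hU
  set J := hJ.toFinset with hJdef
  have hsum : ∀ x ∈ U, ∑ k ∈ J, σ k x = 1 := by
    intro x hx
    have h1 := σ.sum_eq_one (mem_univ x)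
    rwa [finsum_eq_sum_of_support_subset (s := J)] at h1
    intro k hk
    exact hJ.mem_toFinset.2 ⟨x, hk, subset_closure hx⟩
  -- by the chain rule the reparametrized family `Ψ k` has the variation of the original one
  -- multiplied by `σ k`
  set Ψ : X → ℝ → X → Pontryagin B := fun k t x => V.diffeo (σ k x * t) (ψ x) with hΨdef
  have hΨ : ∀ k, IsSmoothFamily (Ψ k) := fun k => by
    refine V.isSmoothFamily hψ (τ := fun t x => σ k x * t) ?_
    exact ((σ k).contMDiff.comp contMDiff_snd).mul contMDiff_fst
  have hΨ0 : ∀ k, Ψ k 0 = ψ := by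
    intro k; funext x; simp only [hΨdef, mul_zero, V.zero]
  have hid0 : (fun x => V.diffeo 0 (ψ x)) = ψ := by funext x; exact V.zero _
  -- each piece has vanishing first variation
  have hpiece : ∀ k, integralOn η U (firstVariation η L (Ψ k)) = 0 := by
    intro k
    have hCk : IsCompact (C ∩ tsupport (σ k)) := hC.inter_right (isClosed_tsupport _)
    have h1 := integralOn_firstVariation hη hL (hΨ k) (ch k) hUo hCk
      (inter_subset_left.trans hCU) (fun x hx => by rw [hΨ0]; exact hσ k hx.2) ?_
    · rw [h1.2, hΨ0]
      rw [MeasureTheory.setIntegral_congr_fun (g := fun _ => 0)]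
      · simp
      · exact (hψ.isOpen_sectionDomain (ch k).isSmoothChart_base).measurableSet
      · intro a ha
        have h2 := hEL (ch k) ((ch k).base.symm a) ha.2 (localVariation (ch k) (Ψ k) a)
          (localVariation_fst_fst (hΨ k) (by rw [hΨ0]; exact ha))
        rw [(ch k).base.right_inv ha.1] at h2
        simp only [h2, mul_zero]
    · intro x hx t
      by_cases hxC : x ∈ C
      · have h3 : σ k x = 0 := by
          by_contra h3
          exact hx ⟨hxC, subset_tsupport _ h3⟩
        simp only [hΨdef, h3, zero_mul]
      · simp only [hΨdef, hfix x hxC]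
  rw [integralOn_sum hη J (α := fun k => firstVariation η L (Ψ k))
    (fun k _ => ((hΨ k).isSmoothFormFamily hη hL).isContForm_derivForm) hUo hU ?_]
  · exact Finset.sum_eq_zero fun k _ => hpiece k
  -- the first variations add up, as can be seen in an adapted chart around each point
  intro i a ha
  set x := (chartAt (BaseSp n) i).symm a with hx
  have hxU : x ∈ U := ha.2
  set e := ch x with he
  have hxe : ψ x ∈ e.pSource := mem_prefChart_source (ψ x).pt
  have hxb : x ∈ e.base.source := by
    have := AdaptedChart.toBase_mem hxe
    rwa [hψ.2] at this
  set b := e.base x with hb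
  have hbx : e.base.symm b = x := e.base.left_inv hxb
  have hbt : b ∈ e.base.target := e.base.map_source hxb
  have hbD : b ∈ sectionDomain e e.base ψ := ⟨hbt, by rw [hbx]; exact hxe⟩
  have hvar : ∀ k, ∀ b' ∈ sectionDomain e e.base ψ, localVariation e (Ψ k) b' =
      σ k (e.base.symm b') • localVariation e (fun t x => V.diffeo t (ψ x)) b' := by
    intro k b' hb'
    have h1 : DifferentiableAt ℝ
        (fun t => localSection e e.base (fun x => V.diffeo t (ψ x)) b')
        (σ k (e.base.symm b') * 0) := by
      have hmem : ((0 : ℝ), b') ∈ familyDomain e e.base (fun t x => V.diffeo t (ψ x)) :=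
        ⟨hb'.1, by change V.diffeo 0 _ ∈ _; rw [V.zero]; exact hb'.2⟩
      rw [mul_zero]
      exact (eventually_deriv_slice_eq ((hid.contDiffOn_localSection
        e.isSmoothChart_base (e := e)).contDiffAt ((hid.isOpen_familyDomain
        e.isSmoothChart_base).mem_nhds hmem))).self_of_nhds.2.differentiableAt
    have h2 : HasDerivAt (fun t => σ k (e.base.symm b') * t) (σ k (e.base.symm b')) (0 : ℝ) := by
      simpa using (hasDerivAt_id (0 : ℝ)).const_mul (σ k (e.base.symm b'))
    have h3 := h1.hasDerivAt.scomp (0 : ℝ) h2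
    rw [mul_zero] at h3
    exact h3.deriv
  -- as the Euler-Lagrange expression vanishes, each first variation is a pure divergence, which is
  -- additive in the variation
  have hcoef : ∀ Φ : ℝ → X → Pontryagin B, IsSmoothFamily Φ → Φ 0 = ψ →
      coeffIn e.base (firstVariation η L Φ) b =
        ∑ μ, fderiv ℝ (fun b => mom μ (localSection e e.base ψ b).2.2
          (localVariation e Φ b).1.2) b (baseVec μ) := by
    intro Φ hΦ hΦ0
    rw [coeffIn_firstVariation hη hL hΦ (by rw [hΦ0]; exact hbD), hΦ0,
      hEL e x hxe _ (localVariation_fst_fst hΦ (by rw [hΦ0]; exact hbD)), zero_add]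
  have hmain : coeffIn e.base (firstVariation η L fun t x => V.diffeo t (ψ x)) b =
      ∑ k ∈ J, coeffIn e.base (firstVariation η L (Ψ k)) b := by
    rw [hcoef _ hid hid0, Finset.sum_congr rfl fun k _ => hcoef _ (hΨ k) (hΨ0 k),
      Finset.sum_comm]
    refine Finset.sum_congr rfl fun μ _ => ?_
    have hd : ∀ k ∈ J, DifferentiableAt ℝ (fun b => mom μ (localSection e e.base ψ b).2.2
        (localVariation e (Ψ k) b).1.2) b := by
      intro k _
      have := contDiffAt_momentum_variation (hΨ k) (e := e) (a := b) (by rw [hΨ0]; exact hbD) μ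
      rw [hΨ0] at this
      exact this.differentiableAt (by simp)
    rw [← sum_apply, ← fderiv_fun_sum hd]
    congr 1
    refine Filter.EventuallyEq.fderiv_eq ?_
    have hUn : ∀ᶠ b' in 𝓝 b, e.base.symm b' ∈ U :=
      (e.base.continuousAt_symm hbt).eventually (by rw [hbx]; exact hUo.mem_nhds hxU)
    filter_upwards [hUn, (hψ.isOpen_sectionDomain e.isSmoothChart_base).mem_nhds hbD]
      with b' hb'U hb'D
    have h4 : ∀ k, mom μ (localSection e e.base ψ b').2.2 (localVariation e (Ψ k) b').1.2 =
        σ k (e.base.symm b') * mom μ (localSection e e.base ψ b').2.2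
          (localVariation e (fun t x => V.diffeo t (ψ x)) b').1.2 := by
      intro k
      rw [hvar k b' hb'D]
      exact map_smul _ _ _
    simp only [h4]
    rw [← Finset.sum_mul, hsum _ hb'U, one_mul]
  have hne := vol_chartFrame_ne_zero e.isSmoothChart_base hbt
  simp only [coeffIn_eq_mul_vol, hbx] at hmain ⊢
  rw [← Finset.sum_mul] at hmain ⊢
  rw [mul_right_cancel₀ hne hmain]

end

section

/-! ### Vertical variations supported in a coordinate domain -/

section BumpDiffeo

variable {E : Type*} [NormedAddCommGroup E] [NormedSpace ℝ E] [CompleteSpace E]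

/-- A translation cut off by a bump function is a diffeomorphism as long as it is short. -/
theorem exists_homeomorph_add_smul {χ : E → ℝ} (hχ : ContDiff ℝ ∞ χ) (hc : HasCompactSupport χ)
    (v : E) : ∃ ε > 0, ∀ s : ℝ, |s| ≤ ε →
      ∃ G : E ≃ₜ E, (∀ q, G q = q + (s * χ q) • v) ∧ ContDiff ℝ ∞ G.symm := by
  obtain ⟨C, hC⟩ := hχ.lipschitzWith_of_hasCompactSupport hc (by simp)
  have hpos : (0 : ℝ) < 2 * ((C : ℝ) + 1) * (‖v‖ + 1) := by positivity
  refine ⟨1 / (2 * ((C : ℝ) + 1) * (‖v‖ + 1)), by positivity, fun s hs => ?_⟩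
  -- for short translations the map is a contractive perturbation of the identity
  have hlip : LipschitzWith (1 / 2) (fun q => (s * χ q) • v) := by
    refine LipschitzWith.of_dist_le_mul fun x y => ?_
    have h1 : |χ x - χ y| ≤ C * dist x y := by
      have := hC.dist_le_mul x y
      rwa [Real.dist_eq] at this
    rw [dist_eq_norm, ← sub_smul, norm_smul, ← mul_sub, norm_mul, Real.norm_eq_abs,
      Real.norm_eq_abs]
    have h2 : |s| * C * ‖v‖ ≤ 1 / 2 := by
      have h3 : |s| * (2 * ((C : ℝ) + 1) * (‖v‖ + 1)) ≤ 1 := (le_div_iff₀ hpos).1 hs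
      have h4 : |s| * C * ‖v‖ ≤ |s| * ((C + 1) * (‖v‖ + 1)) := by
        rw [mul_assoc]
        gcongr <;> simp
      linarith
    calc |s| * |χ x - χ y| * ‖v‖ ≤ |s| * (C * dist x y) * ‖v‖ := by gcongr
      _ = |s| * C * ‖v‖ * dist x y := by ring
      _ ≤ 1 / 2 * dist x y := by gcongr
      _ = ((1 / 2 : NNReal) : ℝ) * dist x y := by simp
  set f : E → E := fun q => q + (s * χ q) • v with hf
  have hfs : ContDiff ℝ ∞ f := contDiff_id.add ((contDiff_const.mul hχ).smul contDiff_const)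
  have happ : ApproximatesLinearOn f ((ContinuousLinearEquiv.refl ℝ E : E ≃L[ℝ] E) : E →L[ℝ] E)
      univ (1 / 2) := by
    refine ApproximatesLinearOn.approximatesLinearOn_iff_lipschitzOnWith.2 ?_
    have : f - ⇑((ContinuousLinearEquiv.refl ℝ E : E ≃L[ℝ] E) : E →L[ℝ] E) =
        fun q => (s * χ q) • v := by
      funext q; simp [hf]
    rw [this]
    exact hlip.lipschitzOnWith
  have hN : Subsingleton E ∨ (1 / 2 : NNReal) <
      ‖((ContinuousLinearEquiv.refl ℝ E : E ≃L[ℝ] E).symm : E →L[ℝ] E)‖₊⁻¹ := by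
    rcases subsingleton_or_nontrivial E with h | h
    · exact Or.inl h
    · right
      have : ‖((ContinuousLinearEquiv.refl ℝ E : E ≃L[ℝ] E).symm : E →L[ℝ] E)‖₊ = 1 :=
        ContinuousLinearMap.nnnorm_id
      rw [this, inv_one]
      exact NNReal.half_lt_self one_ne_zero
  refine ⟨happ.toHomeomorph f hN, fun q => rfl, ?_⟩
  set A : E → E →L[ℝ] E := fun q => fderiv ℝ (fun q => (s * χ q) • v) q
  have hA : ∀ q, ‖-A q‖ < 1 := fun q => by
    rw [norm_neg]
    refine (norm_fderiv_le_of_lipschitz ℝ hlip).trans_lt ?_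
    norm_num
  have hd : ∀ q, HasFDerivAt f (ContinuousLinearMap.id ℝ E + A q) q := fun q =>
    (hasFDerivAt_id q).add
      ((((contDiff_const.mul hχ).smul contDiff_const).differentiable (by simp)) q).hasFDerivAt
  refine Homeomorph.contDiff_symm _
    (f₀' := fun q => ContinuousLinearEquiv.unitsEquiv ℝ E (Units.oneSub (-A q) (hA q))) ?_ hfs
  intro q
  have h1 : ((ContinuousLinearEquiv.unitsEquiv ℝ E (Units.oneSub (-A q) (hA q)) : E ≃L[ℝ] E) :
      E →L[ℝ] E) = ContinuousLinearMap.id ℝ E + A q := by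
    ext u
    simp
  rw [h1]
  exact hd q

/-- The time `t` enters through `ε * sin t`, which stays in `[-ε, ε]` for all `t` and has derivative
`ε` at `0`; thus the family of short translations is defined for all times. -/
theorem contDiff_add_sin_smul {χ : E → ℝ} (hχ : ContDiff ℝ ∞ χ) (ε : ℝ) (v : E) :
    ContDiff ℝ ∞ fun p : ℝ × E => p.2 + (ε * Real.sin p.1 * χ p.2) • v :=
  contDiff_snd.add (((contDiff_const.mul (Real.contDiff_sin.comp contDiff_fst)).mul
    (hχ.comp contDiff_snd)).smul contDiff_const)

end BumpDiffeo

variable {n N : ℕ} {X Y F : Type*}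
  [TopologicalSpace X] [ChartedSpace (BaseSp n) X]
  [TopologicalSpace Y] [ChartedSpace (TotSp n N) Y]
  [TopologicalSpace F] [ChartedSpace (FibSp N) F]
  {B : SmoothFiberBundle n N X Y F}

namespace AdaptedChart

open Classical in
/-- A self-map of the model space of `M`, transported to a coordinate domain and extended by the
identity. -/
def extendById (e : AdaptedChart B) (m₀ : Pontryagin B) (g : PontSp n N → PontSp n N)
    (m : Pontryagin B) : Pontryagin B :=
  if m ∈ e.pSource then e.pInv m₀ (g (e.pFun m)) else m

variable {e : AdaptedChart B} {m₀ : Pontryagin B}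

theorem extendById_of_mem {g : PontSp n N → PontSp n N} {m : Pontryagin B} (h : m ∈ e.pSource) :
    e.extendById m₀ g m = e.pInv m₀ (g (e.pFun m)) := if_pos h

theorem extendById_of_notMem {g : PontSp n N → PontSp n N} {m : Pontryagin B}
    (h : m ∉ e.pSource) : e.extendById m₀ g m = m := if_neg h

theorem extendById_extendById {g h : PontSp n N → PontSp n N} (hg : MapsTo g e.pTarget e.pTarget)
    (hgh : ∀ q, h (g q) = q) (m : Pontryagin B) :
    e.extendById m₀ h (e.extendById m₀ g m) = m := by
  by_cases hm : m ∈ e.pSource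
  · have h1 := hg (pFun_mem hm)
    rw [extendById_of_mem hm, extendById_of_mem (pInv_mem m₀ h1), pFun_pInv m₀ h1, hgh,
      pInv_pFun m₀ hm]
  · rw [extendById_of_notMem hm, extendById_of_notMem hm]

variable [IsManifold 𝓘(ℝ, BaseSp n) ∞ X] [IsManifold 𝓘(ℝ, FibSp N) ∞ F] [T2Space Y]

/-- Off the chart the extension is smooth because the compact set on which the map moves points
projects to a closed subset of `Y`. -/
theorem contMDiff_extendById {G : ℝ × PontSp n N → PontSp n N} (hG : ContDiff ℝ ∞ G)
    {k : Set (PontSp n N)} (hk : IsCompact k) (hkt : k ⊆ e.pTarget)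
    (hfix : ∀ t, ∀ q ∉ k, G (t, q) = q)
    (hmaps : ∀ t, MapsTo (fun q => G (t, q)) e.pTarget e.pTarget) :
    ContMDiff (𝓘(ℝ, ℝ).prod 𝓘(ℝ, PontSp n N)) 𝓘(ℝ, PontSp n N) ∞
      fun p : ℝ × Pontryagin B => e.extendById m₀ (fun q => G (p.1, q)) p.2 := by
  rintro ⟨t, m⟩
  by_cases hm : m ∈ e.pSource
  · have hO : IsOpen {p : ℝ × Pontryagin B | p.2 ∈ e.pSource} :=
      e.isOpen_pSource.preimage continuous_snd
    have h1 : ContMDiffOn (𝓘(ℝ, ℝ).prod 𝓘(ℝ, PontSp n N)) 𝓘(ℝ, ℝ × PontSp n N) ∞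
        (fun p : ℝ × Pontryagin B => (p.1, e.pFun p.2)) {p | p.2 ∈ e.pSource} :=
      contMDiff_fst.contMDiffOn.prodMk_space
        (e.contMDiffOn_pFun.comp contMDiff_snd.contMDiffOn fun p hp => hp)
    have h2 := (e.contMDiffOn_pInv m₀).comp (hG.contMDiff.comp_contMDiffOn h1)
      (fun p hp => hmaps p.1 (pFun_mem hp))
    refine (h2.contMDiffAt (hO.mem_nhds hm)).congr_of_eventuallyEq ?_
    filter_upwards [hO.mem_nhds hm] with p hp
    exact extendById_of_mem hp
  -- the points that are moved lie over the compact set `A`, which is closed as `Y` is Hausdorff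
  · set A : Set Y := e.chart.symm '' (Prod.fst '' k) with hA
    have hAc : IsClosed A := by
      refine ((hk.image continuous_fst).image_of_continuousOn
        (e.chart.continuousOn_symm.mono ?_)).isClosed
      rintro _ ⟨q, hq, rfl⟩
      exact hkt hq
    have hAs : A ⊆ e.chart.source := by
      rintro _ ⟨_, ⟨q, hq, rfl⟩, rfl⟩
      exact e.chart.map_target (hkt hq)
    have hO : IsOpen {p : ℝ × Pontryagin B | p.2.pt ∉ A} :=
      hAc.isOpen_compl.preimage ((contMDiff_pt (B := B)).continuous.comp continuous_snd)
    refine contMDiffAt_snd.congr_of_eventuallyEq ?_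
    filter_upwards [hO.mem_nhds (show (t, m) ∈ _ from fun h => hm (hAs h))] with p hp
    by_cases hpm : p.2 ∈ e.pSource
    · rw [extendById_of_mem hpm, hfix, pInv_pFun m₀ hpm]
      intro hq
      refine hp ⟨_, ⟨_, hq, rfl⟩, ?_⟩
      rw [pFun_fst hpm, e.chart.left_inv hpm]
    · exact extendById_of_notMem hpm

/-- Every compactly supported function on the coordinate domain and every vertical coordinate
direction give a vertical variation. -/
theorem exists_verticalVariation (e : AdaptedChart B) (m₀ : Pontryagin B) {U : Set X}
    {χ : PontSp n N → ℝ} (hχ : ContDiff ℝ ∞ χ) (hc : HasCompactSupport χ)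
    (hsupp : ∀ q ∈ tsupport χ, q ∈ e.pTarget ∧ e.base.symm q.1.1 ∈ U)
    {v : PontSp n N} (hv : v.1.1 = 0) :
    ∃ ε > 0, ∃ V : VerticalVariation B U,
      (∀ t, ∀ m ∈ e.pSource, V.diffeo t m ∈ e.pSource ∧
        e.pFun (V.diffeo t m) = e.pFun m + (ε * Real.sin t * χ (e.pFun m)) • v) ∧
      ∀ t, ∀ m ∉ e.pSource, V.diffeo t m = m := by
  obtain ⟨ε, hε, hball⟩ := exists_homeomorph_add_smul hχ hc v
  have hs : ∀ t, |ε * Real.sin t| ≤ ε := fun t => by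
    rw [abs_mul, abs_of_pos hε]
    exact mul_le_of_le_one_right hε.le (Real.abs_sin_le_one t)
  choose G hG hGs using fun t => hball _ (hs t)
  set k := tsupport χ with hk
  have hfix : ∀ t, ∀ q ∉ k, G t q = q := fun t q hq => by
    rw [hG, image_eq_zero_of_notMem_tsupport hq, mul_zero, zero_smul ℝ v, add_zero]
  have hkk : ∀ t, ∀ q ∈ k, G t q ∈ k := fun t q hq => by
    by_contra h
    have h1 := (G t).injective (hfix t _ h)
    rw [h1] at h
    exact h hq
  have hkt : k ⊆ e.pTarget := fun q hq => (hsupp q hq).1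
  have hmaps : ∀ t, MapsTo (G t) e.pTarget e.pTarget := fun t q hq => by
    by_cases h : q ∈ k
    · exact hkt (hkk t q h)
    · rwa [hfix t q h]
  -- the inverse also fixes the complement of `k` and preserves the coordinate domain
  have hfix' : ∀ t, ∀ q ∉ k, (G t).symm q = q := fun t q hq => by
    rw [Homeomorph.symm_apply_eq, hfix t q hq]
  have hmaps' : ∀ t, MapsTo (G t).symm e.pTarget e.pTarget := fun t q hq => by
    by_cases h : q ∈ k
    · refine hkt ?_
      by_contra h'
      have := hfix t _ h'
      rw [Homeomorph.apply_symm_apply] at this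
      exact h' (this ▸ h)
    · rwa [hfix' t q h]
  have hGsm : ContDiff ℝ ∞ fun p : ℝ × PontSp n N => G p.1 p.2 := by
    have h1 : (fun p : ℝ × PontSp n N => G p.1 p.2) =
        fun p => p.2 + (ε * Real.sin p.1 * χ p.2) • v := by
      funext p; exact hG p.1 p.2
    rw [h1]
    exact contDiff_add_sin_smul hχ ε v
  have hsm : ContMDiff (𝓘(ℝ, ℝ).prod 𝓘(ℝ, PontSp n N)) 𝓘(ℝ, PontSp n N) ∞
      fun p : ℝ × Pontryagin B => e.extendById m₀ (G p.1) p.2 :=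
    contMDiff_extendById (m₀ := m₀) hGsm hc hkt hfix hmaps
  have hslice : ∀ t : ℝ, ContMDiff 𝓘(ℝ, PontSp n N) (𝓘(ℝ, ℝ).prod 𝓘(ℝ, PontSp n N)) ∞
      fun m : Pontryagin B => (t, m) := fun t => contMDiff_const.prodMk contMDiff_id
  have hsymm : ∀ t, ContMDiff 𝓘(ℝ, PontSp n N) 𝓘(ℝ, PontSp n N) ∞
      (e.extendById m₀ (G t).symm) := fun t =>
    (contMDiff_extendById (e := e) (m₀ := m₀) (G := fun p => (G t).symm p.2)
      ((hGs t).comp contDiff_snd) hc hkt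
      (fun _ => hfix' t) (fun _ => hmaps' t)).comp (hslice 0)
  have hcoord : ∀ t, ∀ m ∈ e.pSource, e.extendById m₀ (G t) m ∈ e.pSource ∧
      e.pFun (e.extendById m₀ (G t) m) = G t (e.pFun m) := fun t m hm => by
    rw [extendById_of_mem hm]
    exact ⟨pInv_mem m₀ (hmaps t (pFun_mem hm)), pFun_pInv m₀ (hmaps t (pFun_mem hm))⟩
  refine ⟨ε, hε, ⟨fun t => ⟨⟨e.extendById m₀ (G t), e.extendById m₀ (G t).symm,
      extendById_extendById (hmaps t) (G t).symm_apply_apply,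
      extendById_extendById (hmaps' t) (G t).apply_symm_apply⟩, hsm.comp (hslice t), hsymm t⟩,
    hsm, ?_, ?_, ?_⟩, fun t m hm => ⟨(hcoord t m hm).1, ?_⟩,
    fun t m hm => extendById_of_notMem hm⟩
  · intro m
    change e.extendById m₀ (G 0) m = m
    by_cases hm : m ∈ e.pSource
    · rw [extendById_of_mem hm, hG, Real.sin_zero, mul_zero, zero_mul, zero_smul ℝ v, add_zero,
        pInv_pFun m₀ hm]
    · exact extendById_of_notMem hm
  · intro t m
    change (e.extendById m₀ (G t) m).toBase = m.toBase
    by_cases hm : m ∈ e.pSource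
    · obtain ⟨h1, h2⟩ := hcoord t m hm
      refine e.base.injOn (toBase_mem h1) (toBase_mem hm) ?_
      rw [← pFun_fst_fst h1, ← pFun_fst_fst hm, h2, hG]
      change (e.pFun m).1.1 + _ • v.1.1 = _
      rw [hv, smul_zero, add_zero]
    · rw [extendById_of_notMem hm]
  · refine ⟨e.pInv m₀ '' k, hc.isCompact.image_of_continuousOn
      ((e.contMDiffOn_pInv m₀).continuousOn.mono hkt), ?_, ?_⟩
    · rintro _ ⟨q, hq, rfl⟩
      have h1 := pInv_mem m₀ (hkt hq)
      rw [← e.base.left_inv (toBase_mem h1), ← pFun_fst_fst h1, pFun_pInv m₀ (hkt hq)]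
      exact (hsupp q hq).2
    · intro t m hm
      change e.extendById m₀ (G t) m = m
      by_cases hms : m ∈ e.pSource
      · rw [extendById_of_mem hms, hfix, pInv_pFun m₀ hms]
        exact fun hq => hm ⟨_, hq, pInv_pFun m₀ hms⟩
      · exact extendById_of_notMem hms
  · exact (hcoord t m hm).2.trans (hG t _)

end AdaptedChart

end

section

variable {n N : ℕ} {X Y F : Type*}
  [TopologicalSpace X] [ChartedSpace (BaseSp n) X]
  [TopologicalSpace Y] [ChartedSpace (TotSp n N) Y]
  [TopologicalSpace F] [ChartedSpace (FibSp N) F]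
  {B : SmoothFiberBundle n N X Y F}

/-! ### The fundamental lemma of the calculus of variations -/

theorem eulerLagrange_smul (ℓ : JetSp n N → ℝ) (Q : BaseSp n → PontSp n N) (a : BaseSp n) (r : ℝ)
    (δ : PontSp n N) : eulerLagrange ℓ Q a (r • δ) = r * eulerLagrange ℓ Q a δ := by
  have h1 : ∀ μ : Fin (n + 1), mom μ (r • δ).2.2 = r • mom μ δ.2.2 := fun μ =>
    map_smul (mom μ) r δ.2.2
  have h2 : ∀ u, (r • δ).2.1 u = r • δ.2.1 u := fun u => rfl
  have h3 : (r • δ).1.2 = r • δ.1.2 := rfl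
  have h4 : (((r • δ).1, (r • δ).2.1) : JetSp n N) = r • (δ.1, δ.2.1) := rfl
  simp only [eulerLagrange]
  rw [h3, h4, map_smul, mul_add, Finset.mul_sum, smul_eq_mul]
  congr 1
  refine Finset.sum_congr rfl fun μ _ => ?_
  rw [h1, h2, map_smul, map_smul, smul_apply, smul_eq_mul, smul_eq_mul,
    smul_eq_mul]
  ring

variable [IsManifold 𝓘(ℝ, BaseSp n) ∞ X] [IsManifold 𝓘(ℝ, FibSp N) ∞ F]
  {η : DiffForm (BaseSp n) X (n + 1)} {L : JetBundle B → ℝ}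

theorem continuousOn_eulerLagrange (hη : IsVolumeForm η)
    (hL : ContMDiff 𝓘(ℝ, JetSp n N) 𝓘(ℝ, ℝ) ∞ L) {ψ : X → Pontryagin B}
    (hψ : IsSmoothSection ψ) (e : AdaptedChart B) (δ : PontSp n N) :
    ContinuousOn (fun b => eulerLagrange (e.localLagrangian η L) (localSection e e.base ψ) b δ)
      (sectionDomain e e.base ψ) := by
  rcases (sectionDomain e e.base ψ).eq_empty_or_nonempty with h0 | ⟨b₀, hb₀⟩
  · rw [h0]; exact continuousOn_empty _
  have hDo := hψ.isOpen_sectionDomain e.isSmoothChart_base (e := e)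
  have hQ := hψ.contDiffOn_localSection e.isSmoothChart_base (e := e)
  have hT : IsOpen {q : JetSp n N | q.1 ∈ e.chart.target} :=
    e.chart.open_target.preimage continuous_fst
  have hℓ := (e.contDiffOn_localLagrangian hη hL
    (ψ (e.base.symm b₀)).toJet).continuousOn_fderiv_of_isOpen hT (by simp)
  have hQc := hQ.continuousOn
  have hy := hQ.fst.snd.continuousOn_fderiv_of_isOpen hDo (by simp)
  have hw := hQ.snd.snd.continuousOn_fderiv_of_isOpen hDo (by simp)
  have hℓQ : ContinuousOn (fun b => fderiv ℝ (e.localLagrangian η L)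
      ((localSection e e.base ψ b).1, (localSection e e.base ψ b).2.1))
      (sectionDomain e e.base ψ) := by
    refine hℓ.comp (hQc.fst.prodMk hQc.snd.fst) fun b hb => ?_
    exact AdaptedChart.pFun_mem hb.2
  refine (continuousOn_finsetSum _ fun μ _ => ?_).add (hℓQ.clm_apply continuousOn_const)
  refine (ContinuousOn.sub ?_ ?_).sub ?_
  · exact (mom μ δ.2.2).continuous.comp_continuousOn
      ((hy.clm_apply continuousOn_const).sub (hQc.snd.fst.clm_apply continuousOn_const))
  · exact ((mom μ).continuous.comp_continuousOn hQc.snd.snd).clm_apply continuousOn_const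
  · exact ((mom μ).continuous.comp_continuousOn (hw.clm_apply continuousOn_const)).clm_apply
      continuousOn_const

variable [T2Space X] [SigmaCompactSpace X] [T2Space Y]

/-- A critical point satisfies the Euler-Lagrange equations: at a point where the Euler-Lagrange
expression in some direction is nonzero, vary the section in that direction, cut off by a bump
function on `M`. -/
theorem eulerLagrangeVanishes_of_isCriticalPoint (hη : IsVolumeForm η)
    (hL : ContMDiff 𝓘(ℝ, JetSp n N) 𝓘(ℝ, ℝ) ∞ L) {ψ : X → Pontryagin B}
    (hψ : IsSmoothSection ψ) (hcrit : IsCriticalPoint η L ψ) : EulerLagrangeVanishes η L ψ := by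
  intro e x hx δ hδ
  by_contra hne
  have hc := e.isSmoothChart_base
  have hxs : x ∈ e.base.source := by
    have := AdaptedChart.toBase_mem hx
    rwa [hψ.2] at this
  set a₀ := e.base x with ha₀
  have ha₀x : e.base.symm a₀ = x := e.base.left_inv hxs
  set D := sectionDomain e e.base ψ with hD
  have hDo : IsOpen D := hψ.isOpen_sectionDomain hc
  have ha₀D : a₀ ∈ D := ⟨e.base.map_source hxs, by rw [ha₀x]; exact hx⟩
  set Q := localSection e e.base ψ with hQ
  set h : PontSp n N → BaseSp n → ℝ := fun v b => Real.sign (coeffIn e.base η b) *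
    eulerLagrange (e.localLagrangian η L) Q b v with hh
  have hcont : ∀ v, ContinuousOn (h v) D := fun v =>
    ((hη.continuousOn_sign hc).mono fun b hb => hb.1).mul
      (continuousOn_eulerLagrange hη hL hψ e v)
  have hne' : h δ a₀ ≠ 0 := by
    refine mul_ne_zero ?_ hne
    rw [Ne, Real.sign_eq_zero_iff]
    exact coeffIn_ne_zero hη hc ha₀D.1
  -- the expression is linear in the direction, so that its sign can be chosen
  obtain ⟨v, hv, hpos⟩ : ∃ v : PontSp n N, v.1.1 = 0 ∧ 0 < h v a₀ := by
    refine ⟨h δ a₀ • δ, ?_, ?_⟩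
    · change h δ a₀ • δ.1.1 = 0
      rw [hδ, smul_zero]
    · have : h (h δ a₀ • δ) a₀ = h δ a₀ * h δ a₀ := by
        simp only [hh, eulerLagrange_smul]; ring
      rw [this]
      exact mul_self_pos.2 hne'
  set D' : Set (BaseSp n) := D ∩ h v ⁻¹' Ioi 0 with hD'
  have hD'o : IsOpen D' := (hcont v).isOpen_inter_preimage hDo isOpen_Ioi
  have := ChartedSpace.locallyCompactSpace (BaseSp n) X
  -- a relatively compact neighbourhood `U` of `x` on which the expression stays positive
  obtain ⟨K, hK, hxK, hKD⟩ := exists_compact_subset (e.base.isOpen_inter_preimage hD'o)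
    (show x ∈ e.base.source ∩ e.base ⁻¹' D' from ⟨hxs, ha₀D, hpos⟩)
  set U := interior K with hU
  have hUo : IsOpen U := isOpen_interior
  have hUc : IsCompact (closure U) :=
    hK.of_isClosed_subset isClosed_closure (closure_minimal interior_subset hK.isClosed)
  have hUD : ∀ b ∈ e.base.target, e.base.symm b ∈ U → b ∈ D' := fun b hb hbU => by
    have := (hKD (interior_subset hbU)).2
    rwa [mem_preimage, e.base.right_inv hb] at this
  -- the bump function `χ` on the model space of `M` is supported over `U`
  set S : Set (PontSp n N) :=
    e.pTarget ∩ {q | q.1.1 ∈ e.base.target ∩ e.base.symm ⁻¹' U} with hS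
  have hSo : IsOpen S := AdaptedChart.isOpen_pTarget.inter
    ((e.base.isOpen_inter_preimage_symm hUo).preimage (continuous_fst.comp continuous_fst))
  have hQS : Q a₀ ∈ S := by
    have h1 : (Q a₀).1.1 = a₀ := localSection_base hψ ha₀D
    refine ⟨AdaptedChart.pFun_mem ha₀D.2, ?_⟩
    rw [mem_ofPred_eq, h1]
    exact ⟨ha₀D.1, by rw [mem_preimage, ha₀x]; exact hxK⟩
  obtain ⟨χ, hχS, hχc, hχ, hχr, hχ1⟩ := exists_contDiff_tsupport_subset (n := ⊤)
    (hSo.mem_nhds hQS)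
  have hχ0 : ∀ q, 0 ≤ χ q := fun q => (hχr ⟨q, rfl⟩).1
  obtain ⟨ε, hε, V, hVin, hVout⟩ := e.exists_verticalVariation (ψ x) (U := U) hχ hχc
    (fun q hq => ⟨(hχS hq).1, (hχS hq).2.2⟩) hv
  have hΨ : IsSmoothFamily fun t x => V.diffeo t (ψ x) := V.isSmoothFamily hψ contMDiff_fst
  have hΨ0 : (fun x => V.diffeo 0 (ψ x)) = ψ := by funext x; exact V.zero _
  set C : Set X := e.base.symm '' ((fun q : PontSp n N => q.1.1) '' tsupport χ) with hC
  have hCc : IsCompact C := by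
    refine (hχc.isCompact.image (continuous_fst.comp continuous_fst)).image_of_continuousOn
      (e.base.continuousOn_symm.mono ?_)
    rintro _ ⟨q, hq, rfl⟩
    exact (hχS hq).2.1
  have hCU : C ⊆ U := by
    rintro _ ⟨_, ⟨q, hq, rfl⟩, rfl⟩
    exact (hχS hq).2.2
  have hfix : ∀ x ∉ C, ∀ t, V.diffeo t (ψ x) = ψ x := by
    intro x' hx' t
    by_cases hm : ψ x' ∈ e.pSource
    · obtain ⟨h1, h2⟩ := hVin t _ hm
      have h3 : χ (e.pFun (ψ x')) = 0 := by
        refine image_eq_zero_of_notMem_tsupport fun hq => hx' ⟨_, ⟨_, hq, rfl⟩, ?_⟩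
        have h4 := AdaptedChart.toBase_mem hm
        simp only [AdaptedChart.pFun_fst_fst hm]
        rw [e.base.left_inv h4, hψ.2]
      rw [h3, mul_zero, zero_smul ℝ v, add_zero] at h2
      rw [← AdaptedChart.pInv_pFun (ψ x) h1, h2, AdaptedChart.pInv_pFun (ψ x) hm]
    · exact hVout t _ hm
  have hint := integralOn_firstVariation hη hL hΨ e hUo hCc hCU
    (fun x' hx' => by
      rw [V.zero]
      obtain ⟨hx's, hx'D⟩ := hKD (interior_subset (hCU hx'))
      have := hx'D.1.2
      rwa [e.base.left_inv hx's] at this)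
    (fun x' hx' t => by rw [hfix x' hx', hfix x' hx'])
  have hzero : integralOn η U (firstVariation η L fun t x => V.diffeo t (ψ x)) = 0 :=
    (hasDerivAt_action hη hL hΨ hUo hUc).unique (hcrit U hUo hUc V)
  rw [hzero, hΨ0] at hint
  have hvar : ∀ b ∈ D, Real.sign (coeffIn e.base η b) *
      eulerLagrange (e.localLagrangian η L) Q b
        (localVariation e (fun t x => V.diffeo t (ψ x)) b) = ε * χ (Q b) * h v b := by
    intro b hb
    have h1 : (fun t => localSection e e.base (fun x => V.diffeo t (ψ x)) b) =
        fun t => Q b + (ε * Real.sin t * χ (Q b)) • v := by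
      funext t
      exact (hVin t _ hb.2).2
    have h2 : HasDerivAt (fun t : ℝ => Q b + (ε * Real.sin t * χ (Q b)) • v)
        ((ε * χ (Q b)) • v) 0 := by
      have h3 := (((Real.hasDerivAt_sin 0).const_mul ε).mul_const (χ (Q b))).smul_const v
      rw [Real.cos_zero, mul_one] at h3
      exact h3.const_add (Q b)
    have h4 : localVariation e (fun t x => V.diffeo t (ψ x)) b = (ε * χ (Q b)) • v := by
      rw [localVariation, h1, h2.deriv]
    rw [h4, eulerLagrange_smul]
    ring
  -- the integrand `ε χ h` of the first variation is nonnegative, and positive near `a₀`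
  have hnonneg : ∀ b ∈ D, 0 ≤ ε * χ (Q b) * h v b := by
    intro b hb
    by_cases hq : Q b ∈ tsupport χ
    · have h1 : (Q b).1.1 = b := localSection_base hψ hb
      have h2 := (hχS hq).2.2
      rw [mem_preimage, h1] at h2
      have h3 : 0 < h v b := (hUD b hb.1 h2).2
      exact mul_nonneg (mul_nonneg hε.le (hχ0 _)) h3.le
    · rw [image_eq_zero_of_notMem_tsupport hq]; simp
  have hI : ∫ b in D, ε * χ (Q b) * h v b = 0 := by
    rw [← MeasureTheory.setIntegral_congr_fun hDo.measurableSet hvar]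
    exact hint.2.symm
  have hfi : MeasureTheory.IntegrableOn (fun b => ε * χ (Q b) * h v b) D :=
    hint.1.congr_fun hvar hDo.measurableSet
  have hlt := (MeasureTheory.setIntegral_pos_iff_support_of_nonneg_ae
    ((MeasureTheory.ae_restrict_iff' hDo.measurableSet).2 (Filter.Eventually.of_forall hnonneg))
    hfi).2
  refine (hlt ?_).ne' hI
  refine MeasureTheory.Measure.measure_pos_of_mem_nhds _ (x := a₀) ?_
  have hQc : ContinuousAt Q a₀ := (hψ.contDiffAt_localSection hc ha₀D).continuousAt
  have hχa : ContinuousAt (fun b => χ (Q b)) a₀ := hχ.continuous.continuousAt.comp hQc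
  have hev : ∀ᶠ b in 𝓝 a₀, 0 < χ (Q b) := hχa.eventually (lt_mem_nhds
    (show (0 : ℝ) < χ (Q a₀) by rw [hχ1]; exact one_pos))
  filter_upwards [hev, hD'o.mem_nhds (show a₀ ∈ D' from ⟨ha₀D, hpos⟩)] with b hb hbD
  exact ⟨(mul_pos (mul_pos hε hb) hbD.2).ne', hbD.1⟩

end

section

/-! ### The exterior derivative in coordinates -/

section Dform

variable {E : Type*} [NormedAddCommGroup E] [NormedSpace ℝ E]
  {P : Type*} [TopologicalSpace P] [ChartedSpace E P] [IsManifold 𝓘(ℝ, E) ∞ P]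
  {E' : Type*} [NormedAddCommGroup E'] [NormedSpace ℝ E']

/-- The exterior derivative of a form which is locally pulled back from a normed space. For a
chart this says that the exterior derivative can be computed in any coordinates. -/
theorem dform_apply_of_eventuallyEq {k : ℕ} {α : DiffForm E P k} {φ : P → E'}
    {β : E' → E' [⋀^Fin k]→L[ℝ] ℝ} {p : P} {O : Set P} (hO : IsOpen O) (hp : p ∈ O)
    (hφ : ContMDiffOn 𝓘(ℝ, E) 𝓘(ℝ, E') ∞ φ O)
    (hα : ∀ p' ∈ O, ∀ u : Fin k → E, (α p' : E [⋀^Fin k]→L[ℝ] ℝ) u =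
      β (φ p') fun i => mfderiv 𝓘(ℝ, E) 𝓘(ℝ, E') φ p' (u i))
    (hβ : DifferentiableAt ℝ β (φ p)) (u : Fin (k + 1) → E) :
    (dform α p : E [⋀^Fin (k + 1)]→L[ℝ] ℝ) u =
      extDeriv β (φ p) fun i => mfderiv 𝓘(ℝ, E) 𝓘(ℝ, E') φ p (u i) := by
  set c := chartAt E p with hc
  have hcs : p ∈ c.source := mem_chart_source E p
  have hcp : c.symm (c p) = p := c.left_inv hcs
  set f : E → E' := fun a => φ (c.symm a) with hf
  have hO' : IsOpen (c.target ∩ c.symm ⁻¹' O) := c.isOpen_inter_preimage_symm hO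
  have hmem : c p ∈ c.target ∩ c.symm ⁻¹' O := ⟨c.map_source hcs, by rwa [mem_preimage, hcp]⟩
  have hcsm : ContMDiffOn 𝓘(ℝ, E) 𝓘(ℝ, E) ∞ c.symm c.target := contMDiffOn_chart_symm
  have hfs : ContDiffOn ℝ ∞ f (c.target ∩ c.symm ⁻¹' O) := by
    rw [← contMDiffOn_iff_contDiffOn]
    exact hφ.comp (hcsm.mono inter_subset_left) inter_subset_right
  have hφm : ∀ p' ∈ O, HasMFDerivAt 𝓘(ℝ, E) 𝓘(ℝ, E') φ p'
      (mfderiv 𝓘(ℝ, E) 𝓘(ℝ, E') φ p') := fun p' hp' =>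
    ((hφ.contMDiffAt (hO.mem_nhds hp')).mdifferentiableAt (by simp)).hasMFDerivAt
  have hchain : ∀ a ∈ c.target ∩ c.symm ⁻¹' O, ∀ v : E,
      (mfderiv 𝓘(ℝ, E) 𝓘(ℝ, E') φ (c.symm a) (mfderiv 𝓘(ℝ, E) 𝓘(ℝ, E) c.symm a v) : E') =
        fderiv ℝ f a v := by
    intro a ha v
    have h1 : HasMFDerivAt 𝓘(ℝ, E) 𝓘(ℝ, E) c.symm a (mfderiv 𝓘(ℝ, E) 𝓘(ℝ, E) c.symm a) :=
      ((hcsm.contMDiffAt (c.open_target.mem_nhds ha.1)).mdifferentiableAt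
        (by simp)).hasMFDerivAt
    have h2 : HasMFDerivAt 𝓘(ℝ, E) 𝓘(ℝ, E') f a _ := (hφm _ ha.2).comp a h1
    rw [← mfderiv_eq_fderiv, h2.mfderiv]
    rfl
  -- in the preferred chart the form is the pullback of `β` along `f = φ ∘ c⁻¹`, and the exterior
  -- derivative commutes with pullbacks on normed spaces
  have hchart : formInChart α p =ᶠ[𝓝 (c p)]
      fun a => (β (f a)).compContinuousLinearMap (fderiv ℝ f a) := by
    filter_upwards [hO'.mem_nhds hmem] with a ha
    apply ContinuousAlternatingMap.ext
    intro v
    refine (hα _ ha.2 fun i => mfderiv 𝓘(ℝ, E) 𝓘(ℝ, E) c.symm a (v i)).trans ?_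
    change _ = β (f a) fun i => fderiv ℝ f a (v i)
    congr 1
    funext i
    exact hchain a ha (v i)
  have hfp : f (c p) = φ p := by simp only [hf, hcp]
  have h3 : extDeriv (formInChart α p) (c p) =
      (extDeriv β (f (c p))).compContinuousLinearMap (fderiv ℝ f (c p)) := by
    rw [hchart.extDeriv.self_of_nhds]
    exact extDeriv_pullback (r := ∞) (by rwa [hfp])
      (hfs.contDiffAt (hO'.mem_nhds hmem))
      (by simpa using (WithTop.coe_le_coe.2 le_top : ((2 : ℕ∞) : WithTop ℕ∞) ≤ ∞))
  change extDeriv (formInChart α p) (c p)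
    (fun i => mfderiv 𝓘(ℝ, E) 𝓘(ℝ, E) c p (u i)) = _
  rw [h3]
  change extDeriv β (f (c p))
    (fun i => fderiv ℝ f (c p) (mfderiv 𝓘(ℝ, E) 𝓘(ℝ, E) c p (u i))) = _
  rw [hfp]
  congr 1
  funext i
  have hcm : HasMFDerivAt 𝓘(ℝ, E) 𝓘(ℝ, E) c p (mfderiv 𝓘(ℝ, E) 𝓘(ℝ, E) c p) :=
    (((contMDiffOn_chart (n := ∞) (I := 𝓘(ℝ, E)) (x := p)).contMDiffAt
      (c.open_source.mem_nhds hcs)).mdifferentiableAt (by simp)).hasMFDerivAt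
  have hfm : HasMFDerivAt 𝓘(ℝ, E) 𝓘(ℝ, E') f (c p) (fderiv ℝ f (c p)) :=
    ((hfs.contDiffAt (hO'.mem_nhds hmem)).differentiableAt (by simp)).hasFDerivAt.hasMFDerivAt
  have h5 : HasMFDerivAt 𝓘(ℝ, E) 𝓘(ℝ, E') φ p _ := (hfm.comp p hcm).congr_of_eventuallyEq (by
    filter_upwards [c.open_source.mem_nhds hcs] with p' hp'
    simp only [hf, comp_apply, c.left_inv hp'])
  rw [h5.mfderiv]
  rfl

end Dform

section Model

variable {n N : ℕ}

theorem removeNth_succ_vecCons {V : Type*} {k : ℕ} (x : V) (T : Fin (k + 1) → V)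
    (j : Fin (k + 1)) :
    j.succ.removeNth (Matrix.vecCons x T) = Matrix.vecCons x (j.removeNth T) := by
  funext i
  refine Fin.cases ?_ (fun i => ?_) i
  · simp [Fin.removeNth]
  · simp [Fin.removeNth]

/-- The exterior derivative with its first argument singled out; in the other summands this argument
takes the place of the argument along which the form is differentiated. -/
theorem extDeriv_vecCons {E : Type*} [NormedAddCommGroup E] [NormedSpace ℝ E] {k : ℕ}
    {β : E → E [⋀^Fin (k + 1)]→L[ℝ] ℝ} {q : E} (hβ : DifferentiableAt ℝ β q) (δ : E)
    (T : Fin (k + 1) → E) :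
    extDeriv β q (Matrix.vecCons δ T) = fderiv ℝ (fun q => β q T) q δ -
      ∑ j, fderiv ℝ (fun q => β q (update T j δ)) q (T j) := by
  have hswap : ∀ (τ : E [⋀^Fin (k + 1)]→L[ℝ] ℝ) (j : Fin (k + 1)),
      τ (Matrix.vecCons δ (j.removeNth T)) = (-1) ^ (j : ℕ) * τ (update T j δ) := by
    intro τ j
    have h := τ.toAlternatingMap.neg_one_pow_smul_map_insertNth j δ (j.removeNth T)
    rw [Fin.insertNth_removeNth, zsmul_eq_mul] at h
    push_cast at h
    exact h.symm
  rw [extDeriv_apply hβ, Fin.sum_univ_succ, sub_eq_add_neg, ← Finset.sum_neg_distrib]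
  congr 1
  · simp only [Fin.val_zero, pow_zero, one_smul, Fin.removeNth_zero, Matrix.cons_val_zero]
    rfl
  · refine Finset.sum_congr rfl fun j _ => ?_
    simp only [removeNth_succ_vecCons, hswap, Matrix.cons_val_succ, Fin.val_succ]
    have hd : DifferentiableAt ℝ (fun q => β q (update T j δ)) q :=
      hβ.continuousAlternatingMap_apply_const _
    rw [fderiv_const_mul hd, smul_apply, smul_eq_mul, zsmul_eq_mul, ← mul_assoc]
    push_cast
    rw [← pow_add, show (j : ℕ) + 1 + j = 2 * j + 1 by ring, pow_succ, pow_mul]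
    simp

/-- A form that vanishes on two vertical vectors, evaluated on a frame of graph vectors one of
which is replaced by a vertical vector. -/
theorem dualModel_apply_update (w : DualModel n N) (h : Fin (n + 1) → FibSp N)
    (μ : Fin (n + 1)) (k : FibSp N) :
    w.1 (update (fun i => ((baseVec i, h i) : TotSp n N)) μ (0, k)) = mom μ w k := by
  have h1 : update (fun i => ((baseVec i, h i) : TotSp n N)) μ (0, k) =
      fun i => ((update baseVec μ (0 : BaseSp n) i, update h μ k i) : TotSp n N) := by
    funext i
    by_cases hi : i = μ
    · subst hi; simp
    · simp [hi]
  rw [h1, dualModel_apply_prod]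
  have h2 : ∀ g : Fin (n + 1) → TotSp n N, (∃ i j, i ≠ j ∧ (g i).1 = 0 ∧ (g j).1 = 0) →
      w.1 g = 0 := fun g ⟨i, j, hij, hi, hj⟩ => w.2 g i j hij hi hj
  have h3 : w.1 (fun i => ((update baseVec μ (0 : BaseSp n) i, 0) : TotSp n N)) = 0 :=
    w.1.map_coord_zero μ (by simp)
  rw [h3, zero_add, Finset.sum_eq_single μ, mom_apply]
  · congr 1
    funext i
    by_cases hi : i = μ
    · subst hi; simp
    · simp [hi, baseFrame]
  · intro ν _ hν
    exact h2 _ ⟨ν, μ, hν, by simp, by simp [hν.symm]⟩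
  · simp

/-- The canonical form `Θ` in coordinates. -/
def thetaModel (n N : ℕ) (q : DualSp n N) : DualSp n N [⋀^Fin (n + 1)]→L[ℝ] ℝ :=
  q.2.1.compContinuousLinearMap (ContinuousLinearMap.fst ℝ (TotSp n N) (DualModel n N))

set_option synthInstance.maxHeartbeats 200000 in
theorem differentiable_thetaModel : Differentiable ℝ (thetaModel n N) := by
  have h : thetaModel n N =
      ((ContinuousAlternatingMap.compContinuousLinearMapCLM
        (ContinuousLinearMap.fst ℝ (TotSp n N) (DualModel n N))).comp
      ((show DualModel n N →L[ℝ] TotSp n N [⋀^Fin (n + 1)]→L[ℝ] ℝ from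
        (dualSubmodule n N).subtypeL).comp
        (ContinuousLinearMap.snd ℝ (TotSp n N) (DualModel n N)))) := rfl
  rw [h]
  exact ContinuousLinearMap.differentiable _

theorem fderiv_thetaModel_apply (q δ : DualSp n N) (u : Fin (n + 1) → DualSp n N) :
    fderiv ℝ (fun q => thetaModel n N q u) q δ = δ.2.1 fun i => (u i).1 := by
  have h : (fun q => thetaModel n N q u) = ((dualApply n N fun i => (u i).1).comp
      (ContinuousLinearMap.snd ℝ (TotSp n N) (DualModel n N))) := rfl
  rw [h, ContinuousLinearMap.fderiv]
  rfl

/-- The derivative of the canonical form, contracted with a vertical vector and evaluated on the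
tangent frame of a section. -/
theorem extDeriv_thetaModel (q δ : DualSp n N) (hδ : δ.1.1 = 0) (T : Fin (n + 1) → DualSp n N)
    (h : Fin (n + 1) → FibSp N) (hT : ∀ μ, (T μ).1 = (baseVec μ, h μ)) :
    extDeriv (thetaModel n N) q (Matrix.vecCons δ T) =
      δ.2.1 (baseFrame n N) + ∑ μ, mom μ δ.2 (h μ) - ∑ μ, mom μ (T μ).2 δ.1.2 := by
  rw [extDeriv_vecCons (differentiable_thetaModel q)]
  simp only [fderiv_thetaModel_apply]
  congr 1
  · rw [← dualModel_apply_graph]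
    congr 1
    funext i
    exact hT i
  · refine Finset.sum_congr rfl fun μ _ => ?_
    rw [← dualModel_apply_update (T μ).2 h]
    congr 1
    funext i
    by_cases hi : i = μ
    · subst hi
      simp only [update_self]
      exact Prod.ext hδ rfl
    · simp only [update_of_ne hi, hT]

/-- The generalized energy in coordinates, `p + p_A^μ v^A_μ - L(x, y, v)`. -/
def energyModel (ℓ : JetSp n N → ℝ) (q : PontSp n N) : ℝ :=
  q.2.2.1 (fun i => (baseVec i, q.2.1 (baseVec i))) - ℓ (q.1, q.2.1)

theorem energyModel_eq (ℓ : JetSp n N → ℝ) (q : PontSp n N) :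
    energyModel ℓ q = q.2.2.1 (baseFrame n N) + ∑ μ, mom μ q.2.2 (q.2.1 (baseVec μ)) -
      ℓ (q.1, q.2.1) := by
  rw [energyModel, dualModel_apply_graph]

/-- The differential of the energy, for a varying point given by its components. -/
theorem fderiv_energyModel_comp {G : Type*} [NormedAddCommGroup G] [NormedSpace ℝ G]
    {ℓ : JetSp n N → ℝ} {f : G → PontSp n N} {g : G}
    {y' : G →L[ℝ] TotSp n N} {v' : G →L[ℝ] BaseSp n →L[ℝ] FibSp N} {w' : G →L[ℝ] DualModel n N}
    (hy : HasFDerivAt (fun g => (f g).1) y' g) (hv : HasFDerivAt (fun g => (f g).2.1) v' g)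
    (hw : HasFDerivAt (fun g => (f g).2.2) w' g)
    (hℓ : DifferentiableAt ℝ ℓ ((f g).1, (f g).2.1)) :
    DifferentiableAt ℝ (fun g => energyModel ℓ (f g)) g ∧
    ∀ δ, fderiv ℝ (fun g => energyModel ℓ (f g)) g δ =
      (w' δ).1 (baseFrame n N) + ∑ μ, (mom μ (w' δ) ((f g).2.1 (baseVec μ)) +
        mom μ (f g).2.2 (v' δ (baseVec μ))) -
      fderiv ℝ ℓ ((f g).1, (f g).2.1) (y' δ, v' δ) := by
  have h1 : HasFDerivAt (fun g => dualApply n N (baseFrame n N) (f g).2.2) _ g :=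
    (dualApply n N (baseFrame n N)).hasFDerivAt.comp g hw
  have h2 : ∀ μ : Fin (n + 1), ∃ D : G →L[ℝ] ℝ, HasFDerivAt
      (fun g => mom μ (f g).2.2 ((f g).2.1 (baseVec μ))) D g ∧
      ∀ δ, D δ = mom μ (w' δ) ((f g).2.1 (baseVec μ)) + mom μ (f g).2.2 (v' δ (baseVec μ)) := by
    intro μ
    have h3 : HasFDerivAt (fun g => mom μ (f g).2.2) ((mom μ).comp w') g :=
      (mom μ).hasFDerivAt.comp g hw
    have h4 := hv.clm_apply (hasFDerivAt_const (baseVec μ : BaseSp n) g)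
    refine ⟨_, h3.clm_apply h4, fun δ => ?_⟩
    rw [add_comm (mom μ (w' δ) _)]
    change mom μ (f g).2.2 ((f g).2.1 0 + v' δ (baseVec μ)) + _ = _
    rw [map_zero, zero_add]
    rfl
  choose D hD hDδ using h2
  have h3 : HasFDerivAt (fun g => ℓ ((f g).1, (f g).2.1)) _ g :=
    hℓ.hasFDerivAt.comp g (hy.prodMk hv)
  have h4 := (h1.add (HasFDerivAt.fun_sum fun μ (_ : μ ∈ Finset.univ) => hD μ)).sub h3
  have h5 := h4.congr_of_eventuallyEq (f₁ := fun g => energyModel ℓ (f g))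
    (Filter.Eventually.of_forall fun g => energyModel_eq ℓ (f g))
  refine ⟨h5.differentiableAt, fun δ => ?_⟩
  rw [h5.fderiv, ← Finset.sum_congr rfl fun μ _ => hDδ μ δ, ← sum_apply]
  rfl

theorem fderiv_energyModel {ℓ : JetSp n N → ℝ} {q : PontSp n N}
    (hℓ : DifferentiableAt ℝ ℓ (q.1, q.2.1)) :
    DifferentiableAt ℝ (energyModel ℓ) q ∧ ∀ δ, fderiv ℝ (energyModel ℓ) q δ =
      δ.2.2.1 (baseFrame n N) + ∑ μ, (mom μ δ.2.2 (q.2.1 (baseVec μ)) +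
        mom μ q.2.2 (δ.2.1 (baseVec μ))) - fderiv ℝ ℓ (q.1, q.2.1) (δ.1, δ.2.1) :=
  fderiv_energyModel_comp (f := fun q => q) hasFDerivAt_fst
    (hasFDerivAt_snd (𝕜 := ℝ) (p := q)).fst (hasFDerivAt_snd (𝕜 := ℝ) (p := q)).snd hℓ

/-- The horizontal form `𝓔 = E d^{n+1}x` in coordinates. -/
def energyFormModel (ℓ : JetSp n N → ℝ) (q : PontSp n N) : PontSp n N [⋀^Fin (n + 1)]→L[ℝ] ℝ :=
  energyModel ℓ q • (vol n).compContinuousLinearMap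
    ((ContinuousLinearMap.fst ℝ (BaseSp n) (FibSp N)).comp
      (ContinuousLinearMap.fst ℝ (TotSp n N) ((BaseSp n →L[ℝ] FibSp N) × DualModel n N)))

theorem energyFormModel_apply (ℓ : JetSp n N → ℝ) (q : PontSp n N)
    (u : Fin (n + 1) → PontSp n N) :
    energyFormModel ℓ q u = energyModel ℓ q * vol n fun i => (u i).1.1 := rfl

/-- The exterior derivative of `f d^{n+1}x`, contracted with a vertical vector. -/
theorem extDeriv_smul_vol {G : Type*} [NormedAddCommGroup G] [NormedSpace ℝ G] {f : G → ℝ}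
    {κ : G →L[ℝ] BaseSp n} {q : G} (hf : DifferentiableAt ℝ f q) {δ : G} (hδ : κ δ = 0)
    (T : Fin (n + 1) → G) (hT : ∀ μ, κ (T μ) = baseVec μ) :
    DifferentiableAt ℝ (fun q => f q • (vol n).compContinuousLinearMap κ) q ∧
    extDeriv (fun q => f q • (vol n).compContinuousLinearMap κ) q (Matrix.vecCons δ T) =
      fderiv ℝ f q δ := by
  have hd := hf.smul_const ((vol n).compContinuousLinearMap κ)
  refine ⟨hd, ?_⟩
  rw [extDeriv_vecCons hd]
  have h1 : ((vol n).compContinuousLinearMap κ) T = 1 := by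
    rw [← vol_baseVec (n := n)]
    exact congrArg (vol n) (funext hT)
  have h2 : ∀ j, ((vol n).compContinuousLinearMap κ) (update T j δ) = 0 := fun j =>
    (vol n).map_coord_zero j (by simp [hδ])
  simp [h1, h2]

theorem extDeriv_energyFormModel {ℓ : JetSp n N → ℝ} {q : PontSp n N}
    (hE : DifferentiableAt ℝ (energyModel ℓ) q) {δ : PontSp n N} (hδ : δ.1.1 = 0)
    (T : Fin (n + 1) → PontSp n N) (hT : ∀ μ, (T μ).1.1 = baseVec μ) :
    DifferentiableAt ℝ (energyFormModel ℓ) q ∧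
    extDeriv (energyFormModel ℓ) q (Matrix.vecCons δ T) = fderiv ℝ (energyModel ℓ) q δ :=
  extDeriv_smul_vol hE hδ T hT

end Model

end

section

variable {n N : ℕ} {X Y F : Type*}
  [TopologicalSpace X] [ChartedSpace (BaseSp n) X]
  [TopologicalSpace Y] [ChartedSpace (TotSp n N) Y]
  [TopologicalSpace F] [ChartedSpace (FibSp N) F]
  {B : SmoothFiberBundle n N X Y F}
  [IsManifold 𝓘(ℝ, BaseSp n) ∞ X] [IsManifold 𝓘(ℝ, FibSp N) ∞ F]
  {η : DiffForm (BaseSp n) X (n + 1)} {L : JetBundle B → ℝ} {e : AdaptedChart B}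

/-! ### The generalized energy and the canonical form in bundle coordinates -/

/-- The coordinate Lagrangian is `L` times the coefficient of the volume form. -/
theorem localLagrangian_pFun {m : Pontryagin B} (hm : m ∈ e.pSource) :
    e.localLagrangian η L ((e.pFun m).1, (e.pFun m).2.1) =
      L m.toJet * coeffIn e.base η (e.base m.toBase) := by
  rw [e.localLagrangian_eq η L m.toJet (q := ((e.pFun m).1, (e.pFun m).2.1))
    (AdaptedChart.pFun_mem hm)]
  change L (jetInv e _ _) * coeffIn e.base η (e.pFun m).1.1 = _
  rw [AdaptedChart.pFun_fst_fst hm, ← totalFun_toJet hm]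
  congr 2
  exact (jetCoords B).totalInv_totalFun e _ (m := m.toJet) hm

/-- The generalized energy density is the model energy times `d^{n+1}x`. -/
theorem energyDensity_apply {m : Pontryagin B} (hm : m ∈ e.pSource)
    (u : Fin (n + 1) → BaseSp n) :
    (energyDensity η L m : BaseSp n [⋀^Fin (n + 1)]→L[ℝ] ℝ) u =
      energyModel (e.localLagrangian η L) (e.pFun m) *
        vol n fun i => (e.dbase m.toBase (u i) : BaseSp n) := by
  have hb := AdaptedChart.toBase_mem hm
  set b : Fin (n + 1) → BaseSp n := fun i => e.dbase m.toBase (u i) with hbdef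
  have h1 : (energyDensity η L m : BaseSp n [⋀^Fin (n + 1)]→L[ℝ] ℝ) u =
      m.form.1 (fun i => m.jet.1 (u i)) - L m.toJet * formAt η m.toBase u := rfl
  have h2 : m.form.1 (fun i => m.jet.1 (u i)) =
      (e.pFun m).2.2.1 (fun i => (baseVec i, (e.pFun m).2.1 (baseVec i))) * vol n b := by
    refine (form_apply_eq hm _).trans ?_
    refine Eq.trans ?_ (topForm_apply ((e.pFun m).2.2.1.compContinuousLinearMap
      ((ContinuousLinearMap.id ℝ (BaseSp n)).prod (e.pFun m).2.1)) b)
    exact congrArg (e.pFun m).2.2.1 (funext fun i => dchart_jet hm (u i))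
  have h3 : formAt η m.toBase u = coeffIn e.base η (e.base m.toBase) * vol n b := by
    rw [coeffIn, e.base.left_inv hb]
    refine Eq.trans ?_ (topForm_apply ((formAt η m.toBase).compContinuousLinearMap
      (e.dbaseSymm m.toBase)) b)
    exact congrArg (formAt η m.toBase)
      (funext fun i => (AdaptedChart.dbaseSymm_dbase hb (u i)).symm)
  rw [h1, h2, h3, energyModel, localLagrangian_pFun hm]
  ring

theorem hasMFDerivAt_pFun {m : Pontryagin B} (hm : m ∈ e.pSource) :
    HasMFDerivAt 𝓘(ℝ, PontSp n N) 𝓘(ℝ, PontSp n N) e.pFun m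
      (mfderiv 𝓘(ℝ, PontSp n N) 𝓘(ℝ, PontSp n N) e.pFun m) :=
  ((e.contMDiffOn_pFun.contMDiffAt (e.isOpen_pSource.mem_nhds hm)).mdifferentiableAt
    (by simp)).hasMFDerivAt

/-- The derivative of the coordinates on `M`, with values in the model space. -/
def AdaptedChart.dpFun (e : AdaptedChart B) (m : Pontryagin B) : PontSp n N →L[ℝ] PontSp n N :=
  mfderiv 𝓘(ℝ, PontSp n N) 𝓘(ℝ, PontSp n N) e.pFun m

theorem dchart_mfderiv_pt {m : Pontryagin B} (hm : m ∈ e.pSource) (u : PontSp n N) :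
    e.dchart m.pt (mfderiv 𝓘(ℝ, PontSp n N) 𝓘(ℝ, TotSp n N) Pontryagin.pt m u) =
      (e.dpFun m u).1 := by
  have h1 : HasMFDerivAt 𝓘(ℝ, PontSp n N) 𝓘(ℝ, TotSp n N) (Pontryagin.pt (B := B)) m _ :=
    ((contMDiff_pt (B := B)).mdifferentiableAt (by simp)).hasMFDerivAt
  have h2 : HasMFDerivAt 𝓘(ℝ, TotSp n N) 𝓘(ℝ, TotSp n N) e.chart m.pt (e.dchart m.pt) :=
    (e.mdiff_chart.mdifferentiableAt hm).hasMFDerivAt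
  let κ : PontSp n N →L[ℝ] TotSp n N := ContinuousLinearMap.fst ℝ (TotSp n N) _
  have h3 : HasMFDerivAt 𝓘(ℝ, PontSp n N) 𝓘(ℝ, TotSp n N) κ (e.pFun m) κ := κ.hasMFDerivAt
  have h4 := (h3.comp m (hasMFDerivAt_pFun hm)).congr_of_eventuallyEq
    (f₁ := e.chart ∘ Pontryagin.pt) (by
      filter_upwards [e.isOpen_pSource.mem_nhds hm] with m' hm'
      exact (AdaptedChart.pFun_fst hm').symm)
  exact congrArg (fun T : PontSp n N →L[ℝ] TotSp n N => T u)
    (hasMFDerivAt_unique (h2.comp m h1) h4)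

theorem dbase_mfderiv_toBase {m : Pontryagin B} (hm : m ∈ e.pSource) (u : PontSp n N) :
    e.dbase m.toBase (mfderiv 𝓘(ℝ, PontSp n N) 𝓘(ℝ, BaseSp n) Pontryagin.toBase m u) =
      (e.dpFun m u).1.1 := by
  rw [← dchart_mfderiv_pt hm, AdaptedChart.fst_dchart hm]
  have h1 : HasMFDerivAt 𝓘(ℝ, PontSp n N) 𝓘(ℝ, TotSp n N) (Pontryagin.pt (B := B)) m _ :=
    ((contMDiff_pt (B := B)).mdifferentiableAt (by simp)).hasMFDerivAt
  have h2 : HasMFDerivAt 𝓘(ℝ, TotSp n N) 𝓘(ℝ, BaseSp n) B.proj m.pt (B.dproj m.pt) :=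
    (B.contMDiff_proj.mdifferentiableAt (by simp)).hasMFDerivAt
  have h3 : mfderiv 𝓘(ℝ, PontSp n N) 𝓘(ℝ, BaseSp n) (Pontryagin.toBase (B := B)) m = _ :=
    (h2.comp _ h1).mfderiv
  exact congrArg (fun T : PontSp n N →L[ℝ] BaseSp n => e.dbase m.toBase (T u)) h3

theorem energyForm_apply {m : Pontryagin B} (hm : m ∈ e.pSource)
    (u : Fin (n + 1) → PontSp n N) :
    (energyForm η L m : PontSp n N [⋀^Fin (n + 1)]→L[ℝ] ℝ) u =
      energyFormModel (e.localLagrangian η L) (e.pFun m) fun i => e.dpFun m (u i) := by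
  rw [energyFormModel_apply]
  refine (energyDensity_apply hm fun i =>
    mfderiv 𝓘(ℝ, PontSp n N) 𝓘(ℝ, BaseSp n) Pontryagin.toBase m (u i)).trans ?_
  congr 2
  funext i
  exact dbase_mfderiv_toBase hm (u i)

/-- The coordinates on `Z` induced by an adapted chart. -/
def dualFun (e : AdaptedChart B) : DualBundle B → DualSp n N := (dualCoords B).totalFun e

theorem contMDiffOn_dualFun (e : AdaptedChart B) :
    ContMDiffOn 𝓘(ℝ, DualSp n N) 𝓘(ℝ, DualSp n N) ∞ (dualFun e)
      {z | z.pt ∈ e.chart.source} :=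
  (dualCoords B).contMDiffOn_totalFun e

theorem isOpen_dualSource (e : AdaptedChart B) :
    IsOpen {z : DualBundle B | z.pt ∈ e.chart.source} :=
  (dualCoords B).isOpen_source e

theorem canonicalForm_apply {z : DualBundle B} (hz : z.pt ∈ e.chart.source)
    (u : Fin (n + 1) → DualSp n N) :
    (canonicalForm B z : DualSp n N [⋀^Fin (n + 1)]→L[ℝ] ℝ) u =
      thetaModel n N (dualFun e z) fun i =>
        mfderiv 𝓘(ℝ, DualSp n N) 𝓘(ℝ, DualSp n N) (dualFun e) z (u i) := by
  have h1 : HasMFDerivAt 𝓘(ℝ, DualSp n N) 𝓘(ℝ, TotSp n N) (DualBundle.pt (B := B)) z _ :=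
    ((contMDiff_dualPt (B := B)).mdifferentiableAt (by simp)).hasMFDerivAt
  have h2 : HasMFDerivAt 𝓘(ℝ, TotSp n N) 𝓘(ℝ, TotSp n N) e.chart z.pt (e.dchart z.pt) :=
    (e.mdiff_chart.mdifferentiableAt hz).hasMFDerivAt
  have hO := (isOpen_dualSource e).mem_nhds hz
  have h0 : HasMFDerivAt 𝓘(ℝ, DualSp n N) 𝓘(ℝ, DualSp n N) (dualFun e) z _ :=
    (((contMDiffOn_dualFun e).contMDiffAt hO).mdifferentiableAt (by simp)).hasMFDerivAt
  have h3 : HasMFDerivAt 𝓘(ℝ, DualSp n N) 𝓘(ℝ, TotSp n N) (fun q : DualSp n N => q.1)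
      (dualFun e z) (ContinuousLinearMap.fst ℝ (TotSp n N) (DualModel n N)) :=
    (ContinuousLinearMap.fst ℝ (TotSp n N) (DualModel n N)).hasMFDerivAt
  have h4 := (h3.comp z h0).congr_of_eventuallyEq
    (f₁ := e.chart ∘ DualBundle.pt) (by
      filter_upwards [hO] with z' hz'
      exact ((dualCoords B).fst_totalFun e (m := z') hz').symm)
  have h5 := hasMFDerivAt_unique (h2.comp z h1) h4
  have h6 : dualFun e z = (e.chart z.pt, e.dualEquiv z.pt hz z.form) :=
    (dualCoords B).totalFun_of_mem e (m := z) hz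
  have h7 : (dualFun e z).2 = e.dualEquiv z.pt hz z.form := by rw [h6]
  refine Eq.trans ?_ (congrArg (fun w : DualModel n N => w.1 fun i =>
    (show DualSp n N from
      mfderiv 𝓘(ℝ, DualSp n N) 𝓘(ℝ, DualSp n N) (dualFun e) z (u i)).1) h7).symm
  change z.form.1 (fun i => mfderiv 𝓘(ℝ, DualSp n N) 𝓘(ℝ, TotSp n N) DualBundle.pt z (u i)) =
    z.form.1 fun i => e.dchartSymm z.pt
      (mfderiv 𝓘(ℝ, DualSp n N) 𝓘(ℝ, DualSp n N) (dualFun e) z (u i)).1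
  congr 1
  funext i
  have h8 := congrArg (fun T : DualSp n N →L[ℝ] TotSp n N => T (u i)) h5
  exact (AdaptedChart.dchartSymm_dchart hz _).symm.trans (congrArg (e.dchartSymm z.pt) h8)

theorem mfderiv_dualFun_toDual {m : Pontryagin B} (hm : m ∈ e.pSource) (u : PontSp n N) :
    (mfderiv 𝓘(ℝ, DualSp n N) 𝓘(ℝ, DualSp n N) (dualFun e) m.toDual
      (mfderiv 𝓘(ℝ, PontSp n N) 𝓘(ℝ, DualSp n N) Pontryagin.toDual m u) : DualSp n N) =
      ((e.dpFun m u).1, (e.dpFun m u).2.2) := by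
  have h1 : HasMFDerivAt 𝓘(ℝ, PontSp n N) 𝓘(ℝ, DualSp n N) (Pontryagin.toDual (B := B)) m _ :=
    ((contMDiff_toDual (B := B)).mdifferentiableAt (by simp)).hasMFDerivAt
  have hz : m.toDual ∈ {z : DualBundle B | z.pt ∈ e.chart.source} := hm
  have h0 : HasMFDerivAt 𝓘(ℝ, DualSp n N) 𝓘(ℝ, DualSp n N) (dualFun e) m.toDual _ :=
    (((contMDiffOn_dualFun e).contMDiffAt
      ((isOpen_dualSource e).mem_nhds hz)).mdifferentiableAt (by simp)).hasMFDerivAt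
  let κ : PontSp n N →L[ℝ] DualSp n N := (ContinuousLinearMap.fst ℝ (TotSp n N) _).prod
    ((ContinuousLinearMap.snd ℝ (BaseSp n →L[ℝ] FibSp N) (DualModel n N)).comp
      (ContinuousLinearMap.snd ℝ (TotSp n N) _))
  have h3 : HasMFDerivAt 𝓘(ℝ, PontSp n N) 𝓘(ℝ, DualSp n N) κ (e.pFun m) κ := κ.hasMFDerivAt
  have h4 := (h3.comp m (hasMFDerivAt_pFun hm)).congr_of_eventuallyEq
    (f₁ := dualFun e ∘ Pontryagin.toDual) (by
      filter_upwards [e.isOpen_pSource.mem_nhds hm] with m' hm'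
      exact totalFun_toDual hm')
  exact congrArg (fun T : PontSp n N →L[ℝ] DualSp n N => T u)
    (hasMFDerivAt_unique (h0.comp m h1) h4)

/-! ### The contracted form `ψ^*(V ⌟ Ω_𝓔)` in bundle coordinates -/

/-- In bundle coordinates `Ω_𝓔` is the exterior derivative of the model energy form minus that
of the model canonical form. -/
theorem omegaE_apply {m : Pontryagin B} (hm : m ∈ e.pSource) (u : Fin (n + 1 + 1) → PontSp n N)
    (hE : DifferentiableAt ℝ (energyFormModel (e.localLagrangian η L)) (e.pFun m)) :
    (omegaE η L m : PontSp n N [⋀^Fin (n + 1 + 1)]→L[ℝ] ℝ) u =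
      extDeriv (energyFormModel (e.localLagrangian η L)) (e.pFun m)
        (fun i => e.dpFun m (u i)) -
      extDeriv (thetaModel n N) ((e.pFun m).1, (e.pFun m).2.2)
        (fun i => ((e.dpFun m (u i)).1, (e.dpFun m (u i)).2.2)) := by
  have h1 : (omegaE η L m : PontSp n N [⋀^Fin (n + 1 + 1)]→L[ℝ] ℝ) u =
      -(dform (canonicalForm B) m.toDual : DualSp n N [⋀^Fin (n + 1 + 1)]→L[ℝ] ℝ)
        (fun i => mfderiv 𝓘(ℝ, PontSp n N) 𝓘(ℝ, DualSp n N) Pontryagin.toDual m (u i)) +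
      (dform (energyForm η L) m : PontSp n N [⋀^Fin (n + 1 + 1)]→L[ℝ] ℝ) u := rfl
  have h2 := dform_apply_of_eventuallyEq (α := energyForm η L) (φ := e.pFun)
    e.isOpen_pSource hm e.contMDiffOn_pFun (fun m' hm' u => energyForm_apply hm' u) hE u
  have hz : m.toDual ∈ {z : DualBundle B | z.pt ∈ e.chart.source} := hm
  have h3 := dform_apply_of_eventuallyEq (α := canonicalForm B) (φ := dualFun e)
    (isOpen_dualSource e) hz (contMDiffOn_dualFun e) (fun m' hm' u => canonicalForm_apply hm' u)
    (differentiable_thetaModel _)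
    (fun i => mfderiv 𝓘(ℝ, PontSp n N) 𝓘(ℝ, DualSp n N) Pontryagin.toDual m (u i))
  have h4 : dualFun e m.toDual = ((e.pFun m).1, (e.pFun m).2.2) := totalFun_toDual hm
  have h5 := congrArg₂ (fun q (v : Fin (n + 1 + 1) → DualSp n N) => extDeriv (thetaModel n N) q v)
    h4 (funext fun i => mfderiv_dualFun_toDual hm (u i))
  refine h1.trans ((congrArg₂ (fun s t : ℝ => -s + t) (h3.trans h5) h2).trans ?_)
  exact neg_add_eq_sub _ _

theorem differentiableAt_localLagrangian (hη : IsVolumeForm η)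
    (hL : ContMDiff 𝓘(ℝ, JetSp n N) 𝓘(ℝ, ℝ) ∞ L) {m : Pontryagin B} (hm : m ∈ e.pSource) :
    DifferentiableAt ℝ (e.localLagrangian η L) ((e.pFun m).1, (e.pFun m).2.1) :=
  ((e.contDiffOn_localLagrangian hη hL m.toJet).contDiffAt
    ((e.chart.open_target.preimage continuous_fst).mem_nhds
      (AdaptedChart.pFun_mem hm))).differentiableAt (by simp)

theorem dpFun_mfderiv_section {ψ : X → Pontryagin B} (hψ : IsSmoothSection ψ) {a : BaseSp n}
    (ha : a ∈ sectionDomain e e.base ψ) (v : BaseSp n) :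
    e.dpFun (ψ (e.base.symm a)) (mfderiv 𝓘(ℝ, BaseSp n) 𝓘(ℝ, PontSp n N) ψ (e.base.symm a)
      (mfderiv 𝓘(ℝ, BaseSp n) 𝓘(ℝ, BaseSp n) e.base.symm a v)) =
      fderiv ℝ (localSection e e.base ψ) a v := by
  have h0 := hasMFDerivAt_chart_symm e.isSmoothChart_base ha.1
  have h1 : HasMFDerivAt 𝓘(ℝ, BaseSp n) 𝓘(ℝ, PontSp n N) ψ (e.base.symm a) _ :=
    (hψ.1.mdifferentiableAt (by simp)).hasMFDerivAt
  have h2 : HasMFDerivAt 𝓘(ℝ, BaseSp n) 𝓘(ℝ, PontSp n N) (localSection e e.base ψ) a _ :=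
    ((hasMFDerivAt_pFun ha.2).comp (e.base.symm a) h1).comp a h0
  rw [← mfderiv_eq_fderiv, h2.mfderiv]
  rfl

/-- The coefficient of `ψ^*(V ⌟ Ω_𝓔)` is minus the Euler-Lagrange expression in the direction of
the vertical vector field `V`. -/
theorem coeffIn_pullback_contract (hη : IsVolumeForm η)
    (hL : ContMDiff 𝓘(ℝ, JetSp n N) 𝓘(ℝ, ℝ) ∞ L) {ψ : X → Pontryagin B}
    (hψ : IsSmoothSection ψ) {a : BaseSp n} (ha : a ∈ sectionDomain e e.base ψ)
    {V : ∀ m : Pontryagin B, TangentSpace 𝓘(ℝ, PontSp n N) m} {δ : PontSp n N}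
    (hδ : e.dpFun (ψ (e.base.symm a)) (V (ψ (e.base.symm a))) = δ) (hδ0 : δ.1.1 = 0) :
    coeffIn e.base (pullback (E := BaseSp n) ψ (contract V (omegaE η L))) a =
      -eulerLagrange (e.localLagrangian η L) (localSection e e.base ψ) a δ := by
  set m := ψ (e.base.symm a) with hmdef
  have hm : m ∈ e.pSource := ha.2
  have hQ : e.pFun m = localSection e e.base ψ a := rfl
  set T : Fin (n + 1) → PontSp n N := fun μ => fderiv ℝ (localSection e e.base ψ) a (baseVec μ)
    with hTdef
  set h : Fin (n + 1) → FibSp N := fun μ =>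
    fderiv ℝ (fun b => (localSection e e.base ψ b).1.2) a (baseVec μ) with hhdef
  have hdQ : HasFDerivAt (localSection e e.base ψ) (fderiv ℝ (localSection e e.base ψ) a) a :=
    ((hψ.contDiffAt_localSection e.isSmoothChart_base ha).differentiableAt
      (by simp)).hasFDerivAt
  have hT1 : ∀ μ, (T μ).1 = (baseVec μ, h μ) := fun μ => by
    rw [← fderiv_localSection_fst hψ ha (baseVec μ)]
    have h1 : HasFDerivAt (fun b => (localSection e e.base ψ b).1) _ a := hdQ.fst
    rw [h1.fderiv]; rfl
  have hT2 : ∀ μ, (T μ).2.2 =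
      fderiv ℝ (fun b => (localSection e e.base ψ b).2.2) a (baseVec μ) := fun μ => by
    have h0 : HasFDerivAt (fun b => (localSection e e.base ψ b).2) _ a := hdQ.snd
    have h1 : HasFDerivAt (fun b => (localSection e e.base ψ b).2.2) _ a := h0.snd
    rw [h1.fderiv]; rfl
  obtain ⟨hE, hE'⟩ := fderiv_energyModel (differentiableAt_localLagrangian hη hL hm)
  obtain ⟨hEF, hEF'⟩ := extDeriv_energyFormModel hE hδ0 T (fun μ => by rw [hT1])
  have h1 : coeffIn e.base (pullback (E := BaseSp n) ψ (contract V (omegaE η L))) a =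
      (omegaE η L m : PontSp n N [⋀^Fin (n + 1 + 1)]→L[ℝ] ℝ)
        (Matrix.vecCons (V m) fun μ => mfderiv 𝓘(ℝ, BaseSp n) 𝓘(ℝ, PontSp n N) ψ
          (e.base.symm a) (chartFrame e.base a μ)) := rfl
  have hcons : ∀ u : Fin (n + 1) → PontSp n N, (∀ μ, e.dpFun m (u μ) = T μ) →
      (fun i => e.dpFun m (Matrix.vecCons (V m : PontSp n N) u i)) = Matrix.vecCons δ T := by
    intro u hu
    funext i
    refine Fin.cases ?_ (fun i => ?_) i
    · exact hδ
    · exact hu i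
  have hcons' : (fun i => ((Matrix.vecCons δ T i).1, (Matrix.vecCons δ T i).2.2)) =
      (Matrix.vecCons ((δ.1, δ.2.2) : DualSp n N) fun μ => ((T μ).1, (T μ).2.2)) := by
    funext i
    refine Fin.cases ?_ (fun i => ?_) i <;> rfl
  have h2 := omegaE_apply hm (Matrix.vecCons (V m : PontSp n N) fun μ =>
    mfderiv 𝓘(ℝ, BaseSp n) 𝓘(ℝ, PontSp n N) ψ (e.base.symm a) (chartFrame e.base a μ)) hEF
  have h3 := hcons (fun μ => mfderiv 𝓘(ℝ, BaseSp n) 𝓘(ℝ, PontSp n N) ψ (e.base.symm a)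
    (chartFrame e.base a μ)) fun μ => dpFun_mfderiv_section hψ ha (baseVec μ)
  have h4 : (fun i => ((e.dpFun m (Matrix.vecCons (V m : PontSp n N) (fun μ =>
      mfderiv 𝓘(ℝ, BaseSp n) 𝓘(ℝ, PontSp n N) ψ (e.base.symm a) (chartFrame e.base a μ)) i)).1,
      (e.dpFun m (Matrix.vecCons (V m : PontSp n N) (fun μ =>
      mfderiv 𝓘(ℝ, BaseSp n) 𝓘(ℝ, PontSp n N) ψ (e.base.symm a)
        (chartFrame e.base a μ)) i)).2.2)) =
      (Matrix.vecCons ((δ.1, δ.2.2) : DualSp n N) fun μ => ((T μ).1, (T μ).2.2)) := by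
    rw [← hcons']
    funext i
    exact congrArg (fun q : PontSp n N => (q.1, q.2.2)) (congrFun h3 i)
  rw [h3, h4, hEF', hE', extDeriv_thetaModel _ _ hδ0 _ h hT1] at h2
  refine (h1.trans h2).trans ?_
  simp only [hT2, hQ, eulerLagrange, map_sub, Finset.sum_add_distrib, Finset.sum_sub_distrib]
  ring

end

section

variable {n N : ℕ} {X Y F : Type*}
  [TopologicalSpace X] [ChartedSpace (BaseSp n) X]
  [TopologicalSpace Y] [ChartedSpace (TotSp n N) Y]
  [TopologicalSpace F] [ChartedSpace (FibSp N) F]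
  {B : SmoothFiberBundle n N X Y F}
  [IsManifold 𝓘(ℝ, BaseSp n) ∞ X] [IsManifold 𝓘(ℝ, FibSp N) ∞ F]
  {η : DiffForm (BaseSp n) X (n + 1)} {L : JetBundle B → ℝ} {e : AdaptedChart B}

/-! ### Vertical vector fields and the intrinsic equation -/

theorem contMDiff_smul_vectorField {E : Type*} [NormedAddCommGroup E] [NormedSpace ℝ E]
    {P : Type*} [TopologicalSpace P] [ChartedSpace E P] [IsManifold 𝓘(ℝ, E) ∞ P]
    [IsManifold 𝓘(ℝ, E) 1 P] {g : P → ℝ} {s : ∀ p : P, TangentSpace 𝓘(ℝ, E) p} {O : Set P}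
    (hO : IsOpen O) (hg : ContMDiff 𝓘(ℝ, E) 𝓘(ℝ, ℝ) ∞ g) (hgO : tsupport g ⊆ O)
    (hs : ContMDiffOn 𝓘(ℝ, E) 𝓘(ℝ, E).tangent ∞
      (fun p => (⟨p, s p⟩ : TangentBundle 𝓘(ℝ, E) P)) O) :
    ContMDiff 𝓘(ℝ, E) 𝓘(ℝ, E).tangent ∞
      (fun p => (⟨p, g p • s p⟩ : TangentBundle 𝓘(ℝ, E) P)) :=
  ContMDiffOn.smul_section_of_tsupport hg.contMDiffOn hO hgO hs

theorem dpFun_mfderiv_pInv (m₀ : Pontryagin B) {q : PontSp n N} (hq : q ∈ e.pTarget)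
    (δ : PontSp n N) :
    e.dpFun (e.pInv m₀ q) (mfderiv 𝓘(ℝ, PontSp n N) 𝓘(ℝ, PontSp n N) (e.pInv m₀) q δ) = δ := by
  have hO : e.pTarget ∈ 𝓝 q := AdaptedChart.isOpen_pTarget.mem_nhds hq
  have h1 : HasMFDerivAt 𝓘(ℝ, PontSp n N) 𝓘(ℝ, PontSp n N) (e.pInv m₀) q _ :=
    (((e.contMDiffOn_pInv m₀).contMDiffAt hO).mdifferentiableAt (by simp)).hasMFDerivAt
  have h2 := (hasMFDerivAt_pFun (AdaptedChart.pInv_mem m₀ hq)).comp q h1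
  have h3 := (hasMFDerivAt_id (I := 𝓘(ℝ, PontSp n N)) q).congr_of_eventuallyEq
    (f₁ := e.pFun ∘ e.pInv m₀) (by
      filter_upwards [hO] with q' hq'
      exact AdaptedChart.pFun_pInv m₀ hq')
  exact congrArg (fun T : PontSp n N →L[ℝ] PontSp n N => T δ) (hasMFDerivAt_unique h2 h3)

/-- The coordinate vector field on `M` with constant components `δ`, as a section of the tangent
bundle, is smooth on the coordinate domain. -/
theorem contMDiffOn_coordField (m₀ : Pontryagin B) (δ : PontSp n N) :
    ContMDiffOn 𝓘(ℝ, PontSp n N) 𝓘(ℝ, PontSp n N).tangent ∞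
      (fun m => (⟨m, (mfderiv 𝓘(ℝ, PontSp n N) 𝓘(ℝ, PontSp n N) (e.pInv m₀) (e.pFun m) :
        PontSp n N →L[ℝ] PontSp n N) δ⟩ : TangentBundle 𝓘(ℝ, PontSp n N) (Pontryagin B)))
      e.pSource := by
  have hO : IsOpen e.pTarget := AdaptedChart.isOpen_pTarget
  have h1 : ContMDiff 𝓘(ℝ, PontSp n N) 𝓘(ℝ, PontSp n N).tangent ∞
      (fun q => (⟨q, δ⟩ : TangentBundle 𝓘(ℝ, PontSp n N) (PontSp n N))) :=
    contMDiff_vectorSpace_iff_contDiff.2 (contDiff_const (c := δ))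
  have h2 := (e.contMDiffOn_pInv m₀).contMDiffOn_tangentMapWithin (m := ∞) (by simp)
    hO.uniqueMDiffOn
  have h3 := h2.comp (h1.comp_contMDiffOn e.contMDiffOn_pFun)
    fun m hm => AdaptedChart.pFun_mem hm
  refine h3.congr fun m hm => ?_
  have hq := AdaptedChart.pFun_mem hm
  have h4 : tangentMapWithin 𝓘(ℝ, PontSp n N) 𝓘(ℝ, PontSp n N) (e.pInv m₀) e.pTarget
      (⟨e.pFun m, δ⟩ : TangentBundle 𝓘(ℝ, PontSp n N) (PontSp n N)) =
      tangentMap 𝓘(ℝ, PontSp n N) 𝓘(ℝ, PontSp n N) (e.pInv m₀)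
        (⟨e.pFun m, δ⟩ : TangentBundle 𝓘(ℝ, PontSp n N) (PontSp n N)) :=
    tangentMapWithin_eq_tangentMap (hO.uniqueMDiffOn _ hq)
      (((e.contMDiffOn_pInv m₀).contMDiffAt (hO.mem_nhds hq)).mdifferentiableAt (by simp))
  refine Eq.trans ?_ h4.symm
  have key : ∀ (m m' : Pontryagin B) (u : PontSp n N), m = m' →
      (⟨m, u⟩ : TangentBundle 𝓘(ℝ, PontSp n N) (Pontryagin B)) = ⟨m', u⟩ := by
    rintro m _ u rfl; rfl
  exact key _ _ _ (AdaptedChart.pInv_pFun m₀ hm).symm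

variable [IsManifold 𝓘(ℝ, TotSp n N) ∞ Y] [T2Space Y]

theorem map_smul_eq_zero_of_map_eq_zero {E E' : Type*} [NormedAddCommGroup E] [NormedSpace ℝ E]
    [NormedAddCommGroup E'] [NormedSpace ℝ E'] (T : E →L[ℝ] E') (r : ℝ) {u : E} (h : T u = 0) :
    T (r • u) = 0 := by
  rw [map_smul, h, smul_zero]

theorem map_smul_eq_zero_of_eq_zero {E E' : Type*} [NormedAddCommGroup E] [NormedSpace ℝ E]
    [NormedAddCommGroup E'] [NormedSpace ℝ E'] (T : E →L[ℝ] E') {r : ℝ} (h : r = 0) (u : E) :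
    T (r • u) = 0 := by
  rw [h, zero_smul, map_zero]

/-- Every vertical tangent vector extends to a vertical vector field: cut off a coordinate field
by a bump function on `Y`. -/
theorem exists_isVerticalField {m₁ : Pontryagin B} (hm₁ : m₁ ∈ e.pSource) {δ : PontSp n N}
    (hδ : δ.1.1 = 0) :
    ∃ V : ∀ m : Pontryagin B, TangentSpace 𝓘(ℝ, PontSp n N) m,
      IsVerticalField V ∧ e.dpFun m₁ (V m₁) = δ := by
  obtain ⟨f, -, hf⟩ := (SmoothBumpFunction.nhds_basis_tsupport
    (I := 𝓘(ℝ, TotSp n N)) m₁.pt).mem_iff.1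
    (e.chart.open_source.mem_nhds hm₁)
  set s : ∀ m : Pontryagin B, TangentSpace 𝓘(ℝ, PontSp n N) m := fun m =>
    (mfderiv 𝓘(ℝ, PontSp n N) 𝓘(ℝ, PontSp n N) (e.pInv m₁) (e.pFun m) :
        PontSp n N →L[ℝ] PontSp n N) δ with hs
  set g : Pontryagin B → ℝ := fun m => f m.pt with hg
  have hgs : ContMDiff 𝓘(ℝ, PontSp n N) 𝓘(ℝ, ℝ) ∞ g := f.contMDiff.comp contMDiff_pt
  have hsupp : tsupport g ⊆ e.pSource := by
    intro m hm
    exact hf (closure_minimal (s := support g) (t := Pontryagin.pt ⁻¹' tsupport f)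
      (fun m' hm' => subset_tsupport f hm')
      ((isClosed_tsupport f).preimage (contMDiff_pt (B := B)).continuous) hm)
  have hval : ∀ m ∈ e.pSource, e.dpFun m (s m) = δ := by
    intro m hm
    have h1 := dpFun_mfderiv_pInv m₁ (AdaptedChart.pFun_mem hm) δ
    rwa [AdaptedChart.pInv_pFun m₁ hm] at h1
  refine ⟨fun m => g m • s m, ⟨?_, fun m => ?_⟩, ?_⟩
  · exact contMDiff_smul_vectorField e.isOpen_pSource hgs hsupp (contMDiffOn_coordField m₁ δ)
  · by_cases hm : m ∈ e.pSource
    · have hb := AdaptedChart.toBase_mem hm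
      have h1 : (mfderiv 𝓘(ℝ, PontSp n N) 𝓘(ℝ, BaseSp n) Pontryagin.toBase m (s m)) = 0 := by
        refine (AdaptedChart.dbaseSymm_dbase hb _).symm.trans ?_
        refine (congrArg (e.dbaseSymm m.toBase) ((dbase_mfderiv_toBase hm (s m)).trans ?_)).trans
          (map_zero _)
        rw [hval m hm]; exact hδ
      exact map_smul_eq_zero_of_map_eq_zero (E := PontSp n N) (E' := BaseSp n)
        (mfderiv 𝓘(ℝ, PontSp n N) 𝓘(ℝ, BaseSp n) Pontryagin.toBase m) (g m) h1
    · have h1 : g m = 0 := by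
        by_contra h
        exact hm (hsupp (subset_tsupport g h))
      exact map_smul_eq_zero_of_eq_zero (E := PontSp n N) (E' := BaseSp n)
        (mfderiv 𝓘(ℝ, PontSp n N) 𝓘(ℝ, BaseSp n) Pontryagin.toBase m) h1 (s m)
  · have h1 : g m₁ = 1 := f.eq_one
    change e.dpFun m₁ (g m₁ • s m₁) = δ
    rw [h1, one_smul]
    exact hval m₁ hm₁

theorem formAt_eq_zero_iff_coeffIn {c : OpenPartialHomeomorph X (BaseSp n)}
    (hc : IsSmoothChart c) (α : DiffForm (BaseSp n) X (n + 1)) {a : BaseSp n}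
    (ha : a ∈ c.target) : formAt α (c.symm a) = 0 ↔ coeffIn c α a = 0 := by
  constructor
  · intro h; rw [coeffIn, h]; rfl
  · intro h
    rw [coeffIn_eq_mul_vol] at h
    apply ContinuousAlternatingMap.ext
    intro v
    rw [topForm_apply, (mul_eq_zero.1 h).resolve_right (vol_chartFrame_ne_zero hc ha), zero_mul]
    rfl

/-- The intrinsic equation `ψ^*(V ⌟ Ω_𝓔) = 0` for all vertical `V` amounts to the vanishing of the
Euler-Lagrange expressions. -/
theorem satisfiesIntrinsicEquation_iff (hη : IsVolumeForm η)
    (hL : ContMDiff 𝓘(ℝ, JetSp n N) 𝓘(ℝ, ℝ) ∞ L) {ψ : X → Pontryagin B}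
    (hψ : IsSmoothSection ψ) :
    SatisfiesIntrinsicEquation η L ψ ↔ EulerLagrangeVanishes η L ψ := by
  have hdom : ∀ (e : AdaptedChart B) (x : X), ψ x ∈ e.pSource →
      e.base.symm (e.base x) = x ∧ e.base x ∈ sectionDomain e e.base ψ := by
    intro e x hx
    have hxs : x ∈ e.base.source := by
      have := AdaptedChart.toBase_mem hx
      rwa [hψ.2] at this
    have h1 := e.base.left_inv hxs
    exact ⟨h1, e.base.map_source hxs, by rwa [h1]⟩
  constructor
  · intro h e x hx δ hδ
    obtain ⟨h1, ha⟩ := hdom e x hx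
    obtain ⟨V, hV, hVδ⟩ := exists_isVerticalField ha.2 hδ
    have h2 := coeffIn_pullback_contract hη hL hψ ha hVδ hδ
    have h3 := (formAt_eq_zero_iff_coeffIn e.isSmoothChart_base
      (pullback (E := BaseSp n) ψ (contract V (omegaE η L))) ha.1).1 (h V hV _)
    rw [h3] at h2
    exact neg_eq_zero.1 h2.symm
  · intro h V hV x
    set e := prefChart B (ψ x).pt
    have hx : ψ x ∈ e.pSource := mem_prefChart_source (ψ x).pt
    obtain ⟨h1, ha⟩ := hdom e x hx
    have hδ : (e.dpFun (ψ (e.base.symm (e.base x)))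
        (V (ψ (e.base.symm (e.base x))))).1.1 = 0 :=
      (dbase_mfderiv_toBase ha.2 _).symm.trans
        ((congrArg (e.dbase _) (hV.2 _)).trans (map_zero _))
    have h2 := coeffIn_pullback_contract hη hL hψ ha (V := V) rfl hδ
    rw [h e x hx _ hδ, neg_zero] at h2
    have h3 := (formAt_eq_zero_iff_coeffIn e.isSmoothChart_base
      (pullback (E := BaseSp n) ψ (contract V (omegaE η L))) ha.1).2 h2
    rw [h1] at h3
    exact h3

end

section

variable {n N : ℕ} {X Y F : Type*}
  [TopologicalSpace X] [ChartedSpace (BaseSp n) X]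
  [TopologicalSpace Y] [ChartedSpace (TotSp n N) Y]
  [TopologicalSpace F] [ChartedSpace (FibSp N) F]
  {B : SmoothFiberBundle n N X Y F}
  {η : DiffForm (BaseSp n) X (n + 1)} {L : JetBundle B → ℝ} {e : AdaptedChart B}

/-! ### The implicit Euler-Lagrange equations in components -/

theorem fibSp_eq_sum (h : FibSp N) : h = ∑ A, h A • fibVec A := by
  have := (EuclideanSpace.basisFun (Fin N) ℝ).sum_repr h
  simpa [fibVec] using this.symm

theorem baseSp_eq_sum (u : BaseSp n) : u = ∑ μ, u μ • baseVec μ := by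
  have := (EuclideanSpace.basisFun (Fin (n + 1)) ℝ).sum_repr u
  simpa [baseVec] using this.symm

/-- The velocity direction `∂/∂v^A_μ`. -/
def velVec (A : Fin N) (μ : Fin (n + 1)) : BaseSp n →L[ℝ] FibSp N :=
  (EuclideanSpace.proj μ : BaseSp n →L[ℝ] ℝ).smulRight (fibVec A)

theorem velVec_baseVec (A : Fin N) (μ ν : Fin (n + 1)) :
    velVec A μ (baseVec ν) = if ν = μ then fibVec A else 0 := by
  change (baseVec ν : BaseSp n) μ • fibVec A = _
  by_cases h : ν = μ
  · subst h; simp [baseVec]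
  · simp [baseVec, h, Ne.symm h]

theorem vel_eq_sum (v : BaseSp n →L[ℝ] FibSp N) :
    v = ∑ A, ∑ μ, v (baseVec μ) A • velVec A μ := by
  ext1 u
  have h1 : ∀ (A : Fin N) μ, velVec A μ u = u μ • fibVec A := fun _ _ => rfl
  conv_lhs => rw [baseSp_eq_sum u]
  simp only [sum_apply, smul_apply, h1, map_sum, map_smul]
  rw [Finset.sum_comm]
  refine Finset.sum_congr rfl fun μ _ => ?_
  conv_lhs => rw [fibSp_eq_sum (v (baseVec μ)), Finset.smul_sum]
  exact Finset.sum_congr rfl fun A _ => smul_comm _ _ _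

theorem momentumCoord_eq {m : Pontryagin B} (hm : m ∈ e.pSource) (A : Fin N) (μ : Fin (n + 1)) :
    e.momentumCoord A μ m = mom μ (e.pFun m).2.2 (fibVec A) := by
  rw [AdaptedChart.pFun_of_mem hm, mom_apply]
  change m.form.1 (update (fun ν => e.dchartSymm m.pt (baseVec ν, 0)) μ
    (e.dchartSymm m.pt (0, fibVec A))) =
    m.form.1 (fun ν => e.dchartSymm m.pt (update (baseFrame n N) μ (0, fibVec A) ν))
  congr 1
  funext ν
  by_cases h : ν = μ
  · subst h; simp only [update_self]
  · simp only [update_of_ne h, baseFrame]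

theorem pCoord_eq {m : Pontryagin B} (hm : m ∈ e.pSource) :
    e.pCoord m = (e.pFun m).2.2.1 (baseFrame n N) := by
  rw [AdaptedChart.pFun_of_mem hm]; rfl

theorem vCoord_eq {m : Pontryagin B} (hm : m ∈ e.pSource) (A : Fin N) (μ : Fin (n + 1)) :
    e.vCoord A μ m = (e.pFun m).2.1 (baseVec μ) A := by
  rw [AdaptedChart.pFun_of_mem hm]; rfl

theorem yCoord_eq {m : Pontryagin B} (hm : m ∈ e.pSource) (A : Fin N) :
    e.yCoord A m = (e.pFun m).1.2 A := by
  rw [AdaptedChart.pFun_of_mem hm]; rfl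

theorem jetPoint_eq {m : Pontryagin B} (hm : m ∈ e.pSource) :
    e.jetPoint m = ((e.pFun m).1, (e.pFun m).2.1) := by
  rw [AdaptedChart.pFun_of_mem hm]; rfl

variable [IsManifold 𝓘(ℝ, BaseSp n) ∞ X] [IsManifold 𝓘(ℝ, FibSp N) ∞ F]

/-- The Euler-Lagrange expression vanishes in all vertical directions if and only if the implicit
Euler-Lagrange equations hold. -/
theorem forall_eulerLagrange_eq_zero_iff (ℓ : JetSp n N → ℝ) (Q : BaseSp n → PontSp n N)
    (a : BaseSp n) :
    (∀ δ : PontSp n N, δ.1.1 = 0 → eulerLagrange ℓ Q a δ = 0) ↔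
      (∀ μ, fderiv ℝ (fun b => (Q b).1.2) a (baseVec μ) = (Q a).2.1 (baseVec μ)) ∧
      (∀ A, ∑ μ, mom μ (fderiv ℝ (fun b => (Q b).2.2) a (baseVec μ)) (fibVec A) =
        fderiv ℝ ℓ ((Q a).1, (Q a).2.1) ((0, fibVec A), 0)) ∧
      (∀ A μ, mom μ (Q a).2.2 (fibVec A) =
        fderiv ℝ ℓ ((Q a).1, (Q a).2.1) (0, velVec A μ)) := by
  constructor
  · intro H
    refine ⟨?_, fun A => ?_, fun A μ => ?_⟩
    -- vary the momenta, the fibre coordinates and the velocities separately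
    · have h1 := mom_eq_zero_of_forall (h := fun μ =>
        fderiv ℝ (fun b => (Q b).1.2) a (baseVec μ) - (Q a).2.1 (baseVec μ)) fun w => by
          have h2 := H ((0, 0), (0, w)) rfl
          have h3 : (((0, 0), 0) : JetSp n N) = 0 := rfl
          simpa only [eulerLagrange, zero_apply, map_zero, sub_zero, h3, add_zero] using h2
      exact fun μ => sub_eq_zero.1 (congrFun h1 μ)
    · have h2 := H ((0, fibVec A), (0, 0)) rfl
      simp only [eulerLagrange, zero_apply, map_zero, sub_zero, zero_sub,
        Finset.sum_neg_distrib] at h2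
      linarith
    · have h2 := H ((0, 0), (velVec A μ, 0)) rfl
      have h3 : (((0, 0), velVec A μ) : JetSp n N) = (0, velVec A μ) := rfl
      simp only [eulerLagrange, zero_apply, map_zero, sub_zero, zero_sub, velVec_baseVec,
        Finset.sum_neg_distrib, h3, apply_ite (mom _ _), Finset.sum_ite_eq', Finset.mem_univ,
        if_true] at h2
      linarith
  · rintro ⟨h1, h2, h3⟩ ⟨⟨b, y⟩, v, w⟩ (rfl : b = 0)
    have hy : fderiv ℝ ℓ ((Q a).1, (Q a).2.1) ((0, y), 0) =
        ∑ μ, mom μ (fderiv ℝ (fun b => (Q b).2.2) a (baseVec μ)) y := by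
      have e1 : (((0, y), 0) : JetSp n N) = ∑ A, y A • (((0, fibVec A), 0) : JetSp n N) := by
        have := congrArg (fun y : FibSp N => (ContinuousLinearMap.inl ℝ (TotSp n N)
          (BaseSp n →L[ℝ] FibSp N)) (ContinuousLinearMap.inr ℝ (BaseSp n) (FibSp N) y))
          (fibSp_eq_sum y)
        simpa only [map_sum, map_smul, ContinuousLinearMap.inl_apply,
          ContinuousLinearMap.inr_apply] using this
      rw [e1, map_sum]
      conv_rhs => rw [fibSp_eq_sum y]
      simp only [map_sum, map_smul]
      rw [Finset.sum_comm]
      refine Finset.sum_congr rfl fun A _ => ?_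
      rw [← h2 A, Finset.smul_sum]
    have hv : fderiv ℝ ℓ ((Q a).1, (Q a).2.1) (0, v) =
        ∑ μ, mom μ (Q a).2.2 (v (baseVec μ)) := by
      have e1 : ((0, v) : JetSp n N) =
          ∑ A, ∑ μ, v (baseVec μ) A • ((0, velVec A μ) : JetSp n N) := by
        have := congrArg (ContinuousLinearMap.inr ℝ (TotSp n N)
          (BaseSp n →L[ℝ] FibSp N)) (vel_eq_sum v)
        simpa only [map_sum, map_smul, ContinuousLinearMap.inr_apply] using this
      rw [e1]
      simp only [map_sum, map_smul]
      rw [Finset.sum_comm]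
      refine Finset.sum_congr rfl fun μ _ => ?_
      conv_rhs => rw [fibSp_eq_sum (v (baseVec μ))]
      simp only [map_sum, map_smul, h3]
    have hsplit : (((0, y), v) : JetSp n N) = ((0, y), 0) + (0, v) := by simp
    simp only [eulerLagrange, h1, sub_self, map_zero, zero_sub]
    rw [hsplit, map_add, hy, hv, Finset.sum_sub_distrib, Finset.sum_neg_distrib]
    ring

theorem eulerLagrangeVanishes_iff {ψ : X → Pontryagin B} (hψ : IsSmoothSection ψ) :
    EulerLagrangeVanishes η L ψ ↔ ImplicitEulerLagrange η L ψ := by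
  refine forall_congr' fun e => forall_congr' fun x => ?_
  refine forall_congr' fun hx : ψ x ∈ e.pSource => ?_
  rw [forall_eulerLagrange_eq_zero_iff]
  have hc := e.isSmoothChart_base
  have hxs : x ∈ e.base.source := by
    have := AdaptedChart.toBase_mem hx
    rwa [hψ.2] at this
  set a := e.base x with ha_def
  have hax : e.base.symm a = x := e.base.left_inv hxs
  have ha : a ∈ sectionDomain e e.base ψ := ⟨e.base.map_source hxs, by rwa [hax]⟩
  have hQ : localSection e e.base ψ a = e.pFun (ψ x) := by rw [localSection, hax]
  have hD := (hψ.isOpen_sectionDomain hc (e := e)).mem_nhds ha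
  have hdQ := hψ.contDiffAt_localSection hc ha
  have hy : HasFDerivAt (fun b => (localSection e e.base ψ b).1.2) _ a :=
    (hdQ.fst.snd.differentiableAt (by simp)).hasFDerivAt
  have hw : HasFDerivAt (fun b => (localSection e e.base ψ b).2.2) _ a :=
    (hdQ.snd.snd.differentiableAt (by simp)).hasFDerivAt
  have hpy : ∀ A μ, e.partialX μ (fun x' => e.yCoord A (ψ x')) x =
      fderiv ℝ (fun b => (localSection e e.base ψ b).1.2) a (baseVec μ) A := by
    intro A μ
    have h1 : HasFDerivAt (fun b => e.yCoord A (ψ (e.base.symm b))) _ a :=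
      ((EuclideanSpace.proj A : FibSp N →L[ℝ] ℝ).hasFDerivAt.comp a hy).congr_of_eventuallyEq (by
        filter_upwards [hD] with b hb
        exact yCoord_eq hb.2 A)
    rw [AdaptedChart.partialX, h1.fderiv]
    rfl
  have hpw : ∀ A μ, e.partialX μ (fun x' => e.momentumCoord A μ (ψ x')) x =
      mom μ (fderiv ℝ (fun b => (localSection e e.base ψ b).2.2) a (baseVec μ)) (fibVec A) := by
    intro A μ
    have h1 : HasFDerivAt (fun b => e.momentumCoord A μ (ψ (e.base.symm b))) _ a :=
      (((mom μ).flip (fibVec A)).hasFDerivAt.comp a hw).congr_of_eventuallyEq (by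
        filter_upwards [hD] with b hb
        exact momentumCoord_eq hb.2 A μ)
    rw [AdaptedChart.partialX, h1.fderiv]
    rfl
  simp only [hpy, hpw, vCoord_eq hx, momentumCoord_eq hx, AdaptedChart.dLdy, AdaptedChart.dLdv,
    jetPoint_eq hx, hQ, velVec]
  refine and_congr ⟨fun h A μ => by rw [h], fun h μ => ?_⟩ Iff.rfl
  ext A
  exact h A μ

/-! ### The energy constraint and the covariant Legendre transformation -/

/-- The generalized energy in bundle coordinates is `p + p_A^μ v^A_μ - L`. -/
theorem energyModel_pFun {m : Pontryagin B} (hm : m ∈ e.pSource) :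
    energyModel (e.localLagrangian η L) (e.pFun m) = e.pCoord m +
      ∑ A, ∑ μ, e.momentumCoord A μ m * e.vCoord A μ m -
      e.localLagrangian η L (e.jetPoint m) := by
  rw [energyModel_eq, pCoord_eq hm, jetPoint_eq hm]
  congr 2
  simp only [momentumCoord_eq hm, vCoord_eq hm]
  rw [Finset.sum_comm]
  refine Finset.sum_congr rfl fun μ _ => ?_
  conv_lhs => rw [fibSp_eq_sum ((e.pFun m).2.1 (baseVec μ))]
  simp only [map_sum, map_smul, smul_eq_mul]
  exact Finset.sum_congr rfl fun A _ => mul_comm _ _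

theorem energyDensity_eq_zero_iff {m : Pontryagin B} (hm : m ∈ e.pSource) :
    energyDensity η L m = 0 ↔ energyModel (e.localLagrangian η L) (e.pFun m) = 0 := by
  constructor
  · intro h
    have h1 := energyDensity_apply (η := η) (L := L) hm
      fun μ => e.dbaseSymm m.toBase (baseVec μ)
    have h2 : (fun μ => (e.dbase m.toBase (e.dbaseSymm m.toBase (baseVec μ)) : BaseSp n)) =
        baseVec := funext fun μ =>
      AdaptedChart.dbase_dbaseSymm (AdaptedChart.toBase_mem hm) (baseVec μ)
    rw [h2, vol_baseVec, mul_one] at h1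
    rw [← h1, h]
    rfl
  · intro h
    apply ContinuousAlternatingMap.ext
    intro u
    refine (energyDensity_apply (e := e) hm u).trans ?_
    rw [h, zero_mul]
    rfl

/-- If the implicit Euler-Lagrange equations hold, then the energy constraint is equivalent to the
covariant Legendre transformation. -/
theorem energyConstraint_iff_covariantLegendre {ψ : X → Pontryagin B}
    (hEL : ImplicitEulerLagrange η L ψ) :
    EnergyConstraint η L ψ ↔ CovariantLegendre η L ψ := by
  have key : ∀ (e : AdaptedChart B) (x : X), ψ x ∈ e.pSource →
      (energyDensity η L (ψ x) = 0 ↔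
        e.pCoord (ψ x) = e.localLagrangian η L (e.jetPoint (ψ x)) -
          ∑ A, ∑ μ, e.dLdv η L A μ (ψ x) * e.vCoord A μ (ψ x)) := by
    intro e x hx
    rw [energyDensity_eq_zero_iff hx, energyModel_pFun hx]
    -- replace `p_A^μ` by `∂L/∂v^A_μ` in `p + p_A^μ v^A_μ - L = 0`
    simp only [(hEL e x hx).2.2]
    constructor <;> intro h <;> linarith
  constructor
  · exact fun h e x hx => ⟨(hEL e x hx).2.2, (key e x hx).1 (h x)⟩
  · intro h x
    obtain ⟨e, he⟩ := B.exists_adaptedChart (ψ x).pt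
    exact (key e x he).2 (h e x he).2

end

end HamiltonPontryagin

end

theorem mainTheorem1 {n N : ℕ} {X Y F : Type*}
    [TopologicalSpace X] [ChartedSpace (BaseSp n) X]
    [IsManifold 𝓘(ℝ, BaseSp n) ∞ X] [T2Space X] [SigmaCompactSpace X]
    [TopologicalSpace Y] [ChartedSpace (TotSp n N) Y]
    [IsManifold 𝓘(ℝ, TotSp n N) ∞ Y] [T2Space Y] [SigmaCompactSpace Y]
    [TopologicalSpace F] [ChartedSpace (FibSp N) F]
    [IsManifold 𝓘(ℝ, FibSp N) ∞ F]
    (B : SmoothFiberBundle n N X Y F)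
    (η : DiffForm (BaseSp n) X (n + 1))
    (hη : IsVolumeForm η)
    (L : JetBundle B → ℝ)
    (hL : ContMDiff 𝓘(ℝ, JetSp n N) 𝓘(ℝ, ℝ) ∞ L)
    (ψ : X → Pontryagin B)
    (hψ : IsSmoothSection ψ) :
    List.TFAE [
      IsCriticalPoint η L ψ,
      SatisfiesIntrinsicEquation η L ψ,
      ImplicitEulerLagrange η L ψ] ∧
    (EnergyConstraint η L ψ →
      List.TFAE [
        IsCriticalPoint η L ψ,
        SatisfiesIntrinsicEquation η L ψ,
        ImplicitEulerLagrange η L ψ ∧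
          CovariantLegendre η L ψ]) ∧
    (ImplicitEulerLagrange η L ψ ∧
        CovariantLegendre η L ψ →
      EnergyConstraint η L ψ) := by
  have h1 : IsCriticalPoint η L ψ ↔ HamiltonPontryagin.EulerLagrangeVanishes η L ψ :=
    ⟨HamiltonPontryagin.eulerLagrangeVanishes_of_isCriticalPoint hη hL hψ,
      HamiltonPontryagin.isCriticalPoint_of_eulerLagrangeVanishes hη hL hψ⟩
  have h2 := HamiltonPontryagin.satisfiesIntrinsicEquation_iff hη hL hψ
  have h3 := HamiltonPontryagin.eulerLagrangeVanishes_iff (η := η) (L := L) hψ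
  refine ⟨?_, fun hE => ?_, fun h =>
    (HamiltonPontryagin.energyConstraint_iff_covariantLegendre h.1).2 h.2⟩
  · tfae_have 1 ↔ 2 := h1.trans h2.symm
    tfae_have 2 ↔ 3 := h2.trans h3
    tfae_finish
  · have h4 : ImplicitEulerLagrange η L ψ ↔
        ImplicitEulerLagrange η L ψ ∧ CovariantLegendre η L ψ :=
      ⟨fun h => ⟨h, (HamiltonPontryagin.energyConstraint_iff_covariantLegendre h).1 hE⟩,
        fun h => h.1⟩
    tfae_have 1 ↔ 2 := h1.trans h2.symm
    tfae_have 2 ↔ 3 := (h2.trans h3).trans h4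
    tfae_finish
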